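/- Let $-1\le a_1<a_2<a_3<a_4\le 1$ and $\Gamma=[-1,a_1]\cup[a_2,a_3]\cup[a_4,1]$. Let $R_0(z)=\sqrt{z^2-1}$ on $\mathbb C\setminus[-1,1]$ with $R_0(z)\sim z$ as $z\to\infty$, and put $R_0(\zeta)=i\sqrt{1-\zeta^2}$ for $\zeta\in[-1,1]$. The genus-one defocusing NLS soliton condensate with spectral support $\Gamma$ is described by its density of states $u$ and density of fluxes $v$: real integrable functions on $\Gamma$ which solve the nonlinear dispersion relations with zero spectral scaling function, $$\int_\Gamma \ln\left|\frac{R_0(z)R_0(w)+wz-1}{z-w}\right|u(w)\,dw=|R_0(z)|,\qquad \int_\Gamma \ln\left|\frac{R_0(z)R_0(w)+wz-1}{z-w}\right|v(w)\,dw=2z|R_0(z)|,\qquad z\in\Gamma,$$ the integrals being absolutely convergent. The associated quasimomentum and quasienergy densities are $$\frac{dp}{dz}=\frac{z}{R_0(z)}-\frac{i}{R_0(z)}\int_\Gamma\frac{u(\zeta)R_0(\zeta)}{\zeta-z}\,d\zeta=1-\sum_{m\ge1}\frac{I_m}{z^{m+1}},$$ $$\frac{dq}{dz}=2R_0(z)+\frac{2z^2}{R_0(z)}-\frac{i}{R_0(z)}\int_\Gamma\frac{v(\zeta)R_0(\zeta)}{\zeta-z}\,d\zeta=4z-\sum_{m\ge1}\frac{J_m}{z^{m+1}}\qquad(z\to\infty).$$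 The averaged densities and fluxes of the condensate are defined by $$\langle|\psi|^2\rangle=-2I_1,\qquad \langle|\psi|^4+|\psi_x|^2\rangle=-\tfrac83 I_3,\qquad \langle|\psi|^4+2|\psi_x|^2\rangle=-2J_2,$$ so that $\langle|\psi|^4\rangle=-\tfrac{16}{3}I_3+2J_2$, and the kurtosis is $\kappa=\langle|\psi|^4\rangle/\langle|\psi|^2\rangle^2$. Theorem. Such a pair $(u,v)$ exists, and for every such pair $\langle|\psi|^2\rangle>0$, $C\mu+D\neq0$ and $$\kappa=\frac{A\mu+B}{3(C\mu+D)^2},$$ where $$\mu=\frac{E(m)}{K(m)},\qquad m=\frac{(a_3-a_4)(a_1-a_2)}{(a_2-a_4)(a_1-a_3)},$$ $$E(m)=\int_0^{\pi/2}\sqrt{1-m\sin^2y}\,dy,\qquad K(m)=\int_0^{\pi/2}\frac{dy}{\sqrt{1-m\sin^2y}},$$ $$A=-8(a_2-a_4)(a_1-a_3)\Big(4\sum_{j=1}^4a_j^2-\Big(\sum_{j=1}^4a_j\Big)^2\Big),$$ $$\begin{aligned}B={}&3a_1^4+(12a_2-12a_3-12a_4)a_1^3\\&+\big(2a_2^2+(-20a_3-20a_4)a_2+18a_3^2+20a_4a_3+18a_4^2\big)a_1^2\\&+\big(12a_2^3-4(a_3+a_4)(5a_2^2-5a_3a_2-5a_4a_2+3a_3^2+2a_4a_3+3a_4^2)\big)a_1\\&+3a_2^4+(-12a_3-12a_4)a_2^3+(18a_3^2+20a_4a_3+18a_4^2)a_2^2\\&+(-12a_3^3-20a_3^2a_4-20a_3a_4^2-12a_4^3)a_2\\&+3a_3^4+12a_3^3a_4+2a_3^2a_4^2+12a_3a_4^3+3a_4^4,\end{aligned}$$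 $$C=4(a_2-a_4)(a_1-a_3),\qquad D=-(a_1+a_2-a_3-a_4)^2.$$ -/

import Mathlib

open MeasureTheory Set

noncomputable section

namespace DefNLS

/-- Complete elliptic integral of the first kind, as a function of the parameter `m`. -/
def ellipticK (m : ℝ) : ℝ := ∫ y in (0 : ℝ)..(Real.pi / 2), 1 / √(1 - m * Real.sin y ^ 2)

/-- Complete elliptic integral of the second kind, as a function of the parameter `m`. -/
def ellipticE (m : ℝ) : ℝ := ∫ y in (0 : ℝ)..(Real.pi / 2), √(1 - m * Real.sin y ^ 2)

/-- `R₀(z) = (z² - 1)^{1/2}` on `ℂ \ [-1, 1]`, with the branch `R₀(z) ∼ z` at infinity: since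
`1 - 1/z²` is a non-positive real only for `z ∈ [-1, 1]`, the principal square root is analytic
there. -/
def R₀ (z : ℂ) : ℂ := z * (1 - 1 / z ^ 2) ^ (1 / 2 : ℂ)

/-- `|R₀(z)| = √(1 - z²)` on the cut `[-1, 1]`. -/
def absR₀ (z : ℝ) : ℝ := √(1 - z ^ 2)

/-- The value of `R₀` on the cut `[-1, 1]` (boundary value from the upper half plane). -/
def R₀cut (z : ℝ) : ℂ := Complex.I * (absR₀ z : ℂ)

/-- The kernel `log |(R₀(z) R₀(w) + w z - 1) / (z - w)|` of the nonlinear dispersion relations.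
For `z, w ∈ [-1, 1]` one has `R₀(z) R₀(w) = - |R₀(z)| |R₀(w)|`. -/
def kernel (z w : ℝ) : ℝ := Real.log |(-(absR₀ z * absR₀ w) + w * z - 1) / (z - w)|

/-- `u` is an integrable function on `Γ` which satisfies
`∫_Γ log |(R₀(z) R₀(w) + w z - 1) / (z - w)| u(w) dw + σ(z) u(z) = f(z)` for `z ∈ Γ`. -/
structure SolvesNDR (Γ : Set ℝ) (σ f u : ℝ → ℝ) : Prop where
  integrableOn : IntegrableOn u Γ
  kernel_integrableOn : ∀ z ∈ Γ, IntegrableOn (fun w => kernel z w * u w) Γ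
  equation : ∀ z ∈ Γ, (∫ w in Γ, kernel z w * u w) + σ z * u z = f z

/-- `u` is the density of states of the soliton gas with spectral support `Γ` and spectral scaling
function `σ`: it solves the first nonlinear dispersion relation. -/
def IsDOS (Γ : Set ℝ) (σ u : ℝ → ℝ) : Prop := SolvesNDR Γ σ absR₀ u

/-- `v` is the density of fluxes of the soliton gas with spectral support `Γ` and spectral scaling
function `σ`: it solves the second nonlinear dispersion relation. -/
def IsDOF (Γ : Set ℝ) (σ v : ℝ → ℝ) : Prop := SolvesNDR Γ σ (fun z => 2 * z * absR₀ z) v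

/-- `u` and `v` are the densities of states and of fluxes of the soliton condensate on `Γ`, that is,
of the soliton gas with `σ ≡ 0`. -/
structure IsCondensate (Γ : Set ℝ) (u v : ℝ → ℝ) : Prop where
  dos : IsDOS Γ (fun _ => 0) u
  dof : IsDOF Γ (fun _ => 0) v

/-- The density `dp/dz` of the quasimomentum differential of a soliton gas with density of
states `u` on `Γ`. -/
def dpdz (Γ : Set ℝ) (u : ℝ → ℝ) (z : ℂ) : ℂ :=
  z / R₀ z - Complex.I / R₀ z * ∫ ζ in Γ, (u ζ : ℂ) * R₀cut ζ / ((ζ : ℂ) - z)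

/-- The density `dq/dz` of the quasienergy differential of a soliton gas with density of
fluxes `v` on `Γ`. -/
def dqdz (Γ : Set ℝ) (v : ℝ → ℝ) (z : ℂ) : ℂ :=
  2 * R₀ z + 2 * z ^ 2 / R₀ z
    - Complex.I / R₀ z * ∫ ζ in Γ, (v ζ : ℂ) * R₀cut ζ / ((ζ : ℂ) - z)

/-- The coefficient of `z ^ (-(m + 1))` in the Laurent expansion at infinity of a function `f`
that is analytic for `|z| > 1`. -/
def laurentCoeff (f : ℂ → ℂ) (m : ℕ) : ℂ :=
  (2 * (Real.pi : ℂ) * Complex.I)⁻¹ * circleIntegral (fun z => z ^ m * f z) 0 2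

/-- `I_m`: `dp/dz = 1 - ∑_{m ≥ 1} I_m / z ^ (m + 1)` at infinity; `I_m` is real. -/
def coeffI (Γ : Set ℝ) (u : ℝ → ℝ) (m : ℕ) : ℝ := (-laurentCoeff (dpdz Γ u) m).re

/-- `J_m`: `dq/dz = 4 z - ∑_{m ≥ 1} J_m / z ^ (m + 1)` at infinity; `J_m` is real. -/
def coeffJ (Γ : Set ℝ) (v : ℝ → ℝ) (m : ℕ) : ℝ := (-laurentCoeff (dqdz Γ v) m).re

/-- The average of the density `f₁ = |ψ|²`. -/
def meanF₁ (Γ : Set ℝ) (u : ℝ → ℝ) : ℝ := -2 * coeffI Γ u 1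

/-- The average of the density `f₃ = |ψ|⁴ + |ψ_x|²`. -/
def meanF₃ (Γ : Set ℝ) (u : ℝ → ℝ) : ℝ := -(8 / 3) * coeffI Γ u 3

/-- The average of the flux `g₂ = |ψ|⁴ + 2 |ψ_x|²`. -/
def meanG₂ (Γ : Set ℝ) (v : ℝ → ℝ) : ℝ := -2 * coeffJ Γ v 2

/-- The average of `|ψ|²`. -/
def meanSq (Γ : Set ℝ) (u : ℝ → ℝ) : ℝ := meanF₁ Γ u

/-- The average of `|ψ|⁴ = 2 f₃ - g₂`. -/
def meanFourth (Γ : Set ℝ) (u v : ℝ → ℝ) : ℝ := 2 * meanF₃ Γ u - meanG₂ Γ v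

/-- The kurtosis: the average of `|ψ|⁴` over the square of the average of `|ψ|²`. -/
def kurtosis (Γ : Set ℝ) (u v : ℝ → ℝ) : ℝ := meanFourth Γ u v / meanSq Γ u ^ 2

/-- The spectral support `[-1, a₁] ∪ [a₂, a₃] ∪ [a₄, 1]` of a genus one condensate. -/
def genusOneSupport (a₁ a₂ a₃ a₄ : ℝ) : Set ℝ := Icc (-1) a₁ ∪ Icc a₂ a₃ ∪ Icc a₄ 1

end DefNLS

end

/-!
Write `P` for the monic quartic with roots `a₁, …, a₄`. The densities of the condensate are the
band values of `N / √P` for explicit polynomials `N`, and all averages are read off the expansions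
of such quotients at infinity.

The Joukowski map `ζ ↦ (ζ + ζ⁻¹) / 2` uniformizes the complement of `[-1, 1]` by the unit disk,
where `√P` becomes an explicit product of square roots. Let `G` be analytic in the disk with
boundary values `g` whose imaginary part is constant on each gap. The half-circle contour integral
of `G N / √P` then expresses the integral of `Re g` against the density on the bands through one
Taylor coefficient and the integrals of `N / √|P|` over the two gaps. For
`G ζ = log ((1 - ζ e ^ (i α)) / (1 - ζ e ^ (-i α)))` the real part of `g` is the kernel of the
nonlinear dispersion relations at `z = cos α`, so a numerator with vanishing gap integrals solves
them.

For `N = z² - (e₁ / 2) z + c` the substitution that maps the left gap to a quarter period turns the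
gap integral into `E` and `K`, and its vanishing determines `c`. The numerators needed for the right
hand sides `z |R₀|` and `z² |R₀|` differ from multiples of that one by derivatives of
`z ^ k √P`, whose gap integrals vanish.

Uniqueness of the condensate is not needed: the kernel is symmetric, so by Fubini the moments of
`u |R₀|` and `v |R₀|` that enter `I₁`, `I₃`, `J₂` are the same for all solutions. Positivity of
`⟨|ψ|²⟩ = -(C μ + D) / 4` follows from `μ < 1` and `C + D = -(a₁ - a₂ - a₃ + a₄)² ≤ 0`.
-/

namespace DefNLS

open Filter Topology ComplexConjugate Polynomial Asymptotics

/-- `f z = p z + O(z ^ n)` as `z → 0`, `z ≠ 0`: the polynomial `p` is an expansion of `f` to order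
`n` at the origin. Only the coefficients of `p` below `n` matter, and `f 0` is irrelevant. -/
def HasTaylor (f : ℂ → ℂ) (n : ℕ) (p : ℂ[X]) : Prop :=
  (fun z => f z - p.eval z) =O[𝓝[≠] 0] fun z => z ^ n

theorem isBigO_one_of_continuous {f : ℂ → ℂ} (hf : Continuous f) :
    f =O[𝓝[≠] 0] fun _ => (1 : ℂ) :=
  ((hf.tendsto 0).mono_left nhdsWithin_le_nhds).isBigO_one ℂ

theorem hasTaylor_eval (n : ℕ) (p : ℂ[X]) : HasTaylor (fun z => p.eval z) n p := by
  simpa only [HasTaylor, sub_self] using isBigO_zero _ _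

namespace HasTaylor

variable {f g : ℂ → ℂ} {n : ℕ} {p q : ℂ[X]}

theorem congr_fun (hf : HasTaylor f n p) (hfg : ∀ᶠ z in 𝓝[≠] 0, f z = g z) : HasTaylor g n p :=
  IsBigO.congr' hf (hfg.mono fun _ hz => congrArg (· - _) hz) EventuallyEq.rfl

theorem isBigO_one (hf : HasTaylor f n p) : f =O[𝓝[≠] 0] fun _ => (1 : ℂ) := by
  have hpow : (fun z : ℂ => z ^ n) =O[𝓝[≠] 0] fun _ => (1 : ℂ) :=
    isBigO_one_of_continuous (continuous_pow n)
  simpa using (IsBigO.trans hf hpow).add (isBigO_one_of_continuous p.continuous)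

theorem mul (hf : HasTaylor f n p) (hg : HasTaylor g n q) :
    HasTaylor (fun z => f z * g z) n (p * q) := by
  have hfg := (hf.isBigO_one.mul hg).add ((isBigO_one_of_continuous q.continuous).mul hf)
  refine (hfg.congr_left fun z => ?_).trans (by simpa using isBigO_refl _ _)
  rw [eval_mul]
  ring

theorem sub (hf : HasTaylor f n p) (hg : HasTaylor g n q) :
    HasTaylor (fun z => f z - g z) n (p - q) :=
  (IsBigO.sub hf hg).congr_left fun z => by rw [eval_sub]; ring

theorem mono {m : ℕ} (hf : HasTaylor f n p) (hmn : m ≤ n) : HasTaylor f m p := by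
  have h_pow : (fun z : ℂ => z ^ n) =O[𝓝[≠] 0] fun z : ℂ => z ^ m := by
    simpa only [← pow_add, Nat.add_sub_cancel' hmn, mul_one] using
      (isBigO_refl (fun z : ℂ => z ^ m) (𝓝[≠] 0)).mul
        (isBigO_one_of_continuous (continuous_pow (n - m)))
  exact IsBigO.trans hf h_pow

theorem of_eq_add {r : ℂ → ℂ} (hr : Continuous r)
    (h : ∀ z, z ≠ 0 → f z = p.eval z + z ^ n * r z) : HasTaylor f n p := by
  have h_rem : (fun z => z ^ n * r z) =O[𝓝[≠] 0] fun z : ℂ => z ^ n := by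
    simpa using (isBigO_refl (fun z : ℂ => z ^ n) (𝓝[≠] 0)).mul (isBigO_one_of_continuous hr)
  refine h_rem.congr' ?_ EventuallyEq.rfl
  filter_upwards [self_mem_nhdsWithin] with z hz
  rw [h z hz, add_sub_cancel_left]

theorem of_sq (h : HasTaylor (fun z => f z ^ 2) n (p ^ 2)) (hp : p.eval 0 ≠ 0)
    (hf : Tendsto f (𝓝[≠] 0) (𝓝 (p.eval 0))) : HasTaylor f n p := by
  have h_add : Tendsto (fun z => f z + p.eval z) (𝓝[≠] 0) (𝓝 (p.eval 0 + p.eval 0)) :=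
    hf.add ((p.continuous.tendsto 0).mono_left nhdsWithin_le_nhds)
  have h_ne : p.eval 0 + p.eval 0 ≠ 0 := by simpa only [← two_mul] using mul_ne_zero two_ne_zero hp
  refine (IsBigO.mul h ((h_add.inv₀ h_ne).isBigO_one ℂ)).congr' ?_ (by simp)
  filter_upwards [h_add.eventually_ne h_ne] with z hz
  rw [eval_pow]
  field_simp
  ring

theorem div (hf : HasTaylor f n (p * q)) (hg : HasTaylor g n q) {l : ℂ} (hl : l ≠ 0)
    (h : Tendsto g (𝓝[≠] 0) (𝓝 l)) : HasTaylor (fun z => f z / g z) n p := by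
  have h_num : (fun z => f z - p.eval z * g z) =O[𝓝[≠] 0] fun z => z ^ n := by
    refine (IsBigO.sub hf (((isBigO_one_of_continuous p.continuous).mul hg).trans
      (by simpa using isBigO_refl _ _))).congr_left fun z => ?_
    rw [eval_mul]
    ring
  refine (h_num.mul ((h.inv₀ hl).isBigO_one ℂ)).congr' ?_ (by simp)
  filter_upwards [h.eventually_ne hl] with z hz
  field_simp

end HasTaylor

section Residue

variable {f : ℂ → ℂ} {p : ℂ[X]} {n : ℕ} {r : ℝ}

theorem iteratedDeriv_eval (p : ℂ[X]) (n : ℕ) :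
    iteratedDeriv n (fun z => p.eval z) = fun z => (derivative^[n] p).eval z := by
  induction n with
  | zero => simp
  | succ n ih =>
    funext z
    rw [iteratedDeriv_succ, ih, Polynomial.deriv, Function.iterate_succ_apply']

theorem circleIntegral_eval_div_pow (hr : 0 < r) (p : ℂ[X]) (n : ℕ) :
    (∮ z in C(0, r), p.eval z / z ^ (n + 1)) = 2 * Real.pi * Complex.I * p.coeff n := by
  have hcauchy := p.differentiable.diffContOnCl.circleIntegral_one_div_sub_center_pow_smul
    (c := 0) hr n
  simp only [iteratedDeriv_eval] at hcauchy
  rw [← coeff_zero_eq_eval_zero, coeff_iterate_derivative, zero_add,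
    Nat.descFactorial_self] at hcauchy
  have hfac : (n.factorial : ℂ) ≠ 0 := mod_cast n.factorial_ne_zero
  simp only [sub_zero, smul_eq_mul, nsmul_eq_mul, one_div_mul_eq_div] at hcauchy
  rw [hcauchy]
  field_simp

theorem circleIntegral_eq_zero_of_isBigO_one (hr : 0 < r)
    (hd : ∀ z, ‖z‖ ≤ r → z ≠ 0 → DifferentiableAt ℂ f z)
    (hf : f =O[𝓝[≠] 0] fun _ => (1 : ℂ)) : (∮ z in C(0, r), f z) = 0 := by
  have hlim : Tendsto (fun z => z * f z) (𝓝[≠] 0) (𝓝 0) := by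
    have hid : Tendsto (fun z : ℂ => z * 1) (𝓝[≠] 0) (𝓝 0) :=
      (Continuous.tendsto' (by fun_prop) 0 0 (by simp)).mono_left nhdsWithin_le_nhds
    exact ((isBigO_refl (fun z : ℂ => z) _).mul hf).trans_tendsto hid
  have hd' : ∀ z, ‖z‖ ≤ r → z ≠ 0 → DifferentiableAt ℂ (fun z => z * f z) z :=
    fun z hz h0 => differentiableAt_id.mul (hd z hz h0)
  have hzero :=
    Complex.circleIntegral_sub_center_inv_smul_of_differentiable_on_off_countable_of_tendsto
      (c := 0) (f := fun z => z * f z) hr countable_empty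
      (fun z hz => (hd' z (by simpa using hz.1) hz.2).continuousAt.continuousWithinAt)
      (fun z hz => hd' z (by simpa using Metric.ball_subset_closedBall hz.1.1)
        (by simpa using hz.1.2)) hlim
  rw [smul_zero] at hzero
  refine (circleIntegral.integral_congr hr.le fun z hz => ?_).trans hzero
  have h0 : z ≠ 0 := by rintro rfl; simp [hr.ne] at hz
  simp [h0]

theorem circleIntegral_eq_of_hasTaylor (hr : 0 < r)
    (hd : ∀ z, ‖z‖ ≤ r → z ≠ 0 → DifferentiableAt ℂ f z)
    (hT : HasTaylor (fun z => z ^ (n + 1) * f z) (n + 1) p) :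
    (∮ z in C(0, r), f z) = 2 * Real.pi * Complex.I * p.coeff n := by
  have hdiv : ∀ z : ℂ, z ≠ 0 → DifferentiableAt ℂ (fun z => p.eval z / z ^ (n + 1)) z :=
    fun z h0 => p.differentiableAt.div (by fun_prop) (pow_ne_zero _ h0)
  have hsphere : ∀ g : ℂ → ℂ, (∀ z, ‖z‖ ≤ r → z ≠ 0 → DifferentiableAt ℂ g z) →
      CircleIntegrable g 0 r := fun g hg =>
    ContinuousOn.circleIntegrable hr.le fun z hz =>
      (hg z (by simpa using (mem_sphere_zero_iff_norm.mp hz).le)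
        (by rintro rfl; simp [hr.ne] at hz)).continuousAt.continuousWithinAt
  have hbdd : (fun z => f z - p.eval z / z ^ (n + 1)) =O[𝓝[≠] 0] fun _ => (1 : ℂ) := by
    refine (IsBigO.mul hT (isBigO_refl (fun z : ℂ => (z ^ (n + 1))⁻¹) _)).congr' ?_ ?_ <;>
    · filter_upwards [self_mem_nhdsWithin] with z hz
      have : z ≠ 0 := hz
      field_simp
  have hzero := circleIntegral_eq_zero_of_isBigO_one hr
    (fun z hz h0 => (hd z hz h0).fun_sub (hdiv z h0)) hbdd
  rw [circleIntegral.integral_sub (hsphere _ hd) (hsphere _ fun z _ => hdiv z),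
    circleIntegral_eval_div_pow hr] at hzero
  exact sub_eq_zero.mp hzero

theorem circleIntegral_eq_circleIntegral_inv (f : ℂ → ℂ) (hr : 0 < r) :
    (∮ z in C(0, r), f z) = ∮ w in C(0, r⁻¹), f w⁻¹ / w ^ 2 := by
  have hmap : ∀ θ : ℝ, circleMap 0 r (2 * Real.pi - θ) = (circleMap 0 r⁻¹ θ)⁻¹ := fun θ => by
    simp only [circleMap_zero, Complex.ofReal_inv, mul_inv, inv_inv, ← Complex.exp_neg,
      Complex.ofReal_sub, sub_mul, Complex.exp_sub]
    simp [Complex.exp_neg]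
  have hne : ∀ θ : ℝ, circleMap 0 r⁻¹ θ ≠ 0 := fun θ => by simp [circleMap_zero, hr.ne']
  simp only [circleIntegral, deriv_circleMap, smul_eq_mul]
  have hreflect := intervalIntegral.integral_comp_sub_left (a := 0) (b := 2 * Real.pi)
    (fun θ => circleMap 0 r θ * Complex.I * f (circleMap 0 r θ)) (2 * Real.pi)
  simp only [hmap, sub_self, sub_zero] at hreflect
  rw [← hreflect]
  refine intervalIntegral.integral_congr fun θ _ => ?_
  have := hne θ
  field_simp

theorem laurentCoeff_eq_coeff {m j : ℕ} (hd : ∀ z, 1 < ‖z‖ → DifferentiableAt ℂ f z)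
    (hT : HasTaylor (fun w => w ^ j * f w⁻¹) (m + j + 2) p) :
    laurentCoeff f m = p.coeff (m + j + 1) := by
  have hd' : ∀ w : ℂ, ‖w‖ ≤ 2⁻¹ → w ≠ 0 →
      DifferentiableAt ℂ (fun w => w⁻¹ ^ m * f w⁻¹ / w ^ 2) w := fun w hw h0 => by
    have hinv : 1 < ‖w⁻¹‖ := by
      rw [norm_inv, one_lt_inv₀ (norm_pos_iff.mpr h0)]
      linarith
    have := (hd w⁻¹ hinv).comp w (differentiableAt_inv h0)
    exact (((differentiableAt_inv h0).pow m).mul this).div (by fun_prop) (pow_ne_zero 2 h0)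
  have hT' : HasTaylor (fun w => w ^ (m + j + 1 + 1) * (w⁻¹ ^ m * f w⁻¹ / w ^ 2)) (m + j + 1 + 1)
      p := hT.congr_fun <| by
    filter_upwards [self_mem_nhdsWithin] with w hw
    have : w ≠ 0 := hw
    rw [inv_pow]
    field_simp
    ring
  rw [laurentCoeff, circleIntegral_eq_circleIntegral_inv _ two_pos,
    circleIntegral_eq_of_hasTaylor (by norm_num) hd' hT', inv_mul_cancel_left₀ (by simp)]

end Residue

theorem intervalIntegrable_abs_rpow {s : ℝ} (hs : -1 < s) (a b : ℝ) :
    IntervalIntegrable (fun x : ℝ => |x| ^ s) volume a b := by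
  have h_pos : ∀ c : ℝ, 0 ≤ c → IntervalIntegrable (fun x : ℝ => |x| ^ s) volume 0 c := by
    intro c hc
    refine (intervalIntegral.intervalIntegrable_rpow' hs (a := 0) (b := c)).congr ?_
    intro x hx
    rw [uIoc_of_le hc] at hx
    simp only [abs_of_pos hx.1]
  have h_all : ∀ c : ℝ, IntervalIntegrable (fun x : ℝ => |x| ^ s) volume 0 c := by
    intro c
    rcases le_total 0 c with hc | hc
    · exact h_pos c hc
    · simpa using (h_pos (-c) (by linarith)).comp_sub_left 0
  exact (h_all a).symm.trans (h_all b)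

theorem integrableOn_abs_sub_rpow {s : ℝ} (hs : -1 < s) (p a b : ℝ) :
    IntegrableOn (fun x : ℝ => |x - p| ^ s) (Icc a b) := by
  rcases le_total a b with hab | hab
  · rw [← intervalIntegrable_iff_integrableOn_Icc_of_le hab]
    simpa using (intervalIntegrable_abs_rpow hs (a - p) (b - p)).comp_sub_right p
  · exact (integrableOn_singleton (x := a) (by simp) (by simp)).mono_set
      fun x hx => le_antisymm (hx.2.trans hab) hx.1

theorem setIntegral_abs_sub_rpow_le {s : ℝ} (hs : -1 < s) {p : ℝ} (hp : p ∈ Icc (-1 : ℝ) 1) :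
    ∫ x in Icc (-1 : ℝ) 1, |x - p| ^ s ≤ ∫ x in (-2 : ℝ)..2, |x| ^ s := by
  rw [integral_Icc_eq_integral_Ioc, ← intervalIntegral.integral_of_le (by norm_num),
    intervalIntegral.integral_comp_sub_right (fun x => |x| ^ s)]
  refine intervalIntegral.integral_mono_interval (by linarith [hp.2]) (by linarith)
    (by linarith [hp.1]) (Eventually.of_forall fun x => ?_) (intervalIntegrable_abs_rpow hs _ _)
  exact Real.rpow_nonneg (abs_nonneg _) _

theorem locallyIntegrable_prod_abs_sub_rpow {s : ℝ} (hs : -1 < s) (S : Finset ℝ) :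
    LocallyIntegrable fun x : ℝ => ∏ p ∈ S, |x - p| ^ s := by
  have h_factor (p y : ℝ) (hp : p ≠ y) : ContinuousAt (fun x : ℝ => |x - p| ^ s) y :=
    (by fun_prop : ContinuousAt (fun x : ℝ => |x - p|) y).rpow_const
      (Or.inl (abs_ne_zero.mpr (sub_ne_zero.mpr hp.symm)))
  intro y
  set g : ℝ → ℝ := fun x => ∏ p ∈ S.erase y, |x - p| ^ s
  have hg : ContinuousAt g y :=
    tendsto_finsetProd _ fun p hp => h_factor p y (Finset.ne_of_mem_erase hp)
  have hgm : Measurable g := Finset.measurable_fun_prod _ fun p _ => by fun_prop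
  set t : Set ℝ := {x | ‖g x‖ ≤ ‖g y‖ + 1} ∩ Icc (y - 1) (y + 1)
  have ht : t ∈ 𝓝 y := inter_mem (hg.norm.eventually_le_const (lt_add_one ‖g y‖))
    (Icc_mem_nhds (by linarith) (by linarith))
  have htm : MeasurableSet t :=
    (measurableSet_le hgm.norm measurable_const).inter measurableSet_Icc
  have h_mul (f : ℝ → ℝ) (hf : IntegrableOn f (Icc (y - 1) (y + 1))) :
      IntegrableOn (fun x => f x * g x) t := by
    have hft : IntegrableOn f t := hf.mono_set inter_subset_right
    exact Integrable.mul_bdd hft hgm.aestronglyMeasurable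
      ((ae_restrict_mem htm).mono fun _ hx => hx.1)
  refine ⟨t, ht, ?_⟩
  by_cases hy : y ∈ S
  · simpa only [g, fun x => Finset.mul_prod_erase S (fun p => |x - p| ^ s) hy] using
      h_mul _ (integrableOn_abs_sub_rpow hs y _ _)
  · simpa only [g, Finset.erase_eq_of_notMem hy, one_mul] using
      h_mul (fun _ => 1) (integrableOn_const (by simp))

/-- `1 / √|P|` for the monic polynomial `P` whose simple roots are the points of `S`. -/
noncomputable def absInvRoot (S : Finset ℝ) (x : ℝ) : ℝ := ∏ p ∈ S, |x - p| ^ (-(1 / 2) : ℝ)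

theorem absInvRoot_nonneg (S : Finset ℝ) (x : ℝ) : 0 ≤ absInvRoot S x :=
  Finset.prod_nonneg fun _ _ => Real.rpow_nonneg (abs_nonneg _) _

theorem measurable_absInvRoot (S : Finset ℝ) : Measurable (absInvRoot S) :=
  Finset.measurable_fun_prod _ fun p _ => by fun_prop

theorem locallyIntegrable_absInvRoot (S : Finset ℝ) : LocallyIntegrable (absInvRoot S) :=
  locallyIntegrable_prod_abs_sub_rpow (by norm_num) S

/-- Young's inequality separates the singularity at `y` from those at `S`, uniformly in `y`. -/
theorem abs_sub_rpow_mul_absInvRoot_le (S : Finset ℝ) (x y : ℝ) :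
    |x - y| ^ (-(1 / 4) : ℝ) * absInvRoot S x ≤
      |x - y| ^ (-(3 / 4) : ℝ) + ∏ p ∈ S, |x - p| ^ (-(3 / 4) : ℝ) := by
  have h_conj : (3 : ℝ).HolderConjugate (3 / 2) := by
    constructor <;> norm_num
  have h_young := Real.young_inequality_of_nonneg
    (Real.rpow_nonneg (abs_nonneg (x - y)) (-(1 / 4))) (absInvRoot_nonneg S x) h_conj
  have h_prod : absInvRoot S x ^ (3 / 2 : ℝ) = ∏ p ∈ S, |x - p| ^ (-(3 / 4) : ℝ) := by
    rw [absInvRoot, ← Real.finsetProd_rpow _ _ fun p _ => Real.rpow_nonneg (abs_nonneg _) _]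
    refine Finset.prod_congr rfl fun p _ => ?_
    rw [← Real.rpow_mul (abs_nonneg _)]
    norm_num
  rw [h_prod, ← Real.rpow_mul (abs_nonneg _), show -(1 / 4) * (3 : ℝ) = -(3 / 4) by norm_num]
    at h_young
  have h₁ : 0 ≤ |x - y| ^ (-(3 / 4) : ℝ) := Real.rpow_nonneg (abs_nonneg _) _
  have h₂ : 0 ≤ ∏ p ∈ S, |x - p| ^ (-(3 / 4) : ℝ) :=
    Finset.prod_nonneg fun _ _ => Real.rpow_nonneg (abs_nonneg _) _
  linarith

theorem integrableOn_abs_sub_rpow_mul_absInvRoot (S : Finset ℝ) (y a b : ℝ) :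
    IntegrableOn (fun x => |x - y| ^ (-(1 / 4) : ℝ) * absInvRoot S x) (Icc a b) := by
  refine ((integrableOn_abs_sub_rpow (s := -(3 / 4)) (by norm_num) y a b).add
    ((locallyIntegrable_prod_abs_sub_rpow (s := -(3 / 4)) (by norm_num) S).integrableOn_isCompact
      isCompact_Icc)).mono' ?_ (Eventually.of_forall fun x => ?_)
  · have := measurable_absInvRoot S
    exact Measurable.aestronglyMeasurable (by fun_prop)
  · rw [Real.norm_of_nonneg (mul_nonneg (Real.rpow_nonneg (abs_nonneg _) _)
      (absInvRoot_nonneg S x))]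
    exact abs_sub_rpow_mul_absInvRoot_le S x y

theorem exists_setIntegral_abs_sub_rpow_mul_absInvRoot_le (S : Finset ℝ) :
    ∃ K, ∀ y ∈ Icc (-1 : ℝ) 1,
      ∫ x in Icc (-1) 1, |x - y| ^ (-(1 / 4) : ℝ) * absInvRoot S x ≤ K := by
  have hs : (-1 : ℝ) < -(3 / 4) := by norm_num
  have h_prod := (locallyIntegrable_prod_abs_sub_rpow hs S).integrableOn_isCompact
    (isCompact_Icc (a := (-1 : ℝ)) (b := 1))
  refine ⟨(∫ x in (-2 : ℝ)..2, |x| ^ (-(3 / 4) : ℝ)) +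
    ∫ x in Icc (-1) 1, ∏ p ∈ S, |x - p| ^ (-(3 / 4) : ℝ), fun y hy => ?_⟩
  calc ∫ x in Icc (-1) 1, |x - y| ^ (-(1 / 4) : ℝ) * absInvRoot S x
      ≤ ∫ x in Icc (-1) 1, (|x - y| ^ (-(3 / 4) : ℝ) + ∏ p ∈ S, |x - p| ^ (-(3 / 4) : ℝ)) :=
        setIntegral_mono (integrableOn_abs_sub_rpow_mul_absInvRoot S y _ _)
          ((integrableOn_abs_sub_rpow hs y _ _).add h_prod)
          fun x => abs_sub_rpow_mul_absInvRoot_le S x y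
    _ = (∫ x in Icc (-1) 1, |x - y| ^ (-(3 / 4) : ℝ)) +
          ∫ x in Icc (-1) 1, ∏ p ∈ S, |x - p| ^ (-(3 / 4) : ℝ) :=
        integral_add (integrableOn_abs_sub_rpow hs y _ _) h_prod
    _ ≤ _ := add_le_add_left (setIntegral_abs_sub_rpow_le hs hy) _

theorem kernel_comm (z w : ℝ) : kernel z w = kernel w z := by
  rw [kernel, kernel, abs_div, abs_div, abs_sub_comm z w, mul_comm (absR₀ z), mul_comm w z]

theorem kernel_eq_zero_of_sq_eq_one {z : ℝ} (hz : z ^ 2 = 1) (w : ℝ) : kernel z w = 0 := by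
  have h_num : (-(absR₀ z * absR₀ w) + w * z - 1) ^ 2 = (z - w) ^ 2 := by
    have : absR₀ z = 0 := by simp [absR₀, hz]
    rw [this]
    linear_combination (w ^ 2 - 1) * hz
  rw [kernel, abs_div, sq_eq_sq_iff_abs_eq_abs _ _ |>.mp h_num]
  rcases eq_or_ne |z - w| 0 with h | h
  · rw [h, div_zero, Real.log_zero]
  · rw [div_self h, Real.log_one]

theorem measurable_kernel : Measurable fun q : ℝ × ℝ => kernel q.1 q.2 := by
  unfold kernel absR₀
  fun_prop

theorem measurable_kernel_left (z : ℝ) : Measurable (kernel z) := by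
  unfold kernel absR₀
  fun_prop

theorem absR₀_mul_absR₀_le {z w : ℝ} (hz : z ∈ Icc (-1 : ℝ) 1) (hw : w ∈ Icc (-1 : ℝ) 1) :
    absR₀ z * absR₀ w ≤ 1 + w * z := by
  have hz' : 0 ≤ 1 - z ^ 2 := by nlinarith [hz.1, hz.2]
  rw [absR₀, absR₀, ← Real.sqrt_mul hz']
  refine Real.sqrt_le_iff.mpr ⟨?_, ?_⟩
  · nlinarith [hz.1, hz.2, hw.1, hw.2]
  · nlinarith [sq_nonneg (z + w)]

theorem abs_sub_le_one_sub_mul {z w : ℝ} (hz : z ∈ Icc (-1 : ℝ) 1) (hw : w ∈ Icc (-1 : ℝ) 1) :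
    |w - z| ≤ 1 - w * z := by
  rw [abs_le]
  constructor <;> nlinarith [hz.1, hz.2, hw.1, hw.2]

theorem log_two_div_le {d : ℝ} (hd : 0 < d) :
    Real.log (2 / d) ≤ 8 * d ^ (-(1 / 4) : ℝ) := by
  have h_log := Real.log_le_rpow_div (x := 2 / d) (by positivity) (ε := 1 / 4) (by norm_num)
  have h_two : (2 : ℝ) ^ (1 / 4 : ℝ) ≤ 2 :=
    Real.rpow_le_self_of_one_le (by norm_num) (by norm_num)
  rw [div_eq_mul_inv, Real.mul_rpow two_pos.le (by positivity), Real.inv_rpow hd.le,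
    ← Real.rpow_neg hd.le, ← div_eq_mul_inv] at h_log
  have := mul_le_mul_of_nonneg_right h_two (Real.rpow_nonneg hd.le (-(1 / 4)))
  linarith

theorem abs_kernel_le {z w : ℝ} (hz : z ∈ Icc (-1 : ℝ) 1) (hw : w ∈ Icc (-1 : ℝ) 1) :
    |kernel z w| ≤ 8 * |w - z| ^ (-(1 / 4) : ℝ) := by
  rcases eq_or_ne z w with rfl | hne
  · simp [kernel, Real.zero_rpow]
  have hpos : 0 < |w - z| := abs_pos.mpr (sub_ne_zero.mpr hne.symm)
  have h_nonneg : 0 ≤ absR₀ z * absR₀ w := mul_nonneg (Real.sqrt_nonneg _) (Real.sqrt_nonneg _)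
  have h_le := absR₀_mul_absR₀_le hz hw
  have h_sub := abs_sub_le_one_sub_mul hz hw
  have h_eq : kernel z w = Real.log ((1 - w * z + absR₀ z * absR₀ w) / |w - z|) := by
    rw [kernel, abs_div, abs_sub_comm z w, abs_of_nonpos (by linarith)]
    ring_nf
  have h_one : 1 ≤ (1 - w * z + absR₀ z * absR₀ w) / |w - z| := by
    rw [one_le_div hpos]; linarith
  rw [h_eq, abs_of_nonneg (Real.log_nonneg h_one)]
  refine (Real.log_le_log (by linarith) ?_).trans (log_two_div_le hpos)
  gcongr
  linarith

/-- The branch of `√(1 - 2aζ + ζ²)` on the unit disc with value `1` at the origin. In terms of the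
Joukowski variable `z = (ζ + ζ⁻¹) / 2` it is `√(2ζ(z - a))`. -/
noncomputable def diskSqrt (a : ℝ) (ζ : ℂ) : ℂ := (1 - 2 * a * ζ + ζ ^ 2) ^ (2⁻¹ : ℂ)

theorem quadratic_re (a : ℝ) (ζ : ℂ) :
    (1 - 2 * a * ζ + ζ ^ 2).re = 1 - 2 * a * ζ.re + (ζ.re ^ 2 - ζ.im ^ 2) := by
  simp [sq]

theorem quadratic_im (a : ℝ) (ζ : ℂ) :
    (1 - 2 * a * ζ + ζ ^ 2).im = 2 * ζ.im * (ζ.re - a) := by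
  simp [sq]; ring

theorem quadratic_mem_slitPlane {a : ℝ} (ha : a ∈ Icc (-1 : ℝ) 1) {ζ : ℂ} (hζ : ‖ζ‖ < 1) :
    1 - 2 * a * ζ + ζ ^ 2 ∈ Complex.slitPlane := by
  rw [Complex.mem_slitPlane_iff, quadratic_re, quadratic_im]
  have h_norm : ζ.re ^ 2 + ζ.im ^ 2 < 1 := by
    have := Complex.sq_norm ζ
    rw [Complex.normSq_apply] at this
    nlinarith [norm_nonneg ζ]
  obtain ⟨ha₁, ha₂⟩ := ha
  by_contra! h
  obtain ⟨h_re, h_im⟩ := h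
  rcases mul_eq_zero.mp h_im with h_im | h_im
  · obtain h_im : ζ.im = 0 := by linarith
    rw [h_im] at h_re h_norm
    have h₁ : ζ.re < 1 := by nlinarith
    have h₂ : -1 < ζ.re := by nlinarith
    rcases le_total 0 ζ.re with h | h
    · nlinarith [mul_nonneg h (sub_nonneg.mpr ha₂), mul_pos (sub_pos.mpr h₁) (sub_pos.mpr h₁)]
    · nlinarith [mul_nonneg (neg_nonneg.mpr h) (neg_le_iff_add_nonneg.mp ha₁),
        mul_pos (neg_lt_iff_pos_add.mp h₂) (neg_lt_iff_pos_add.mp h₂)]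
  · obtain h_re_eq : ζ.re = a := by linarith
    rw [h_re_eq] at h_re h_norm
    nlinarith

theorem quadratic_circle_mem_slitPlane {a θ : ℝ} (hθ : θ ∈ Ioo 0 Real.pi) (ha : Real.cos θ ≠ a) :
    1 - 2 * a * circleMap 0 1 θ + circleMap 0 1 θ ^ 2 ∈ Complex.slitPlane := by
  rw [Complex.mem_slitPlane_iff, quadratic_im, circleMap_zero_re, circleMap_zero_im, one_mul,
    one_mul]
  exact Or.inr (mul_ne_zero (mul_ne_zero two_ne_zero (Real.sin_pos_of_mem_Ioo hθ).ne')
    (sub_ne_zero.mpr ha))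

theorem diskSqrt_sq (a : ℝ) (ζ : ℂ) : diskSqrt a ζ ^ 2 = 1 - 2 * a * ζ + ζ ^ 2 := by
  have h := Complex.cpow_nat_inv_pow (1 - 2 * a * ζ + ζ ^ 2) (n := 2) two_ne_zero
  rwa [Nat.cast_ofNat] at h

theorem diskSqrt_ne_zero {a : ℝ} {ζ : ℂ} (h : 1 - 2 * a * ζ + ζ ^ 2 ∈ Complex.slitPlane) :
    diskSqrt a ζ ≠ 0 := fun h₀ => Complex.slitPlane_ne_zero h <| by
  rw [← diskSqrt_sq, h₀, zero_pow two_ne_zero]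

theorem differentiableAt_diskSqrt {a : ℝ} {ζ : ℂ}
    (h : 1 - 2 * a * ζ + ζ ^ 2 ∈ Complex.slitPlane) : DifferentiableAt ℂ (diskSqrt a) ζ :=
  DifferentiableAt.cpow_const (by fun_prop) h

theorem diskSqrt_conj {a : ℝ} (ha : a ∈ Icc (-1 : ℝ) 1) {ζ : ℂ} (hζ : ‖ζ‖ < 1) :
    diskSqrt a (conj ζ) = conj (diskSqrt a ζ) := by
  have h := Complex.conj_cpow _ (2⁻¹ : ℂ)
    (Complex.slitPlane_arg_ne_pi (quadratic_mem_slitPlane ha hζ))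
  simpa only [diskSqrt, map_inv₀, map_add, map_sub, map_one, map_mul, map_pow, Complex.conj_ofReal,
    map_ofNat] using h

theorem diskSqrt_zero (a : ℝ) : diskSqrt a 0 = 1 := by simp [diskSqrt]

/-- The boundary value of `√(X - a)` on the real axis from the lower half plane, which is the side
approached by `(ζ + ζ⁻¹) / 2` as `ζ` tends to the upper half of the unit circle from inside. -/
noncomputable def cutSqrt (a X : ℝ) : ℂ :=
  if a ≤ X then (√(X - a) : ℂ) else -Complex.I * (√(a - X) : ℂ)

theorem cutSqrt_sq (a X : ℝ) : cutSqrt a X ^ 2 = ((X - a : ℝ) : ℂ) := by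
  unfold cutSqrt
  split_ifs with h
  · rw [← Complex.ofReal_pow, Real.sq_sqrt (by linarith)]
  · rw [mul_pow, neg_sq, Complex.I_sq, ← Complex.ofReal_pow, Real.sq_sqrt (by linarith)]
    push_cast; ring

theorem norm_cutSqrt (a X : ℝ) : ‖cutSqrt a X‖ = √|X - a| := by
  rw [← Real.sqrt_sq (norm_nonneg (cutSqrt a X)), ← norm_pow, cutSqrt_sq, Complex.norm_real,
    Real.norm_eq_abs]

theorem quadratic_circle (a θ : ℝ) :
    1 - 2 * a * circleMap 0 1 θ + circleMap 0 1 θ ^ 2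
      = 2 * ((Real.cos θ - a : ℝ) : ℂ) * circleMap 0 1 θ := by
  have h := Real.sin_sq_add_cos_sq θ
  apply Complex.ext
  · rw [quadratic_re]
    simp only [circleMap_zero_re, circleMap_zero_im, Complex.mul_re, Complex.mul_im,
      Complex.ofReal_re, Complex.ofReal_im, Complex.re_ofNat, Complex.im_ofNat]
    linear_combination (-1 : ℝ) * h
  · rw [quadratic_im]
    simp only [circleMap_zero_re, circleMap_zero_im, Complex.mul_re, Complex.mul_im,
      Complex.ofReal_re, Complex.ofReal_im, Complex.re_ofNat, Complex.im_ofNat]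
    ring

theorem sqrt_two_mul_circleMap_half_sq (θ : ℝ) :
    ((√2 : ℂ) * circleMap 0 1 (θ / 2)) ^ 2 = 2 * circleMap 0 1 θ := by
  have h_sqrt : ((√2 : ℝ) : ℂ) ^ 2 = 2 := by
    rw [← Complex.ofReal_pow, Real.sq_sqrt two_pos.le, Complex.ofReal_ofNat]
  have h_half : circleMap 0 1 (θ / 2) ^ 2 = circleMap 0 1 θ := by
    simp only [circleMap, zero_add, Complex.ofReal_one, one_mul]
    rw [← Complex.exp_nat_mul]
    congr 1; push_cast; ring
  rw [mul_pow, h_sqrt, h_half]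

theorem circleMap_half_mul_cutSqrt_re_pos {a θ : ℝ} (hθ : θ ∈ Ioo 0 Real.pi)
    (ha : Real.cos θ ≠ a) : 0 < (circleMap 0 1 (θ / 2) * cutSqrt a (Real.cos θ)).re := by
  have h_cos : 0 < Real.cos (θ / 2) :=
    Real.cos_pos_of_mem_Ioo ⟨by linarith [hθ.1, hθ.2], by linarith [hθ.2]⟩
  have h_sin : 0 < Real.sin (θ / 2) :=
    Real.sin_pos_of_mem_Ioo ⟨by linarith [hθ.1], by linarith [hθ.1, hθ.2]⟩
  unfold cutSqrt
  split_ifs with h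
  · have : 0 < √(Real.cos θ - a) := Real.sqrt_pos.mpr (sub_pos.mpr (lt_of_le_of_ne h ha.symm))
    rw [mul_comm, Complex.re_ofReal_mul, circleMap_zero_re]
    positivity
  · have : 0 < √(a - Real.cos θ) := Real.sqrt_pos.mpr (by linarith)
    rw [mul_comm, mul_comm (-Complex.I), mul_assoc, Complex.re_ofReal_mul, neg_mul, Complex.neg_re,
      Complex.I_mul_re, neg_neg, circleMap_zero_im]
    positivity

theorem diskSqrt_circle {a θ : ℝ} (hθ : θ ∈ Ioo 0 Real.pi) (ha : Real.cos θ ≠ a) :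
    diskSqrt a (circleMap 0 1 θ) = √2 * circleMap 0 1 (θ / 2) * cutSqrt a (Real.cos θ) := by
  have h_sq : 1 - 2 * a * circleMap 0 1 θ + circleMap 0 1 θ ^ 2 =
      (√2 * circleMap 0 1 (θ / 2) * cutSqrt a (Real.cos θ)) ^ 2 := by
    rw [mul_pow, sqrt_two_mul_circleMap_half_sq, cutSqrt_sq, quadratic_circle]
    ring
  rw [diskSqrt, h_sq]
  refine Complex.sq_cpow_two_inv ?_
  rw [mul_assoc, Complex.re_ofReal_mul]
  exact mul_pos (by positivity) (circleMap_half_mul_cutSqrt_re_pos hθ ha)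

theorem two_mul_abs_cos_sub_le_norm {a r θ : ℝ} (ha : a ∈ Icc (-1 : ℝ) 1) (hr : 0 ≤ r) :
    2 * r * |Real.cos θ - a| ≤ ‖1 - 2 * a * circleMap 0 r θ + circleMap 0 r θ ^ 2‖ := by
  refine le_of_sq_le_sq ?_ (norm_nonneg _)
  rw [Complex.sq_norm, Complex.normSq_apply, quadratic_re, quadratic_im, circleMap_zero_re,
    circleMap_zero_im, mul_pow, sq_abs]
  have h_sin := Real.sin_sq θ
  have h_cos : Real.cos θ ∈ Icc (-1 : ℝ) 1 := ⟨Real.neg_one_le_cos θ, Real.cos_le_one θ⟩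
  generalize Real.cos θ = X at *
  generalize Real.sin θ = s at *
  have haX : a * X ≤ 1 := by nlinarith [ha.1, ha.2, h_cos.1, h_cos.2]
  have h_nonneg : 0 ≤ (1 - r) ^ 2 * ((1 + r) ^ 2 - 4 * r * (a * X)) :=
    mul_nonneg (sq_nonneg _) (by nlinarith [sq_nonneg (1 - r)])
  linear_combination h_nonneg - (r ^ 4 * (s ^ 2 + 1 - X ^ 2) + 4 * r ^ 2 * (r * X - a) ^ 2
    - 2 * r ^ 2 * (1 - 2 * a * (r * X) + (r * X) ^ 2)) * h_sin

theorem rpow_neg_half_eq (x : ℝ) (hx : 0 ≤ x) : x ^ (-(1 / 2) : ℝ) = (√x)⁻¹ := by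
  rw [Real.rpow_neg hx, Real.sqrt_eq_rpow]

theorem norm_diskSqrt_inv_le {a r θ : ℝ} (ha : a ∈ Icc (-1 : ℝ) 1) (hr : 1 / 2 ≤ r)
    (hX : Real.cos θ ≠ a) :
    ‖diskSqrt a (circleMap 0 r θ)‖⁻¹ ≤ |Real.cos θ - a| ^ (-(1 / 2) : ℝ) := by
  have hpos : 0 < |Real.cos θ - a| := abs_pos.mpr (sub_ne_zero.mpr hX)
  rw [rpow_neg_half_eq _ hpos.le]
  refine inv_anti₀ (Real.sqrt_pos.mpr hpos) (Real.sqrt_le_iff.mpr ⟨norm_nonneg _, ?_⟩)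
  rw [← norm_pow, diskSqrt_sq]
  refine le_trans ?_ (two_mul_abs_cos_sub_le_norm ha (by linarith))
  nlinarith

theorem norm_diskSqrt_of_sq_eq_one {p : ℝ} (hp : p ^ 2 = 1) (ζ : ℂ) :
    ‖diskSqrt p ζ‖ = ‖ζ - p‖ := by
  have hp' : (p : ℂ) ^ 2 = 1 := mod_cast hp
  rw [← pow_left_inj₀ (norm_nonneg _) (norm_nonneg _) two_ne_zero, ← norm_pow, ← norm_pow,
    diskSqrt_sq]
  congr 1
  linear_combination -hp'

theorem norm_diskSqrt_le_two {p : ℝ} (hp : p ^ 2 = 1) {ζ : ℂ} (hζ : ‖ζ‖ ≤ 1) :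
    ‖diskSqrt p ζ‖ ≤ 2 := by
  have : ‖(p : ℂ)‖ = 1 := by
    rw [Complex.norm_real, Real.norm_eq_abs, ← sq_eq_sq₀ (abs_nonneg p) one_pos.le, sq_abs, hp,
      one_pow]
  rw [norm_diskSqrt_of_sq_eq_one hp]
  linarith [norm_sub_le ζ p]

theorem sqrt_abs_cos_sub_one_mul_sqrt_abs_cos_add_one {θ : ℝ} (hθ : 0 ≤ Real.sin θ) :
    √|Real.cos θ - 1| * √|Real.cos θ - -1| = Real.sin θ := by
  rw [← Real.sqrt_mul (abs_nonneg _), ← abs_mul,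
    show (Real.cos θ - 1) * (Real.cos θ - -1) = -Real.sin θ ^ 2 by rw [Real.sin_sq]; ring,
    abs_neg, abs_of_nonneg (sq_nonneg _), Real.sqrt_sq hθ]

theorem norm_diskSqrt_mul_norm_inv_le {S T : Finset ℝ} (hS : ∀ a ∈ S, a ∈ Icc (-1 : ℝ) 1)
    (hT : ∀ p ∈ T, p ^ 2 = 1) {r θ p : ℝ} (hr : 1 / 2 ≤ r) (hr₁ : r < 1) (hp : p ∈ S ∪ T)
    (hθp : Real.cos θ ≠ p) :
    (if p ∈ T then ‖diskSqrt p (circleMap 0 r θ)‖ else 1) *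
        (if p ∈ S then ‖diskSqrt p (circleMap 0 r θ)‖⁻¹ else 1) ≤
      (if p ∈ T then 2 * √|Real.cos θ - p| else 1) * |Real.cos θ - p| ^ (-(1 / 2) : ℝ) := by
  have hζ : ‖circleMap 0 r θ‖ < 1 := by rwa [norm_circleMap_zero, abs_of_nonneg (by linarith)]
  have h_cancel : 2 * √|Real.cos θ - p| * |Real.cos θ - p| ^ (-(1 / 2) : ℝ) = 2 := by
    rw [rpow_neg_half_eq _ (abs_nonneg _), mul_assoc, mul_inv_cancel₀
      (Real.sqrt_pos.mpr (abs_pos.mpr (sub_ne_zero.mpr hθp))).ne', mul_one]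
  by_cases hpT : p ∈ T <;> by_cases hpS : p ∈ S
  · rw [if_pos hpT, if_pos hpS, if_pos hpT, h_cancel, mul_inv_cancel₀ (norm_ne_zero_iff.mpr
      (diskSqrt_ne_zero (quadratic_mem_slitPlane (hS p hpS) hζ)))]
    exact one_le_two
  · rw [if_pos hpT, if_neg hpS, if_pos hpT, h_cancel, mul_one]
    exact norm_diskSqrt_le_two (hT p hpT) hζ.le
  · rw [if_neg hpT, if_pos hpS, if_neg hpT, one_mul, one_mul]
    exact norm_diskSqrt_inv_le (hS p hpS) hr hθp
  · exact absurd hp (by simp [hpT, hpS])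

/-- The zeros `±1` of `ζ² - 1` that are not branch points compensate the corresponding factors of
`absInvRoot`. -/
theorem norm_sq_sub_one_mul_prod_le {S : Finset ℝ} (hS : ∀ a ∈ S, a ∈ Icc (-1 : ℝ) 1) {r θ : ℝ}
    (hr : 1 / 2 ≤ r) (hr1 : r < 1) (hθ : θ ∈ Ioo 0 Real.pi) (hX : Real.cos θ ∉ S ∪ {1, -1}) :
    ‖(circleMap 0 r θ ^ 2 - 1) * ∏ a ∈ S, (diskSqrt a (circleMap 0 r θ))⁻¹‖ ≤
      4 * (Real.sin θ * absInvRoot (S ∪ {1, -1}) (Real.cos θ)) := by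
  set ζ := circleMap 0 r θ
  set X := Real.cos θ
  set T : Finset ℝ := {1, -1} with hT
  have hT_sq : ∀ p ∈ T, p ^ 2 = 1 := by simp [hT]
  have hT_prod (f : ℝ → ℝ) : ∏ p ∈ T, f p = f 1 * f (-1) := Finset.prod_pair (by norm_num)
  have h_ind (A : Finset ℝ) (f : ℝ → ℝ) (hA : (S ∪ T) ∩ A = A) :
      ∏ p ∈ S ∪ T, (if p ∈ A then f p else 1) = ∏ p ∈ A, f p := by
    rw [Finset.prod_ite_mem, hA]
  calc ‖(ζ ^ 2 - 1) * ∏ a ∈ S, (diskSqrt a ζ)⁻¹‖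
      = (∏ p ∈ T, ‖diskSqrt p ζ‖) * ∏ p ∈ S, ‖diskSqrt p ζ‖⁻¹ := by
        rw [hT_prod, norm_diskSqrt_of_sq_eq_one (one_pow 2),
          norm_diskSqrt_of_sq_eq_one (by norm_num), norm_mul, norm_prod, ← norm_mul]
        simp only [norm_inv]
        congr 2
        push_cast; ring
    _ ≤ ∏ p ∈ S ∪ T, (if p ∈ T then 2 * √|X - p| else 1) * |X - p| ^ (-(1 / 2) : ℝ) := by
        rw [← h_ind T _ Finset.union_inter_cancel_right,
          ← h_ind S _ Finset.union_inter_cancel_left, ← Finset.prod_mul_distrib]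
        exact Finset.prod_le_prod (fun p _ => by positivity) fun p hp =>
          norm_diskSqrt_mul_norm_inv_le hS hT_sq hr hr1 hp (ne_of_mem_of_not_mem hp hX).symm
    _ = 4 * (Real.sin θ * absInvRoot (S ∪ T) X) := by
        rw [Finset.prod_mul_distrib, h_ind T _ Finset.union_inter_cancel_right, hT_prod,
          ← sqrt_abs_cos_sub_one_mul_sqrt_abs_cos_add_one (Real.sin_pos_of_mem_Ioo hθ).le,
          absInvRoot]
        ring

/-- The pullback of `1 / √P` to the unit disc under the Joukowski map `z = (ζ + ζ⁻¹) / 2`, where `P`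
is the monic polynomial whose simple roots are the points of `S`. Meaningful for `S` of even
cardinality. -/
noncomputable def diskInvRoot (S : Finset ℝ) (ζ : ℂ) : ℂ :=
  (2 * ζ) ^ (S.card / 2) * ∏ a ∈ S, (diskSqrt a ζ)⁻¹

/-- The boundary value of `1 / √P` on the real axis, see `cutSqrt` and `diskInvRoot`. -/
noncomputable def cutInvRoot (S : Finset ℝ) (X : ℝ) : ℂ := ∏ a ∈ S, (cutSqrt a X)⁻¹

theorem norm_cutInvRoot (S : Finset ℝ) (X : ℝ) : ‖cutInvRoot S X‖ = absInvRoot S X := by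
  simp only [cutInvRoot, absInvRoot, norm_prod, norm_inv, norm_cutSqrt,
    rpow_neg_half_eq _ (abs_nonneg _)]

theorem measurable_cutInvRoot (S : Finset ℝ) : Measurable (cutInvRoot S) := by
  refine Finset.measurable_fun_prod _ fun a _ => Measurable.inv ?_
  exact Measurable.ite measurableSet_Ici (by fun_prop) (by fun_prop)

theorem diskInvRoot_circle {S : Finset ℝ} (hS : Even S.card) {θ : ℝ} (hθ : θ ∈ Ioo 0 Real.pi)
    (hX : Real.cos θ ∉ S) : diskInvRoot S (circleMap 0 1 θ) = cutInvRoot S (Real.cos θ) := by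
  have h_ne : (2 * circleMap 0 1 θ) ^ (S.card / 2) ≠ 0 :=
    pow_ne_zero _ (mul_ne_zero two_ne_zero (circleMap_ne_center one_ne_zero))
  have h_prod : ∏ a ∈ S, (diskSqrt a (circleMap 0 1 θ))⁻¹ =
      ((2 * circleMap 0 1 θ) ^ (S.card / 2))⁻¹ * cutInvRoot S (Real.cos θ) := by
    rw [Finset.prod_congr rfl fun a ha => by
        rw [diskSqrt_circle hθ fun h => hX (h ▸ ha), mul_inv],
      Finset.prod_mul_distrib, Finset.prod_const, cutInvRoot, ← sqrt_two_mul_circleMap_half_sq,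
      ← pow_mul, Nat.mul_div_cancel' hS.two_dvd, inv_pow]
  rw [diskInvRoot, h_prod, mul_inv_cancel_left₀ h_ne]

theorem diskInvRoot_conj {S : Finset ℝ} (hS : ∀ a ∈ S, a ∈ Icc (-1 : ℝ) 1) {ζ : ℂ}
    (hζ : ‖ζ‖ < 1) : diskInvRoot S (conj ζ) = conj (diskInvRoot S ζ) := by
  rw [diskInvRoot, diskInvRoot, map_mul, map_pow, map_mul, map_ofNat, map_prod]
  congr 1
  exact Finset.prod_congr rfl fun a ha => by rw [diskSqrt_conj (hS a ha) hζ, map_inv₀]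

theorem differentiableAt_diskInvRoot {S : Finset ℝ} {ζ : ℂ}
    (h : ∀ a ∈ S, 1 - 2 * a * ζ + ζ ^ 2 ∈ Complex.slitPlane) :
    DifferentiableAt ℂ (diskInvRoot S) ζ := by
  refine (by fun_prop : DifferentiableAt ℂ (fun ζ : ℂ => (2 * ζ) ^ (S.card / 2)) ζ).mul ?_
  exact DifferentiableAt.fun_finsetProd fun a ha =>
    (differentiableAt_diskSqrt (h a ha)).inv (diskSqrt_ne_zero (h a ha))

theorem circleMap_zero_two_pi_sub (r θ : ℝ) :
    circleMap 0 r (2 * Real.pi - θ) = conj (circleMap 0 r θ) := by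
  apply Complex.ext
  · rw [Complex.conj_re, circleMap_zero_re, circleMap_zero_re, Real.cos_two_pi_sub]
  · rw [Complex.conj_im, circleMap_zero_im, circleMap_zero_im, Real.sin_two_pi_sub, mul_neg]

theorem norm_circleMap_zero_of_nonneg {r : ℝ} (hr : 0 ≤ r) (θ : ℝ) : ‖circleMap 0 r θ‖ = r := by
  rw [norm_circleMap_zero, abs_of_nonneg hr]

theorem circleIntegral_eq_two_mul_integral_re {f : ℂ → ℂ} {r : ℝ}
    (hc : Continuous fun θ => f (circleMap 0 r θ))
    (hs : ∀ θ, f (conj (circleMap 0 r θ)) = -conj (f (circleMap 0 r θ))) :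
    (∮ z in C(0, r), f z) =
      ((2 * ∫ θ in (0 : ℝ)..Real.pi, (circleMap 0 r θ * Complex.I * f (circleMap 0 r θ)).re : ℝ) :
        ℂ) := by
  set h : ℝ → ℂ := fun θ => circleMap 0 r θ * Complex.I * f (circleMap 0 r θ) with hh
  have h_cont : Continuous h := ((continuous_circleMap 0 r).mul continuous_const).mul hc
  have h_int (a b : ℝ) : IntervalIntegrable h volume a b := h_cont.intervalIntegrable a b
  have h_conj_int : IntervalIntegrable (fun θ => conj (h θ)) volume 0 Real.pi :=
    (Complex.continuous_conj.comp h_cont).intervalIntegrable _ _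
  have h_lower : ∫ θ in Real.pi..2 * Real.pi, h θ = ∫ θ in (0 : ℝ)..Real.pi, conj (h θ) := by
    have h_sub := intervalIntegral.integral_comp_sub_left (a := 0) (b := Real.pi) h (2 * Real.pi)
    rw [show 2 * Real.pi - Real.pi = Real.pi by ring, sub_zero] at h_sub
    rw [← h_sub]
    refine intervalIntegral.integral_congr fun θ _ => ?_
    simp only [hh, circleMap_zero_two_pi_sub, hs, map_mul, Complex.conj_I]
    ring
  calc (∮ z in C(0, r), f z) = ∫ θ in (0 : ℝ)..2 * Real.pi, h θ := by
        simp only [circleIntegral, deriv_circleMap, smul_eq_mul, hh]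
    _ = ∫ θ in (0 : ℝ)..Real.pi, (h θ + conj (h θ)) := by
        rw [← intervalIntegral.integral_add_adjacent_intervals (h_int 0 Real.pi)
          (h_int Real.pi _), h_lower, ← intervalIntegral.integral_add (h_int _ _) h_conj_int]
    _ = _ := by
        simp only [Complex.add_conj]
        rw [intervalIntegral.integral_ofReal, intervalIntegral.integral_const_mul]

theorem tendsto_circleMap_nhdsLT_one (θ : ℝ) :
    Tendsto (fun r : ℝ => circleMap 0 r θ) (𝓝[<] 1) (𝓝 (circleMap 0 1 θ)) :=
  (Continuous.tendsto (by unfold circleMap; fun_prop) 1).mono_left nhdsWithin_le_nhds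

theorem continuous_comp_circleMap {f : ℂ → ℂ} {r : ℝ} (hr : 0 < r)
    (hd : ∀ z, ‖z‖ ≤ r → z ≠ 0 → DifferentiableAt ℂ f z) :
    Continuous fun θ => f (circleMap 0 r θ) :=
  continuous_iff_continuousAt.mpr fun θ => ContinuousAt.comp (f := circleMap 0 r)
    (hd _ (norm_circleMap_zero_of_nonneg hr.le θ).le (circleMap_ne_center hr.ne')).continuousAt
    (continuous_circleMap 0 r).continuousAt

theorem integral_half_circle_of_hasTaylor {f : ℂ → ℂ} {n : ℕ} {p : ℂ[X]} {r : ℝ} (hr : 0 < r)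
    (hd : ∀ z, ‖z‖ ≤ r → z ≠ 0 → DifferentiableAt ℂ f z)
    (hT : HasTaylor (fun z => z ^ (n + 1) * f z) (n + 1) p)
    (hs : ∀ z, ‖z‖ = r → f (conj z) = -conj (f z)) :
    ∫ θ in Ioo 0 Real.pi, (circleMap 0 r θ * Complex.I * f (circleMap 0 r θ)).re =
      -(Real.pi * (p.coeff n).im) := by
  have h_residue := circleIntegral_eq_of_hasTaylor hr hd hT
  rw [circleIntegral_eq_two_mul_integral_re (continuous_comp_circleMap hr hd)
    (fun θ => hs _ (norm_circleMap_zero_of_nonneg hr.le θ))] at h_residue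
  have h_re := congrArg Complex.re h_residue
  rw [Complex.ofReal_re, show 2 * (Real.pi : ℂ) * Complex.I * p.coeff n
    = ((2 * Real.pi : ℝ) : ℂ) * (Complex.I * p.coeff n) by push_cast; ring,
    Complex.re_ofReal_mul, Complex.I_mul_re] at h_re
  rw [← integral_Ioc_eq_integral_Ioo, ← intervalIntegral.integral_of_le Real.pi_pos.le]
  linarith

theorem integral_half_circle {f : ℂ → ℂ} {n : ℕ} {p : ℂ[X]} {D : ℝ → ℝ}
    (hd : ∀ z, ‖z‖ < 1 → z ≠ 0 → DifferentiableAt ℂ f z)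
    (hT : HasTaylor (fun z => z ^ (n + 1) * f z) (n + 1) p)
    (hs : ∀ z, ‖z‖ < 1 → f (conj z) = -conj (f z))
    (hc : ∀ᵐ θ ∂volume.restrict (Ioo 0 Real.pi), ContinuousAt f (circleMap 0 1 θ))
    (hD : IntegrableOn D (Ioo 0 Real.pi))
    (hb : ∀ᵐ θ ∂volume.restrict (Ioo 0 Real.pi), ∀ r, 1 / 2 ≤ r → r < 1 →
      ‖f (circleMap 0 r θ)‖ ≤ D θ) :
    ∫ θ in Ioo 0 Real.pi, (circleMap 0 1 θ * Complex.I * f (circleMap 0 1 θ)).re =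
      -(Real.pi * (p.coeff n).im) := by
  have h_lim : Tendsto (fun r : ℝ =>
      ∫ θ in Ioo 0 Real.pi, (circleMap 0 r θ * Complex.I * f (circleMap 0 r θ)).re) (𝓝[<] 1)
      (𝓝 (∫ θ in Ioo 0 Real.pi, (circleMap 0 1 θ * Complex.I * f (circleMap 0 1 θ)).re)) := by
    have h_mem : ∀ᶠ r : ℝ in 𝓝[<] 1, r ∈ Ioo (1 / 2) 1 := Ioo_mem_nhdsLT (by norm_num)
    apply tendsto_integral_filter_of_dominated_convergence D
    · filter_upwards [h_mem] with r hr
      have h := continuous_comp_circleMap (by linarith [hr.1])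
        fun z hz => hd z (hz.trans_lt hr.2)
      exact (Complex.continuous_re.comp
        (((continuous_circleMap 0 r).mul continuous_const).mul h)).aestronglyMeasurable
    · filter_upwards [h_mem] with r hr
      filter_upwards [hb] with θ hθ
      refine (Complex.abs_re_le_norm _).trans ?_
      rw [norm_mul, norm_mul, Complex.norm_I,
        norm_circleMap_zero_of_nonneg (by linarith [hr.1]), mul_one]
      exact (mul_le_of_le_one_left (norm_nonneg _) hr.2.le).trans (hθ r hr.1.le hr.2)
    · exact hD
    · filter_upwards [hc] with θ hθ
      have h_radial := tendsto_circleMap_nhdsLT_one θ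
      exact (Complex.continuous_re.tendsto _).comp
        ((h_radial.mul_const _).mul (hθ.tendsto.comp h_radial))
  refine tendsto_nhds_unique h_lim (tendsto_const_nhds.congr' ?_)
  filter_upwards [Ioo_mem_nhdsLT (zero_lt_one' ℝ)] with r hr
  exact (integral_half_circle_of_hasTaylor hr.1 (fun z hz => hd z (hz.trans_lt hr.2)) hT
    fun z hz => hs z (hz ▸ hr.2)).symm

theorem image_cos_Ioo : Real.cos '' Ioo 0 Real.pi = Ioo (-1) 1 := by
  ext x
  constructor
  · rintro ⟨θ, hθ, rfl⟩
    have := Real.sin_pos_of_mem_Ioo hθ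
    constructor <;> nlinarith [Real.sin_sq_add_cos_sq θ]
  · intro hx
    exact ⟨Real.arccos x, ⟨Real.arccos_pos.mpr hx.2, Real.arccos_lt_pi.mpr hx.1⟩,
      Real.cos_arccos hx.1.le hx.2.le⟩

theorem integral_Icc_eq_integral_cos (g : ℝ → ℝ) :
    ∫ x in Icc (-1) 1, g x = ∫ θ in Ioo 0 Real.pi, Real.sin θ * g (Real.cos θ) := by
  rw [integral_Icc_eq_integral_Ioo, ← image_cos_Ioo,
    integral_image_eq_integral_abs_deriv_smul measurableSet_Ioo
      (fun θ _ => (Real.hasDerivAt_cos θ).hasDerivWithinAt)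
      (Real.injOn_cos.mono Ioo_subset_Icc_self)]
  refine setIntegral_congr_fun measurableSet_Ioo fun θ hθ => ?_
  simp only [smul_eq_mul, abs_neg, abs_of_pos (Real.sin_pos_of_mem_Ioo hθ)]

theorem integrableOn_cos {g : ℝ → ℝ} (hg : IntegrableOn g (Icc (-1) 1)) :
    IntegrableOn (fun θ => Real.sin θ * g (Real.cos θ)) (Ioo 0 Real.pi) := by
  have h := (integrableOn_image_iff_integrableOn_abs_deriv_smul measurableSet_Ioo
      (fun θ _ => (Real.hasDerivAt_cos θ).hasDerivWithinAt)
      (Real.injOn_cos.mono Ioo_subset_Icc_self) g).mp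
      (by rw [image_cos_Ioo]; exact hg.mono_set Ioo_subset_Icc_self)
  refine h.congr_fun (fun θ hθ => ?_) measurableSet_Ioo
  simp only [smul_eq_mul, abs_neg, abs_of_pos (Real.sin_pos_of_mem_Ioo hθ)]

theorem ae_cos_notMem (s : Finset ℝ) :
    ∀ᵐ θ ∂volume.restrict (Ioo 0 Real.pi), θ ∈ Ioo 0 Real.pi ∧ Real.cos θ ∉ s := by
  refine (ae_restrict_mem measurableSet_Ioo).and ?_
  rw [ae_restrict_iff' measurableSet_Ioo]
  have h_fin : (Ioo 0 Real.pi ∩ Real.cos ⁻¹' (s : Set ℝ)).Finite := by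
    apply Set.Finite.of_finite_image (f := Real.cos)
    · exact s.finite_toSet.subset (by rintro _ ⟨θ, hθ, rfl⟩; exact hθ.2)
    · exact Real.injOn_cos.mono fun θ hθ => Ioo_subset_Icc_self hθ.1
  filter_upwards [measure_eq_zero_iff_ae_notMem.mp (h_fin.measure_zero volume)] with θ h h_mem hs
  exact h ⟨h_mem, hs⟩

/-- The Joukowski map, a bijection from the punctured unit disc to `ℂ \ [-1, 1]`. -/
noncomputable def joukowski (ζ : ℂ) : ℂ := (ζ + ζ⁻¹) / 2

theorem differentiableAt_joukowski {ζ : ℂ} (h : ζ ≠ 0) : DifferentiableAt ℂ joukowski ζ :=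
  (differentiableAt_id.add (differentiableAt_inv h)).div_const 2

theorem joukowski_conj (ζ : ℂ) : joukowski (conj ζ) = conj (joukowski ζ) := by
  simp [joukowski, map_div₀, map_inv₀, Complex.conj_ofNat]

theorem joukowski_circle (θ : ℝ) : joukowski (circleMap 0 1 θ) = (Real.cos θ : ℂ) := by
  simp only [joukowski, circleMap, zero_add, Complex.ofReal_one, one_mul, Complex.ofReal_cos,
    Complex.cos]
  rw [← Complex.exp_neg, neg_mul]

theorem circle_inv_sub (θ : ℝ) :
    (circleMap 0 1 θ)⁻¹ - circleMap 0 1 θ = -(2 * Complex.I * Real.sin θ) := by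
  simp only [circleMap, zero_add, Complex.ofReal_one, one_mul, Complex.ofReal_sin, Complex.sin]
  rw [← Complex.exp_neg, neg_mul]
  linear_combination (Complex.exp (-(θ * Complex.I)) - Complex.exp (θ * Complex.I)) * Complex.I_sq

theorem norm_inv_circleMap_le {r : ℝ} (hr : 1 / 2 ≤ r) (θ : ℝ) : ‖(circleMap 0 r θ)⁻¹‖ ≤ 2 := by
  rw [norm_inv, norm_circleMap_zero_of_nonneg (by linarith)]
  exact (inv_le_comm₀ (by linarith) two_pos).mpr (by linarith)

theorem norm_joukowski_le {r : ℝ} (hr : 1 / 2 ≤ r) (hr1 : r < 1) (θ : ℝ) :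
    ‖joukowski (circleMap 0 r θ)‖ ≤ 2 := by
  have h := norm_add_le (circleMap 0 r θ) (circleMap 0 r θ)⁻¹
  rw [norm_circleMap_zero_of_nonneg (by linarith)] at h
  rw [joukowski, norm_div, Complex.norm_ofNat]
  linarith [norm_inv_circleMap_le hr θ]

theorem exists_norm_aeval_le (N : ℝ[X]) : ∃ C, ∀ z : ℂ, ‖z‖ ≤ 2 → ‖aeval z N‖ ≤ C := by
  obtain ⟨C, hC⟩ := (isCompact_closedBall (0 : ℂ) 2).exists_bound_of_continuousOn
    (Polynomial.continuous_aeval N).continuousOn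
  exact ⟨C, fun z hz => hC z (by simpa using hz)⟩

/-- The pullback of the differential `G N dz / √P` to the unit disc under `z = joukowski ζ`, where
`P` is the monic polynomial with simple roots `S`. -/
noncomputable def diskForm (S : Finset ℝ) (N : ℝ[X]) (G : ℂ → ℂ) (ζ : ℂ) : ℂ :=
  G ζ * aeval (joukowski ζ) N * (diskInvRoot S ζ * ((1 - (ζ⁻¹) ^ 2) / 2))

/-- `G` is analytic in the punctured unit disc, odd under complex conjugation, and has, off the
points of the finite set `T`, the boundary value `g (cos θ)` at `exp (i θ)`, `0 < θ < π`. The bound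
`b (cos θ)` along radii dominates the pullbacks `diskForm S N G` as the radius tends to `1`. -/
structure HasBoundaryValue (G : ℂ → ℂ) (g : ℝ → ℂ) (b : ℝ → ℝ) (T : Finset ℝ) : Prop where
  differentiableAt : ∀ ζ, ‖ζ‖ < 1 → ζ ≠ 0 → DifferentiableAt ℂ G ζ
  map_conj : ∀ ζ, ‖ζ‖ < 1 → G (conj ζ) = -conj (G ζ)
  continuousAt : ∀ θ ∈ Ioo 0 Real.pi, Real.cos θ ∉ T → ContinuousAt G (circleMap 0 1 θ)
  circle : ∀ θ ∈ Ioo 0 Real.pi, Real.cos θ ∉ T → G (circleMap 0 1 θ) = g (Real.cos θ)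
  norm_le : ∀ θ ∈ Ioo 0 Real.pi, Real.cos θ ∉ T → ∀ r, 1 / 2 ≤ r → r < 1 →
    ‖G (circleMap 0 r θ)‖ ≤ b (Real.cos θ)
  measurable : Measurable g
  integrableOn : ∀ S : Finset ℝ, IntegrableOn (fun X => b X * absInvRoot S X) (Icc (-1) 1)

section DiskForm

variable {S : Finset ℝ} {N : ℝ[X]} {G : ℂ → ℂ} {θ : ℝ}

theorem diskForm_conj (hS : ∀ a ∈ S, a ∈ Icc (-1 : ℝ) 1) {ζ : ℂ} (hζ : ‖ζ‖ < 1)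
    (hG : G (conj ζ) = -conj (G ζ)) : diskForm S N G (conj ζ) = -conj (diskForm S N G ζ) := by
  rw [diskForm, hG, diskInvRoot_conj hS hζ, joukowski_conj, aeval_conj, diskForm]
  simp only [map_mul, map_sub, map_div₀, map_pow, map_one, map_ofNat, map_inv₀]
  ring

theorem continuousAt_diskForm_circle (hG : ContinuousAt G (circleMap 0 1 θ))
    (hθ : θ ∈ Ioo 0 Real.pi) (hX : Real.cos θ ∉ S) :
    ContinuousAt (diskForm S N G) (circleMap 0 1 θ) := by
  have h₀ : circleMap 0 1 θ ≠ 0 := circleMap_ne_center one_ne_zero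
  have h_root : ContinuousAt (diskInvRoot S) (circleMap 0 1 θ) :=
    (differentiableAt_diskInvRoot fun a ha =>
      quadratic_circle_mem_slitPlane hθ fun h => hX (h ▸ ha)).continuousAt
  refine (hG.mul ?_).mul (h_root.mul ?_)
  · exact (Polynomial.continuous_aeval N).continuousAt.comp
      (differentiableAt_joukowski h₀).continuousAt
  · exact (continuousAt_const.sub ((continuousAt_inv₀ h₀).pow 2)).div_const 2

theorem differentiableAt_diskForm (hS : ∀ a ∈ S, a ∈ Icc (-1 : ℝ) 1) {ζ : ℂ} (hζ : ‖ζ‖ < 1)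
    (h₀ : ζ ≠ 0) (hG : DifferentiableAt ℂ G ζ) : DifferentiableAt ℂ (diskForm S N G) ζ := by
  refine (hG.mul ?_).mul ((differentiableAt_diskInvRoot fun a ha =>
    quadratic_mem_slitPlane (hS a ha) hζ).mul ?_)
  · exact (Polynomial.differentiable_aeval N).differentiableAt.comp ζ
      (differentiableAt_joukowski h₀)
  · exact ((differentiableAt_const 1).sub ((differentiableAt_inv h₀).pow 2)).div_const 2

theorem circle_mul_I_mul_diskForm (hS : Even S.card) (hθ : θ ∈ Ioo 0 Real.pi)
    (hX : Real.cos θ ∉ S) :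
    circleMap 0 1 θ * Complex.I * diskForm S N G (circleMap 0 1 θ) =
      ((-Real.sin θ : ℝ) : ℂ) *
        (G (circleMap 0 1 θ) * N.eval (Real.cos θ) * cutInvRoot S (Real.cos θ)) := by
  have h₀ : circleMap 0 1 θ ≠ 0 := circleMap_ne_center one_ne_zero
  have h_deriv : circleMap 0 1 θ * Complex.I * ((1 - (circleMap 0 1 θ)⁻¹ ^ 2) / 2) =
      ((-Real.sin θ : ℝ) : ℂ) := by
    have h : circleMap 0 1 θ * (1 - (circleMap 0 1 θ)⁻¹ ^ 2) = 2 * Complex.I * Real.sin θ := by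
      rw [← neg_eq_iff_eq_neg.mpr (circle_inv_sub θ)]
      field_simp
      ring
    push_cast at h ⊢
    linear_combination Complex.I / 2 * h + Complex.sin θ * Complex.I_sq
  have h_eval : aeval (Real.cos θ : ℂ) N = ((N.eval (Real.cos θ) : ℝ) : ℂ) := by
    rw [← Complex.coe_algebraMap, aeval_algebraMap_apply, Polynomial.coe_aeval_eq_eval]
  rw [diskForm, diskInvRoot_circle hS hθ hX, joukowski_circle, h_eval]
  linear_combination (G (circleMap 0 1 θ) * ((N.eval (Real.cos θ) : ℝ) : ℂ) *
    cutInvRoot S (Real.cos θ)) * h_deriv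

theorem norm_diskInvRoot_mul_le (hS : ∀ a ∈ S, a ∈ Icc (-1 : ℝ) 1) {r : ℝ} (hr : 1 / 2 ≤ r)
    (hr1 : r < 1) (hθ : θ ∈ Ioo 0 Real.pi) (hX : Real.cos θ ∉ S ∪ {1, -1}) :
    ‖diskInvRoot S (circleMap 0 r θ) * ((1 - (circleMap 0 r θ)⁻¹ ^ 2) / 2)‖ ≤
      2 ^ (S.card / 2) * 8 * (Real.sin θ * absInvRoot (S ∪ {1, -1}) (Real.cos θ)) := by
  have h_bound := norm_sq_sub_one_mul_prod_le hS hr hr1 hθ hX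
  have h_inv := norm_inv_circleMap_le hr θ
  have h₀ : circleMap 0 r θ ≠ 0 := circleMap_ne_center (by linarith)
  have h_norm : ‖2 * circleMap 0 r θ‖ ≤ 2 := by
    rw [norm_mul, norm_circleMap_zero_of_nonneg (by linarith), Complex.norm_ofNat]
    linarith
  generalize circleMap 0 r θ = ζ at *
  calc ‖diskInvRoot S ζ * ((1 - ζ⁻¹ ^ 2) / 2)‖
      = ‖2 * ζ‖ ^ (S.card / 2) * (‖ζ⁻¹‖ ^ 2 / 2) *
          ‖(ζ ^ 2 - 1) * ∏ a ∈ S, (diskSqrt a ζ)⁻¹‖ := by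
        rw [← norm_pow, ← norm_pow, ← Complex.norm_ofNat 2, ← norm_div, ← norm_mul, ← norm_mul,
          diskInvRoot]
        congr 1
        field_simp
    _ ≤ 2 ^ (S.card / 2) * (2 ^ 2 / 2) *
          (4 * (Real.sin θ * absInvRoot (S ∪ {1, -1}) (Real.cos θ))) := by gcongr
    _ = _ := by ring

theorem HasBoundaryValue.setIntegral_re_eq {g : ℝ → ℂ} {b : ℝ → ℝ} {T : Finset ℝ} {n : ℕ}
    {p : ℂ[X]} (hG : HasBoundaryValue G g b T) (hS : ∀ a ∈ S, a ∈ Icc (-1 : ℝ) 1)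
    (hS_even : Even S.card)
    (hT : HasTaylor (fun ζ => ζ ^ (n + 1) * diskForm S N G ζ) (n + 1) p) :
    ∫ x in Icc (-1) 1, (g x * N.eval x * cutInvRoot S x).re = Real.pi * (p.coeff n).im := by
  obtain ⟨C, hC⟩ := exists_norm_aeval_le N
  have h_ae := ae_cos_notMem (T ∪ (S ∪ {1, -1}))
  have h_half := integral_half_circle (f := diskForm S N G)
    (D := fun θ => Real.sin θ * (C * (2 ^ (S.card / 2) * 8) *
      (b (Real.cos θ) * absInvRoot (S ∪ {1, -1}) (Real.cos θ))))
    (fun ζ hζ h₀ => differentiableAt_diskForm hS hζ h₀ (hG.differentiableAt ζ hζ h₀)) hT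
    (fun ζ hζ => diskForm_conj hS hζ (hG.map_conj ζ hζ)) ?_
    (integrableOn_cos ((hG.integrableOn _).const_mul _)) ?_
  · rw [← neg_eq_iff_eq_neg.mpr h_half, integral_Icc_eq_integral_cos, ← integral_neg]
    refine integral_congr_ae ?_
    filter_upwards [h_ae] with θ ⟨hθ, hX⟩
    rw [Finset.notMem_union, Finset.notMem_union] at hX
    rw [circle_mul_I_mul_diskForm hS_even hθ hX.2.1, hG.circle θ hθ hX.1, Complex.re_ofReal_mul]
    ring
  · filter_upwards [h_ae] with θ ⟨hθ, hX⟩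
    rw [Finset.notMem_union, Finset.notMem_union] at hX
    exact continuousAt_diskForm_circle (hG.continuousAt θ hθ hX.1) hθ hX.2.1
  · filter_upwards [h_ae] with θ ⟨hθ, hX⟩ r hr hr1
    rw [Finset.notMem_union] at hX
    have hG_norm := hG.norm_le θ hθ hX.1 r hr hr1
    have hb_nonneg : 0 ≤ b (Real.cos θ) := (norm_nonneg _).trans hG_norm
    rw [diskForm, norm_mul, norm_mul]
    calc _ ≤ b (Real.cos θ) * C * (2 ^ (S.card / 2) * 8 *
          (Real.sin θ * absInvRoot (S ∪ {1, -1}) (Real.cos θ))) :=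
          mul_le_mul (mul_le_mul hG_norm (hC _ (norm_joukowski_le hr hr1 θ)) (norm_nonneg _)
            hb_nonneg) (norm_diskInvRoot_mul_le hS hr hr1 hθ hX.2) (norm_nonneg _)
            (mul_nonneg hb_nonneg ((norm_nonneg _).trans (hC 0 (by simp))))
      _ = _ := by ring

theorem HasBoundaryValue.norm_boundary_le {g : ℝ → ℂ} {b : ℝ → ℝ} {T : Finset ℝ}
    (hG : HasBoundaryValue G g b T) {x : ℝ} (hx : x ∈ Ioo (-1) 1) (hxT : x ∉ T) : ‖g x‖ ≤ b x := by
  rw [← image_cos_Ioo] at hx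
  obtain ⟨θ, hθ, rfl⟩ := hx
  rw [← hG.circle θ hθ hxT]
  refine le_of_tendsto ((hG.continuousAt θ hθ hxT).tendsto.comp
    (tendsto_circleMap_nhdsLT_one θ)).norm ?_
  filter_upwards [Ioo_mem_nhdsLT (by norm_num : (1 / 2 : ℝ) < 1)] with r hr
  exact hG.norm_le θ hθ hxT r hr.1.le hr.2

theorem HasBoundaryValue.integrableOn_mul_cutInvRoot {g : ℝ → ℂ} {b : ℝ → ℝ} {T : Finset ℝ}
    (hG : HasBoundaryValue G g b T) (S : Finset ℝ) (N : ℝ[X]) :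
    IntegrableOn (fun x => g x * N.eval x * cutInvRoot S x) (Icc (-1) 1) := by
  obtain ⟨C, hC⟩ := (isCompact_Icc (a := (-1 : ℝ)) (b := 1)).exists_bound_of_continuousOn
    N.continuous.continuousOn
  rw [integrableOn_Icc_iff_integrableOn_Ioo]
  refine (((hG.integrableOn S).mono_set Ioo_subset_Icc_self).const_mul C).mono' ?_ ?_
  · exact ((hG.measurable.mul (Complex.measurable_ofReal.comp N.continuous.measurable)).mul
      (measurable_cutInvRoot S)).aestronglyMeasurable
  · filter_upwards [ae_restrict_mem measurableSet_Ioo,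
      measure_eq_zero_iff_ae_notMem.mp (T.finite_toSet.measure_zero (volume.restrict _))]
      with x hx hxT
    have h_norm := hG.norm_boundary_le hx hxT
    have h_eval := hC x (Ioo_subset_Icc_self hx)
    rw [norm_mul, norm_mul, norm_cutInvRoot, Complex.norm_real]
    calc _ ≤ b x * C * absInvRoot S x := mul_le_mul_of_nonneg_right
          (mul_le_mul h_norm h_eval (norm_nonneg _) ((norm_nonneg _).trans h_norm))
          (absInvRoot_nonneg S x)
      _ = _ := by ring

end DiskForm

theorem cutSqrt_inv (a X : ℝ) :
    (cutSqrt a X)⁻¹ = (if X < a then Complex.I else 1) * ((|X - a| ^ (-(1 / 2) : ℝ) : ℝ) : ℂ) := by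
  rw [rpow_neg_half_eq _ (abs_nonneg _), cutSqrt, Complex.ofReal_inv]
  by_cases h : a ≤ X
  · rw [if_pos h, if_neg (not_lt.mpr h), abs_of_nonneg (sub_nonneg.mpr h), one_mul]
  · rw [if_neg h, if_pos (not_le.mp h), abs_of_neg (sub_neg.mpr (not_le.mp h)), neg_sub, mul_inv,
      inv_neg, Complex.inv_I, neg_neg]

theorem cutInvRoot_eq_mul_absInvRoot (S : Finset ℝ) (X : ℝ) :
    cutInvRoot S X = (∏ a ∈ S, if X < a then Complex.I else 1) * (absInvRoot S X : ℂ) := by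
  simp only [cutInvRoot, cutSqrt_inv, Finset.prod_mul_distrib, absInvRoot, Complex.ofReal_prod]

theorem absInvRoot_eq_zero {S : Finset ℝ} {X : ℝ} (h : X ∈ S) : absInvRoot S X = 0 :=
  Finset.prod_eq_zero h (by rw [sub_self, abs_zero, Real.zero_rpow (by norm_num)])

/-- The integral of `N / √|P|` over the interval `(b, c)`, where `P` is the monic polynomial with
simple roots `S`. It is used for gaps, that is, intervals in which `P` is negative. -/
noncomputable def gapIntegral (S : Finset ℝ) (N : ℝ[X]) (b c : ℝ) : ℝ :=
  ∫ x in Ioo b c, N.eval x * absInvRoot S x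

/-- The density `π⁻¹ N / √P` on the bands, with the branch of `√P` that is positive at `+∞`. -/
noncomputable def density (S : Finset ℝ) (N : ℝ[X]) (x : ℝ) : ℝ :=
  Real.pi⁻¹ * (N.eval x * (cutInvRoot S x).re)

/-- The four branch points of a genus one condensate. -/
structure BranchPoints where
  (a₁ a₂ a₃ a₄ : ℝ)
  neg_one_le : -1 ≤ a₁
  lt₁₂ : a₁ < a₂
  lt₂₃ : a₂ < a₃
  lt₃₄ : a₃ < a₄
  le_one : a₄ ≤ 1

namespace BranchPoints

variable (B : BranchPoints)

/-- The set of branch points. -/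
noncomputable def roots : Finset ℝ := {B.a₁, B.a₂, B.a₃, B.a₄}

/-- The union of the three bands. -/
def bands : Set ℝ := genusOneSupport B.a₁ B.a₂ B.a₃ B.a₄

theorem prod_roots {M : Type*} [CommMonoid M] (f : ℝ → M) :
    ∏ a ∈ B.roots, f a = f B.a₁ * f B.a₂ * f B.a₃ * f B.a₄ := by
  have h₁₂ := B.lt₁₂
  have h₂₃ := B.lt₂₃
  have h₃₄ := B.lt₃₄
  rw [roots, Finset.prod_insert, Finset.prod_insert, Finset.prod_pair h₃₄.ne, mul_assoc, mul_assoc]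
  · simp only [Finset.mem_insert, Finset.mem_singleton, not_or]
    exact ⟨h₂₃.ne, (h₂₃.trans h₃₄).ne⟩
  · simp only [Finset.mem_insert, Finset.mem_singleton, not_or]
    exact ⟨h₁₂.ne, (h₁₂.trans h₂₃).ne, (h₁₂.trans (h₂₃.trans h₃₄)).ne⟩

theorem card_roots : B.roots.card = 4 := by
  have h := B.prod_roots fun _ => Multiplicative.ofAdd 1
  rw [Finset.prod_const] at h
  simpa using congrArg Multiplicative.toAdd h

theorem even_card_roots : Even B.roots.card := B.card_roots ▸ by decide

theorem mem_Icc_of_mem_roots {a : ℝ} (h : a ∈ B.roots) : a ∈ Icc (-1 : ℝ) 1 := by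
  obtain ⟨_, _, _, _, h₀, h₁₂, h₂₃, h₃₄, h₁⟩ := B
  simp only [roots, Finset.mem_insert, Finset.mem_singleton] at h
  rcases h with rfl | rfl | rfl | rfl <;> constructor <;> linarith

theorem Icc_eq_bands_union_gaps :
    Icc (-1 : ℝ) 1 = B.bands ∪ (Ioo B.a₁ B.a₂ ∪ Ioo B.a₃ B.a₄) := by
  obtain ⟨_, _, _, _, h₀, h₁₂, h₂₃, h₃₄, h₁⟩ := B
  ext x
  simp only [bands, genusOneSupport, mem_union, mem_Icc, mem_Ioo]
  grind

theorem bands_subset : B.bands ⊆ Icc (-1 : ℝ) 1 := by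
  rw [B.Icc_eq_bands_union_gaps]
  exact subset_union_left

theorem measurableSet_bands : MeasurableSet B.bands :=
  (measurableSet_Icc.union measurableSet_Icc).union measurableSet_Icc

theorem disjoint_bands_gaps : Disjoint B.bands (Ioo B.a₁ B.a₂ ∪ Ioo B.a₃ B.a₄) := by
  obtain ⟨_, _, _, _, h₀, h₁₂, h₂₃, h₃₄, h₁⟩ := B
  rw [Set.disjoint_left]
  rintro x ((⟨_, _⟩ | ⟨_, _⟩) | ⟨_, _⟩) (⟨_, _⟩ | ⟨_, _⟩) <;> linarith

theorem disjoint_gaps : Disjoint (Ioo B.a₁ B.a₂) (Ioo B.a₃ B.a₄) := by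
  rw [Set.disjoint_left]
  rintro x ⟨_, h₂⟩ ⟨h₃, _⟩
  linarith [B.lt₂₃]

theorem cutInvRoot_of_mem_left_gap {X : ℝ} (hX : X ∈ Ioo B.a₁ B.a₂) :
    cutInvRoot B.roots X = -Complex.I * (absInvRoot B.roots X : ℂ) := by
  obtain ⟨h₁, h₂⟩ := hX
  rw [cutInvRoot_eq_mul_absInvRoot, B.prod_roots, if_neg h₁.not_gt, if_pos h₂,
    if_pos (h₂.trans B.lt₂₃), if_pos (h₂.trans (B.lt₂₃.trans B.lt₃₄)), one_mul, Complex.I_mul_I,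
    neg_one_mul]

theorem cutInvRoot_of_mem_right_gap {X : ℝ} (hX : X ∈ Ioo B.a₃ B.a₄) :
    cutInvRoot B.roots X = Complex.I * (absInvRoot B.roots X : ℂ) := by
  obtain ⟨h₃, h₄⟩ := hX
  rw [cutInvRoot_eq_mul_absInvRoot, B.prod_roots, if_neg h₃.not_gt, if_pos h₄,
    if_neg (B.lt₂₃.trans h₃).not_gt, if_neg (B.lt₁₂.trans (B.lt₂₃.trans h₃)).not_gt, one_mul,
    one_mul, one_mul]

theorem cutInvRoot_im_of_mem_bands {X : ℝ} (hX : X ∈ B.bands) : (cutInvRoot B.roots X).im = 0 := by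
  rw [cutInvRoot_eq_mul_absInvRoot, Complex.im_mul_ofReal]
  by_cases h_mem : X ∈ B.roots
  · rw [absInvRoot_eq_zero h_mem, mul_zero]
  have h_ne : X ≠ B.a₁ ∧ X ≠ B.a₂ ∧ X ≠ B.a₃ ∧ X ≠ B.a₄ := by
    simpa only [roots, Finset.mem_insert, Finset.mem_singleton, not_or] using h_mem
  obtain ⟨a₁, a₂, a₃, a₄, h₀, h₁₂, h₂₃, h₃₄, h₁⟩ := B
  rw [prod_roots]
  simp only at h_ne ⊢
  obtain ((h | h) | h) : (X < a₁ ∨ (a₂ < X ∧ X < a₃)) ∨ a₄ < X := by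
    simp only [bands, genusOneSupport, mem_union, mem_Icc] at hX
    grind
  · rw [if_pos h, if_pos (by linarith), if_pos (by linarith), if_pos (by linarith)]
    simp
  · rw [if_neg (by linarith), if_neg h.1.not_gt, if_pos h.2, if_pos (by linarith)]
    simp
  · rw [if_neg (by linarith), if_neg (by linarith), if_neg (by linarith), if_neg h.not_gt]
    simp

theorem integral_Icc_re_eq_bands_add_gaps {g : ℝ → ℂ} {N : ℝ[X]} {k₁ k₂ : ℝ}
    (hg : IntegrableOn (fun x => g x * N.eval x * cutInvRoot B.roots x) (Icc (-1) 1))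
    (hk₁ : ∀ x ∈ Ioo B.a₁ B.a₂, (g x).im = k₁) (hk₂ : ∀ x ∈ Ioo B.a₃ B.a₄, (g x).im = k₂) :
    ∫ x in Icc (-1) 1, (g x * N.eval x * cutInvRoot B.roots x).re =
      (∫ x in B.bands, Real.pi * ((g x).re * density B.roots N x)) +
        (k₁ * gapIntegral B.roots N B.a₁ B.a₂ - k₂ * gapIntegral B.roots N B.a₃ B.a₄) := by
  have h_int : IntegrableOn (fun x => (g x * N.eval x * cutInvRoot B.roots x).re) (Icc (-1) 1) :=
    hg.re
  rw [B.Icc_eq_bands_union_gaps] at h_int ⊢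
  have h_gaps := h_int.mono_set subset_union_right
  rw [setIntegral_union B.disjoint_bands_gaps (measurableSet_Ioo.union measurableSet_Ioo)
    (h_int.mono_set subset_union_left) h_gaps, setIntegral_union B.disjoint_gaps measurableSet_Ioo
    (h_gaps.mono_set subset_union_left) (h_gaps.mono_set subset_union_right), sub_eq_add_neg,
    ← neg_mul, gapIntegral, gapIntegral, ← integral_const_mul, ← integral_const_mul]
  congr 1
  · refine setIntegral_congr_fun B.measurableSet_bands fun x hx => ?_
    have := Real.pi_ne_zero
    simp only [density, Complex.mul_re, Complex.mul_im, Complex.ofReal_re, Complex.ofReal_im,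
      B.cutInvRoot_im_of_mem_bands hx]
    field_simp
    ring
  congr 1
  · refine setIntegral_congr_fun measurableSet_Ioo fun x hx => ?_
    simp only [B.cutInvRoot_of_mem_left_gap hx, ← hk₁ x hx, Complex.mul_re, Complex.mul_im,
      Complex.ofReal_re, Complex.ofReal_im, Complex.neg_re, Complex.neg_im, Complex.I_re,
      Complex.I_im]
    ring
  · refine setIntegral_congr_fun measurableSet_Ioo fun x hx => ?_
    simp only [B.cutInvRoot_of_mem_right_gap hx, ← hk₂ x hx, Complex.mul_re, Complex.mul_im,
      Complex.ofReal_re, Complex.ofReal_im, Complex.I_re, Complex.I_im]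
    ring

theorem setIntegral_bands_add_gapIntegrals {G : ℂ → ℂ} {g : ℝ → ℂ} {b : ℝ → ℝ} {T : Finset ℝ}
    {N : ℝ[X]} {k₁ k₂ : ℝ} {n : ℕ} {p : ℂ[X]} (hG : HasBoundaryValue G g b T)
    (hk₁ : ∀ x ∈ Ioo B.a₁ B.a₂, (g x).im = k₁) (hk₂ : ∀ x ∈ Ioo B.a₃ B.a₄, (g x).im = k₂)
    (hT : HasTaylor (fun ζ => ζ ^ (n + 1) * diskForm B.roots N G ζ) (n + 1) p) :
    Real.pi * (∫ x in B.bands, (g x).re * density B.roots N x) +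
        (k₁ * gapIntegral B.roots N B.a₁ B.a₂ - k₂ * gapIntegral B.roots N B.a₃ B.a₄) =
      Real.pi * (p.coeff n).im := by
  rw [← hG.setIntegral_re_eq (fun _ => B.mem_Icc_of_mem_roots) B.even_card_roots hT,
    B.integral_Icc_re_eq_bands_add_gaps (hG.integrableOn_mul_cutInvRoot B.roots N) hk₁ hk₂,
    integral_const_mul]

end BranchPoints

theorem hasTaylor_diskForm {S : Finset ℝ} {N : ℝ[X]} {G : ℂ → ℂ} {k j n : ℕ} {p q : ℂ[X]}
    (hN : HasTaylor (fun ζ => (2 * ζ) ^ k * aeval (joukowski ζ) N * diskInvRoot S ζ) n p)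
    (hG : HasTaylor (fun ζ => ζ ^ j * G ζ) n q) :
    HasTaylor (fun ζ => ζ ^ (k + j + 2) * diskForm S N G ζ) n
      (C (((2 ^ (k + 1))⁻¹ : ℝ) : ℂ) * (q * (X ^ 2 - 1) * p)) := by
  refine ((hasTaylor_eval n _).mul ((hG.mul (hasTaylor_eval n (X ^ 2 - 1))).mul hN)).congr_fun ?_
  filter_upwards [self_mem_nhdsWithin] with ζ (hζ : ζ ≠ 0)
  simp only [diskForm, eval_C, eval_sub, eval_pow, eval_X, eval_one]
  push_cast
  field_simp
  ring

theorem tendsto_prod_diskSqrt (S : Finset ℝ) :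
    Tendsto (fun ζ => ∏ a ∈ S, diskSqrt a ζ) (𝓝[≠] 0) (𝓝 1) := by
  have h : ContinuousAt (fun ζ => ∏ a ∈ S, diskSqrt a ζ) 0 :=
    tendsto_finsetProd S fun a _ => (differentiableAt_diskSqrt (by simp)).continuousAt
  have h_lim := h.tendsto.mono_left (nhdsWithin_le_nhds (s := {0}ᶜ))
  simpa only [diskSqrt_zero, Finset.prod_const_one] using h_lim

namespace BranchPoints

variable (B : BranchPoints)

/-- The sum of the branch points. -/
def esymm₁ : ℝ := B.a₁ + B.a₂ + B.a₃ + B.a₄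

/-- The second elementary symmetric function of the branch points. -/
def esymm₂ : ℝ :=
  B.a₁ * B.a₂ + B.a₁ * B.a₃ + B.a₁ * B.a₄ + B.a₂ * B.a₃ + B.a₂ * B.a₄ + B.a₃ * B.a₄

/-- The third elementary symmetric function of the branch points. -/
def esymm₃ : ℝ :=
  B.a₁ * B.a₂ * B.a₃ + B.a₁ * B.a₂ * B.a₄ + B.a₁ * B.a₃ * B.a₄ + B.a₂ * B.a₃ * B.a₄

/-- The product of the branch points. -/
def esymm₄ : ℝ := B.a₁ * B.a₂ * B.a₃ * B.a₄

/-- The coefficient of `z ^ 0` in the expansion of `√P` at infinity. -/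
noncomputable def sqrtCoeff₀ : ℝ := B.esymm₂ / 2 - B.esymm₁ ^ 2 / 8

/-- The coefficient of `z ^ (-1)` in the expansion of `√P` at infinity. -/
noncomputable def sqrtCoeff₁ : ℝ := (B.esymm₁ * B.sqrtCoeff₀ - B.esymm₃) / 2

/-- The coefficient of `z ^ (-2)` in the expansion of `√P` at infinity. -/
noncomputable def sqrtCoeff₂ : ℝ :=
  (B.esymm₄ + B.esymm₁ * B.sqrtCoeff₁ - B.sqrtCoeff₀ ^ 2) / 2

/-- The expansion of `4 ζ ^ 2 √P (joukowski ζ)` at `ζ = 0` up to order `5`. -/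
noncomputable def sqrtSeries : ℂ[X] :=
  1 - C (B.esymm₁ : ℂ) * X + C (2 + 4 * B.sqrtCoeff₀ : ℂ) * X ^ 2 +
    C (8 * B.sqrtCoeff₁ - B.esymm₁ : ℂ) * X ^ 3 + C (1 + 16 * B.sqrtCoeff₂ : ℂ) * X ^ 4

theorem hasTaylor_prod_diskSqrt :
    HasTaylor (fun ζ => ∏ a ∈ B.roots, diskSqrt a ζ) 5 B.sqrtSeries := by
  have h_zero : B.sqrtSeries.eval 0 = 1 := by simp [sqrtSeries]
  refine HasTaylor.of_sq (HasTaylor.of_eq_add (r := fun ζ =>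
    -((2 * ((2 + 4 * B.sqrtCoeff₀) * (8 * B.sqrtCoeff₁ - B.esymm₁) -
      B.esymm₁ * (1 + 16 * B.sqrtCoeff₂)) + 6 * B.esymm₁ + 8 * B.esymm₃) +
    ((8 * B.sqrtCoeff₁ - B.esymm₁) ^ 2 + 2 * (2 + 4 * B.sqrtCoeff₀) * (1 + 16 * B.sqrtCoeff₂) -
      4 - 4 * B.esymm₂) * ζ +
    2 * ((8 * B.sqrtCoeff₁ - B.esymm₁) * (1 + 16 * B.sqrtCoeff₂) + B.esymm₁) * ζ ^ 2 +
    ((1 + 16 * B.sqrtCoeff₂) ^ 2 - 1) * ζ ^ 3)) (by fun_prop) fun ζ _ => ?_) ?_ ?_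
  · rw [← Finset.prod_pow]
    simp only [diskSqrt_sq, B.prod_roots, sqrtSeries, eval_pow, eval_add, eval_sub, eval_mul,
      eval_one, eval_C, eval_X, sqrtCoeff₂, sqrtCoeff₁, sqrtCoeff₀, esymm₁, esymm₂, esymm₃, esymm₄]
    push_cast
    ring
  · rw [h_zero]
    exact one_ne_zero
  · rw [h_zero]
    exact tendsto_prod_diskSqrt B.roots

theorem hasTaylor_mul_diskInvRoot {f : ℂ → ℂ} {k : ℕ} {p : ℂ[X]} {n : ℕ} (hn : n ≤ 5)
    (hf : HasTaylor (fun ζ => (2 * ζ) ^ (k + 2) * f ζ) n (p * B.sqrtSeries)) :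
    HasTaylor (fun ζ => (2 * ζ) ^ k * f ζ * diskInvRoot B.roots ζ) n p := by
  refine (hf.div (B.hasTaylor_prod_diskSqrt.mono hn) one_ne_zero
    (tendsto_prod_diskSqrt B.roots)).congr_fun (Eventually.of_forall fun ζ => ?_)
  rw [diskInvRoot, Finset.prod_inv_distrib, B.card_roots]
  ring

/-- The monic quartic polynomial `P` whose roots are the branch points. -/
noncomputable def quartic : ℝ[X] :=
  X ^ 4 - C B.esymm₁ * X ^ 3 + C B.esymm₂ * X ^ 2 - C B.esymm₃ * X + C B.esymm₄

/-- The numerator of the quasimomentum differential, up to its constant term `c`, which is to be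
determined by the vanishing of the gap integrals. -/
noncomputable def num₀ (c : ℝ) : ℝ[X] := X ^ 2 - C (B.esymm₁ / 2) * X + C c

/-- The numerator of the quasienergy differential: `num₁ / √P` and a multiple of `num₀ / √P` differ
by the derivative of `√P / 2`. -/
noncomputable def num₁ (c : ℝ) : ℝ[X] :=
  C (1 / 4) * (derivative B.quartic + C B.esymm₁ * B.num₀ c)

/-- A numerator whose quotient by `√P` is, up to multiples of `num₀ / √P` and `num₁ / √P`, the
derivative of `X √P / 3`. -/
noncomputable def num₂ (c : ℝ) : ℝ[X] :=
  C (1 / 3) * (B.quartic + C (1 / 2) * X * derivative B.quartic + C B.esymm₁ * B.num₁ c -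
    C B.sqrtCoeff₀ * B.num₀ c)

/-- The constant term of `num₁ c`. -/
noncomputable def numCoeff₁ (c : ℝ) : ℝ := (B.esymm₁ * c - B.esymm₃) / 4

/-- The constant term of `num₂ c`. -/
noncomputable def numCoeff₂ (c : ℝ) : ℝ :=
  (B.esymm₄ + B.esymm₁ * B.numCoeff₁ c - B.sqrtCoeff₀ * c) / 3

theorem num₁_eq (c : ℝ) : B.num₁ c =
    X ^ 3 - C (B.esymm₁ / 2) * X ^ 2 + C B.sqrtCoeff₀ * X + C (B.numCoeff₁ c) := by
  refine funext fun x => ?_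
  simp [num₁, num₀, quartic, numCoeff₁, sqrtCoeff₀]
  ring

theorem num₂_eq (c : ℝ) : B.num₂ c =
    X ^ 4 - C (B.esymm₁ / 2) * X ^ 3 + C B.sqrtCoeff₀ * X ^ 2 + C B.sqrtCoeff₁ * X +
      C (B.numCoeff₂ c) := by
  refine funext fun x => ?_
  simp [num₂, num₁_eq, num₀, quartic, numCoeff₂, sqrtCoeff₁, sqrtCoeff₀]
  ring

theorem hasTaylor_num₀ (c : ℝ) :
    HasTaylor (fun ζ => (2 * ζ) ^ 0 * aeval (joukowski ζ) (B.num₀ c) * diskInvRoot B.roots ζ) 3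
      (1 + C (4 * (c - B.sqrtCoeff₀) : ℂ) * X ^ 2) := by
  obtain ⟨c₂, h₂⟩ : ∃ c₂ : ℂ, c₂ = 2 + 4 * B.sqrtCoeff₀ := ⟨_, rfl⟩
  obtain ⟨c₃, h₃⟩ : ∃ c₃ : ℂ, c₃ = 8 * B.sqrtCoeff₁ - B.esymm₁ := ⟨_, rfl⟩
  obtain ⟨c₄, h₄⟩ : ∃ c₄ : ℂ, c₄ = 1 + 16 * B.sqrtCoeff₂ := ⟨_, rfl⟩
  obtain ⟨d₂, k₂⟩ : ∃ d₂ : ℂ, d₂ = 4 * (c - B.sqrtCoeff₀) := ⟨_, rfl⟩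
  refine B.hasTaylor_mul_diskInvRoot (by norm_num) (.of_eq_add (r := fun ζ =>
    (-B.esymm₁ - (c₃ - d₂ * B.esymm₁)) + (1 - (c₄ + d₂ * c₂)) * ζ - d₂ * c₃ * ζ ^ 2 -
      d₂ * c₄ * ζ ^ 3) (by fun_prop) fun ζ hζ => ?_)
  simp only [sqrtSeries, num₀, joukowski, map_add, map_sub, map_mul, map_pow, aeval_X, aeval_C,
    Complex.coe_algebraMap, eval_add, eval_sub, eval_mul, eval_pow, eval_one, eval_X, eval_C,
    Complex.ofReal_div, Complex.ofReal_ofNat, ← h₂, ← h₃, ← h₄, ← k₂]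
  field_simp
  rw [h₂, k₂]
  ring

theorem hasTaylor_num₁ (c : ℝ) :
    HasTaylor (fun ζ => (2 * ζ) ^ 1 * aeval (joukowski ζ) (B.num₁ c) * diskInvRoot B.roots ζ) 5
      (1 + X ^ 2 + C (8 * (B.numCoeff₁ c - B.sqrtCoeff₁) : ℂ) * X ^ 3 +
        C (8 * (B.esymm₁ * (B.numCoeff₁ c - B.sqrtCoeff₁) - 2 * B.sqrtCoeff₂) : ℂ) * X ^ 4) := by
  obtain ⟨c₂, h₂⟩ : ∃ c₂ : ℂ, c₂ = 2 + 4 * B.sqrtCoeff₀ := ⟨_, rfl⟩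
  obtain ⟨c₃, h₃⟩ : ∃ c₃ : ℂ, c₃ = 8 * B.sqrtCoeff₁ - B.esymm₁ := ⟨_, rfl⟩
  obtain ⟨c₄, h₄⟩ : ∃ c₄ : ℂ, c₄ = 1 + 16 * B.sqrtCoeff₂ := ⟨_, rfl⟩
  obtain ⟨d₃, k₃⟩ : ∃ d₃ : ℂ, d₃ = 8 * (B.numCoeff₁ c - B.sqrtCoeff₁) := ⟨_, rfl⟩
  obtain ⟨d₄, k₄⟩ : ∃ d₄ : ℂ,
    d₄ = 8 * (B.esymm₁ * (B.numCoeff₁ c - B.sqrtCoeff₁) - 2 * B.sqrtCoeff₂) := ⟨_, rfl⟩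
  refine B.hasTaylor_mul_diskInvRoot le_rfl (.of_eq_add (r := fun ζ =>
    (-B.esymm₁ - (c₃ + d₃ * c₂ - d₄ * B.esymm₁)) + (1 - (c₄ + d₃ * c₃ + d₄ * c₂)) * ζ -
      (d₃ * c₄ + d₄ * c₃) * ζ ^ 2 - d₄ * c₄ * ζ ^ 3) (by fun_prop) fun ζ hζ => ?_)
  simp only [sqrtSeries, num₁_eq, joukowski, map_add, map_sub, map_mul, map_pow, aeval_X, aeval_C,
    Complex.coe_algebraMap, eval_add, eval_sub, eval_mul, eval_pow, eval_one, eval_X, eval_C,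
    Complex.ofReal_div, Complex.ofReal_ofNat, ← h₂, ← h₃, ← h₄, ← k₃, ← k₄]
  field_simp
  rw [h₂, h₃, h₄, k₃, k₄]
  ring

theorem hasTaylor_num₂ (c : ℝ) :
    HasTaylor (fun ζ => (2 * ζ) ^ 2 * aeval (joukowski ζ) (B.num₂ c) * diskInvRoot B.roots ζ) 5
      ((1 + X ^ 2) ^ 2 + C (16 * (B.numCoeff₂ c - B.sqrtCoeff₂) : ℂ) * X ^ 4) := by
  obtain ⟨c₂, h₂⟩ : ∃ c₂ : ℂ, c₂ = 2 + 4 * B.sqrtCoeff₀ := ⟨_, rfl⟩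
  obtain ⟨c₃, h₃⟩ : ∃ c₃ : ℂ, c₃ = 8 * B.sqrtCoeff₁ - B.esymm₁ := ⟨_, rfl⟩
  obtain ⟨c₄, h₄⟩ : ∃ c₄ : ℂ, c₄ = 1 + 16 * B.sqrtCoeff₂ := ⟨_, rfl⟩
  obtain ⟨d₄, k₄⟩ : ∃ d₄ : ℂ, d₄ = 16 * (B.numCoeff₂ c - B.sqrtCoeff₂) := ⟨_, rfl⟩
  refine B.hasTaylor_mul_diskInvRoot le_rfl (.of_eq_add (r := fun ζ =>
    (8 * B.sqrtCoeff₁ - 3 * B.esymm₁ - (2 * c₃ - (1 + d₄) * B.esymm₁)) +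
      (4 + 4 * B.sqrtCoeff₀ - (2 * c₄ + (1 + d₄) * c₂)) * ζ - (B.esymm₁ + (1 + d₄) * c₃) * ζ ^ 2 +
      (1 - (1 + d₄) * c₄) * ζ ^ 3) (by fun_prop) fun ζ hζ => ?_)
  simp only [sqrtSeries, num₂_eq, joukowski, map_add, map_sub, map_mul, map_pow, aeval_X, aeval_C,
    Complex.coe_algebraMap, eval_add, eval_sub, eval_mul, eval_pow, eval_one, eval_X, eval_C,
    Complex.ofReal_div, Complex.ofReal_ofNat, ← h₂, ← h₃, ← h₄, ← k₄]
  field_simp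
  rw [h₂, h₃, h₄, k₄]
  ring

end BranchPoints

theorem hasBoundaryValue_const :
    HasBoundaryValue (fun _ => Complex.I) (fun _ => Complex.I) (fun _ => 1) ∅ where
  differentiableAt _ _ _ := differentiableAt_const _
  map_conj _ _ := by rw [Complex.conj_I, neg_neg]
  continuousAt _ _ _ := continuousAt_const
  circle _ _ _ := rfl
  norm_le _ _ _ _ _ _ := Complex.norm_I.le
  measurable := measurable_const
  integrableOn S :=
    ((locallyIntegrable_absInvRoot S).integrableOn_isCompact isCompact_Icc).const_mul 1

theorem absR₀_cos {θ : ℝ} (hθ : θ ∈ Ioo 0 Real.pi) : absR₀ (Real.cos θ) = Real.sin θ := by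
  rw [absR₀, ← Real.sin_sq, Real.sqrt_sq (Real.sin_pos_of_mem_Ioo hθ).le]

theorem measurable_absR₀ : Measurable absR₀ := by
  unfold absR₀
  fun_prop

theorem hasBoundaryValue_absR₀ : HasBoundaryValue (fun ζ => Complex.I * (ζ⁻¹ - ζ) / 2)
    (fun x => (absR₀ x : ℂ)) (fun _ => 2) ∅ where
  differentiableAt ζ _ h₀ :=
    (((differentiableAt_inv h₀).sub differentiableAt_id).const_mul _).div_const 2
  map_conj ζ _ := by
    simp only [map_div₀, map_mul, map_sub, map_inv₀, Complex.conj_I, map_ofNat]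
    ring
  continuousAt θ _ _ :=
    ((continuousAt_inv₀ (circleMap_ne_center one_ne_zero)).sub continuousAt_id).const_mul _
      |>.div_const 2
  circle θ hθ _ := by
    rw [circle_inv_sub, absR₀_cos hθ]
    linear_combination -(Real.sin θ : ℂ) * Complex.I_sq
  norm_le θ _ _ r hr hr1 := by
    have h := norm_sub_le (circleMap 0 r θ)⁻¹ (circleMap 0 r θ)
    rw [norm_circleMap_zero_of_nonneg (by linarith)] at h
    rw [norm_div, norm_mul, Complex.norm_I, Complex.norm_ofNat, one_mul]
    linarith [norm_inv_circleMap_le hr θ]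
  measurable := Complex.measurable_ofReal.comp measurable_absR₀
  integrableOn S :=
    ((locallyIntegrable_absInvRoot S).integrableOn_isCompact isCompact_Icc).const_mul 2

namespace BranchPoints

section Residues

variable {B : BranchPoints} {G : ℂ → ℂ} {g : ℝ → ℂ} {b : ℝ → ℝ} {T : Finset ℝ} {k₁ k₂ : ℝ}
  {p q : ℂ[X]}

theorem setIntegral_bands_add_gapIntegrals_of_hasTaylor {N : ℝ[X]} {k j : ℕ}
    (hG : HasBoundaryValue G g b T) (hk₁ : ∀ x ∈ Ioo B.a₁ B.a₂, (g x).im = k₁)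
    (hk₂ : ∀ x ∈ Ioo B.a₃ B.a₄, (g x).im = k₂)
    (hq : HasTaylor (fun ζ => ζ ^ j * G ζ) (k + j + 2) q)
    (hN : HasTaylor (fun ζ => (2 * ζ) ^ k * aeval (joukowski ζ) N * diskInvRoot B.roots ζ)
      (k + j + 2) p) :
    Real.pi * (∫ x in B.bands, (g x).re * density B.roots N x) +
        (k₁ * gapIntegral B.roots N B.a₁ B.a₂ - k₂ * gapIntegral B.roots N B.a₃ B.a₄) =
      Real.pi * (((q * (X ^ 2 - 1) * p).coeff (k + j + 1)).im / 2 ^ (k + 1)) := by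
  rw [B.setIntegral_bands_add_gapIntegrals hG hk₁ hk₂ (hasTaylor_diskForm hN hq), coeff_C_mul,
    Complex.im_ofReal_mul, div_eq_inv_mul]

theorem setIntegral_num₀_add_gapIntegrals (c : ℝ) (hG : HasBoundaryValue G g b T)
    (hq : HasTaylor G 2 q) (hk₁ : ∀ x ∈ Ioo B.a₁ B.a₂, (g x).im = k₁)
    (hk₂ : ∀ x ∈ Ioo B.a₃ B.a₄, (g x).im = k₂) :
    Real.pi * (∫ x in B.bands, (g x).re * density B.roots (B.num₀ c) x) +
        (k₁ * gapIntegral B.roots (B.num₀ c) B.a₁ B.a₂ -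
          k₂ * gapIntegral B.roots (B.num₀ c) B.a₃ B.a₄) =
      Real.pi * (-(q.coeff 1).im / 2) := by
  rw [setIntegral_bands_add_gapIntegrals_of_hasTaylor (k := 0) (j := 0) hG hk₁ hk₂
    (by simpa using hq) ((B.hasTaylor_num₀ c).mono (by norm_num))]
  simp [coeff_mul, Finset.Nat.antidiagonal_succ, coeff_one, coeff_C, coeff_X_pow]

theorem setIntegral_num₁_add_gapIntegrals (c : ℝ) (hG : HasBoundaryValue G g b T)
    (hq : HasTaylor G 3 q) (hk₁ : ∀ x ∈ Ioo B.a₁ B.a₂, (g x).im = k₁)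
    (hk₂ : ∀ x ∈ Ioo B.a₃ B.a₄, (g x).im = k₂) :
    Real.pi * (∫ x in B.bands, (g x).re * density B.roots (B.num₁ c) x) +
        (k₁ * gapIntegral B.roots (B.num₁ c) B.a₁ B.a₂ -
          k₂ * gapIntegral B.roots (B.num₁ c) B.a₃ B.a₄) =
      Real.pi * (-(q.coeff 2).im / 4) := by
  rw [setIntegral_bands_add_gapIntegrals_of_hasTaylor (k := 1) (j := 0) hG hk₁ hk₂
    (by simpa using hq) ((B.hasTaylor_num₁ c).mono (by norm_num))]
  simp [coeff_mul, Finset.Nat.antidiagonal_succ, coeff_one, coeff_C, coeff_X_pow]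
  norm_num

theorem setIntegral_num₂_add_gapIntegrals (c : ℝ) (hG : HasBoundaryValue G g b T)
    (hq : HasTaylor G 4 q) (hk₁ : ∀ x ∈ Ioo B.a₁ B.a₂, (g x).im = k₁)
    (hk₂ : ∀ x ∈ Ioo B.a₃ B.a₄, (g x).im = k₂) :
    Real.pi * (∫ x in B.bands, (g x).re * density B.roots (B.num₂ c) x) +
        (k₁ * gapIntegral B.roots (B.num₂ c) B.a₁ B.a₂ -
          k₂ * gapIntegral B.roots (B.num₂ c) B.a₃ B.a₄) =
      Real.pi * (-((q.coeff 1).im + (q.coeff 3).im) / 8) := by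
  rw [setIntegral_bands_add_gapIntegrals_of_hasTaylor (k := 2) (j := 0) hG hk₁ hk₂
    (by simpa using hq) ((B.hasTaylor_num₂ c).mono (by norm_num))]
  simp [coeff_mul, Finset.Nat.antidiagonal_succ, coeff_one, coeff_C, coeff_X, pow_two]
  ring

theorem gapIntegral_num₀_eq (c : ℝ) : gapIntegral B.roots (B.num₀ c) B.a₁ B.a₂ =
    gapIntegral B.roots (B.num₀ c) B.a₃ B.a₄ := by
  have h := setIntegral_num₀_add_gapIntegrals (B := B) c hasBoundaryValue_const
    (by simpa using hasTaylor_eval 2 (C Complex.I)) (fun _ _ => Complex.I_im)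
    (fun _ _ => Complex.I_im)
  simp only [Complex.I_re, zero_mul, integral_zero, coeff_C_succ, Complex.zero_im] at h
  linarith

theorem setIntegral_absR₀_mul_density {N : ℝ[X]} {k : ℕ}
    (hN : HasTaylor (fun ζ => (2 * ζ) ^ k * aeval (joukowski ζ) N * diskInvRoot B.roots ζ)
      (k + 3) p) :
    ∫ x in B.bands, absR₀ x * density B.roots N x =
      -((((1 - X ^ 2) ^ 2 * p).coeff (k + 2)).re / 2 ^ (k + 2)) := by
  have hq : HasTaylor (fun ζ => ζ ^ 1 * (Complex.I * (ζ⁻¹ - ζ) / 2)) (k + 1 + 2)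
      (C ((2⁻¹ : ℝ) * Complex.I) * (1 - X ^ 2)) := by
    refine (hasTaylor_eval _ _).congr_fun ?_
    filter_upwards [self_mem_nhdsWithin] with ζ (hζ : ζ ≠ 0)
    simp only [eval_mul, eval_C, eval_sub, eval_one, eval_pow, eval_X]
    push_cast
    field_simp
  have h := setIntegral_bands_add_gapIntegrals_of_hasTaylor hasBoundaryValue_absR₀
    (fun _ _ => Complex.ofReal_im _) (fun _ _ => Complex.ofReal_im _) hq hN
  rw [show (C ((2⁻¹ : ℝ) * Complex.I) * (1 - X ^ 2) * (X ^ 2 - 1) * p : ℂ[X]) =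
    C ((2⁻¹ : ℝ) * Complex.I) * -((1 - X ^ 2) ^ 2 * p) by ring, coeff_C_mul, coeff_neg, mul_assoc,
    Complex.im_ofReal_mul, Complex.I_mul_im, Complex.neg_re, zero_mul, zero_mul, sub_zero,
    add_zero] at h
  have h := mul_left_cancel₀ Real.pi_ne_zero h
  simp only [Complex.ofReal_re] at h
  rw [h, pow_succ _ (k + 1)]
  field_simp

theorem setIntegral_absR₀_mul_density_num₀ (c : ℝ) :
    ∫ x in B.bands, absR₀ x * density B.roots (B.num₀ c) x = 1 / 2 - (c - B.sqrtCoeff₀) := by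
  rw [setIntegral_absR₀_mul_density (k := 0) (B.hasTaylor_num₀ c)]
  simp [coeff_mul, Finset.Nat.antidiagonal_succ, coeff_one, coeff_C, coeff_X, pow_two]
  ring

theorem hasTaylor_X_mul_num₁ (c : ℝ) : HasTaylor
    (fun ζ => (2 * ζ) ^ 2 * aeval (joukowski ζ) (X * B.num₁ c) * diskInvRoot B.roots ζ) 5
    ((1 + X ^ 2) * (1 + X ^ 2 + C (8 * (B.numCoeff₁ c - B.sqrtCoeff₁) : ℂ) * X ^ 3 +
      C (8 * (B.esymm₁ * (B.numCoeff₁ c - B.sqrtCoeff₁) - 2 * B.sqrtCoeff₂) : ℂ) * X ^ 4)) := by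
  refine ((hasTaylor_eval 5 (1 + X ^ 2)).mul (B.hasTaylor_num₁ c)).congr_fun ?_
  filter_upwards [self_mem_nhdsWithin] with ζ (hζ : ζ ≠ 0)
  simp only [eval_add, eval_one, eval_pow, eval_X, map_mul, aeval_X, joukowski]
  field_simp
  ring

theorem setIntegral_absR₀_mul_density_num₂ (c : ℝ) :
    ∫ x in B.bands, absR₀ x * density B.roots (B.num₂ c) x =
      1 / 8 - (B.numCoeff₂ c - B.sqrtCoeff₂) := by
  rw [setIntegral_absR₀_mul_density (k := 2) (B.hasTaylor_num₂ c)]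
  generalize h : (16 * (B.numCoeff₂ c - B.sqrtCoeff₂) : ℂ) = d
  rw [show ((1 - X ^ 2) ^ 2 * ((1 + X ^ 2) ^ 2 + C d * X ^ 4) : ℂ[X]) =
    1 + (C d - 2) * X ^ 4 + (X ^ 3 - 2 * C d * X + C d * X ^ 3) * X ^ 5 by ring]
  simp only [coeff_add, coeff_one, coeff_mul_X_pow', coeff_sub, ← h]
  norm_num
  ring

theorem setIntegral_absR₀_mul_density_X_mul_num₁ (c : ℝ) :
    ∫ x in B.bands, absR₀ x * density B.roots (X * B.num₁ c) x =
      1 / 8 - (B.esymm₁ * (B.numCoeff₁ c - B.sqrtCoeff₁) / 2 - B.sqrtCoeff₂) := by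
  rw [setIntegral_absR₀_mul_density (k := 2) (B.hasTaylor_X_mul_num₁ c)]
  generalize h :
    (8 * (B.esymm₁ * (B.numCoeff₁ c - B.sqrtCoeff₁) - 2 * B.sqrtCoeff₂) : ℂ) = d
  generalize (8 * (B.numCoeff₁ c - B.sqrtCoeff₁) : ℂ) = e
  rw [show ((1 - X ^ 2) ^ 2 * ((1 + X ^ 2) * (1 + X ^ 2 + C e * X ^ 3 + C d * X ^ 4)) : ℂ[X]) =
    1 + C e * X ^ 3 + (C d - 2) * X ^ 4 + (X ^ 3 - (C e + C d * X) * (1 + X ^ 2 - X ^ 4)) * X ^ 5 by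
      ring]
  simp only [coeff_add, coeff_one, coeff_mul_X_pow', coeff_sub,
    coeff_C_succ, ← h]
  norm_num
  ring

end Residues

end BranchPoints

theorem hasTaylor_log_one_sub_mul (η : ℂ) (n : ℕ) :
    HasTaylor (fun ζ => Complex.log (1 - ζ * η)) (n + 1)
      (-∑ k ∈ Finset.range (n + 1), C (η ^ k / k) * X ^ k) := by
  have h_tendsto : Tendsto (fun ζ : ℂ => -(ζ * η)) (𝓝[≠] 0) (𝓝 0) :=
    (Continuous.tendsto' (by fun_prop) 0 0 (by simp)).mono_left nhdsWithin_le_nhds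
  have h_pow : (fun ζ : ℂ => (-(ζ * η)) ^ (n + 1)) =O[𝓝[≠] 0] fun ζ => ζ ^ (n + 1) :=
    ((isBigO_refl _ _).const_mul_left ((-η) ^ (n + 1))).congr_left fun ζ => by ring
  refine (((Complex.log_sub_logTaylor_isBigO n).comp_tendsto h_tendsto).trans h_pow).congr_left
    fun ζ => ?_
  simp only [Function.comp_apply, Complex.logTaylor, eval_neg, eval_finsetSum, eval_mul, eval_C,
    eval_pow, eval_X, ← sub_eq_add_neg, ← Finset.sum_neg_distrib]
  congr 1
  refine Finset.sum_congr rfl fun k _ => ?_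
  have h_sign : (-1 : ℂ) ^ k * (-1) ^ k = 1 := by rw [← mul_pow]; norm_num
  linear_combination -(ζ ^ k * η ^ k / k) * h_sign + (-1) ^ (k + 1) / (k : ℂ) * neg_pow (ζ * η) k

theorem log_one_sub_circleMap {φ : ℝ} (h₀ : 0 < φ) (h₁ : φ < 2 * Real.pi) :
    Complex.log (1 - circleMap 0 1 φ) =
      Real.log (2 * Real.sin (φ / 2)) + ((φ - Real.pi) / 2 : ℝ) * Complex.I := by
  have h_sin : 0 < Real.sin (φ / 2) := Real.sin_pos_of_mem_Ioo ⟨by linarith, by linarith⟩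
  have h_polar : 1 - circleMap 0 1 φ = ((2 * Real.sin (φ / 2) : ℝ) : ℂ) *
      Complex.exp (((φ - Real.pi) / 2 : ℝ) * Complex.I) := by
    have h_half : (φ - Real.pi) / 2 = φ / 2 - Real.pi / 2 := by ring
    obtain ⟨ψ, rfl⟩ : ∃ ψ, φ = 2 * ψ := ⟨φ / 2, by ring⟩
    apply Complex.ext
    · rw [Complex.re_ofReal_mul, Complex.exp_ofReal_mul_I_re, Complex.sub_re, circleMap_zero_re,
        h_half, Real.cos_sub_pi_div_two, Complex.one_re, mul_div_cancel_left₀ _ two_ne_zero,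
        Real.cos_two_mul, Real.cos_sq']
      ring
    · rw [Complex.im_ofReal_mul, Complex.exp_ofReal_mul_I_im, Complex.sub_im, circleMap_zero_im,
        h_half, Real.sin_sub_pi_div_two, Complex.one_im, mul_div_cancel_left₀ _ two_ne_zero,
        Real.sin_two_mul]
      ring
  rw [h_polar, Complex.log_ofReal_mul (by positivity) (Complex.exp_ne_zero _), Complex.log_exp] <;>
  · rw [Complex.im_ofReal_mul, Complex.I_im]
    linarith

theorem log_one_sub_circleMap_neg {φ : ℝ} (h₀ : 0 < φ) (h₁ : φ < 2 * Real.pi) :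
    Complex.log (1 - circleMap 0 1 (-φ)) =
      Real.log (2 * Real.sin (φ / 2)) - ((φ - Real.pi) / 2 : ℝ) * Complex.I := by
  rw [← periodic_circleMap, log_one_sub_circleMap (by linarith) (by linarith),
    show (-φ + 2 * Real.pi) / 2 = Real.pi - φ / 2 by ring, Real.sin_pi_sub]
  push_cast
  ring

theorem kernel_cos {α θ : ℝ} (hα : α ∈ Ioo 0 Real.pi) (hθ : θ ∈ Ioo 0 Real.pi) (h : θ ≠ α) :
    kernel (Real.cos α) (Real.cos θ) =
      Real.log (2 * Real.sin ((θ + α) / 2)) - Real.log (2 * |Real.sin ((θ - α) / 2)|) := by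
  obtain ⟨x, y, rfl, rfl⟩ : ∃ x y, θ = x + y ∧ α = x - y :=
    ⟨(θ + α) / 2, (θ - α) / 2, by ring, by ring⟩
  rw [kernel, absR₀_cos hα, absR₀_cos hθ, show (x + y + (x - y)) / 2 = x by ring,
    show (x + y - (x - y)) / 2 = y by ring]
  obtain ⟨hα₀, hα₁⟩ := hα
  obtain ⟨hθ₀, hθ₁⟩ := hθ
  have hx : 0 < Real.sin x := Real.sin_pos_of_mem_Ioo ⟨by linarith, by linarith⟩
  have hy : Real.sin y ≠ 0 := by
    rw [Ne, Real.sin_eq_zero_iff_of_lt_of_lt (by linarith) (by linarith)]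
    exact fun hy => h (by rw [hy, add_zero, sub_zero])
  have h_num : -(Real.sin (x - y) * Real.sin (x + y)) + Real.cos (x + y) * Real.cos (x - y) - 1 =
      -(2 * Real.sin x * Real.sin x) := by
    rw [Real.sin_sub, Real.sin_add, Real.cos_sub, Real.cos_add]
    nlinarith [Real.sin_sq_add_cos_sq x, Real.sin_sq_add_cos_sq y]
  have h_den : Real.cos (x - y) - Real.cos (x + y) = 2 * Real.sin y * Real.sin x := by
    rw [Real.cos_sub, Real.cos_add]
    ring
  rw [h_num, h_den, neg_div, abs_neg, mul_div_mul_right _ _ hx.ne', abs_div, abs_mul, abs_mul,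
    abs_of_pos hx, abs_two, Real.log_div (by positivity) (by positivity)]

/-- The function `log ((1 - ζe^{iα}) / (1 - ζe^{-iα}))` on the unit disc. The real part of its
boundary value at `e^{iθ}` is `kernel (cos α) (cos θ)`. -/
noncomputable def logPotential (α : ℝ) (ζ : ℂ) : ℂ :=
  Complex.log (1 - ζ * circleMap 0 1 α) - Complex.log (1 - ζ * circleMap 0 1 (-α))

/-- The boundary value of `logPotential α`, as a function of `X = cos θ`. -/
noncomputable def cutPotential (α X : ℝ) : ℂ :=
  kernel (Real.cos α) X + (if X < Real.cos α then α else α - Real.pi : ℝ) * Complex.I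

theorem logPotential_circle {α θ : ℝ} (hα : α ∈ Ioo 0 Real.pi) (hθ : θ ∈ Ioo 0 Real.pi)
    (h : Real.cos θ ≠ Real.cos α) :
    logPotential α (circleMap 0 1 θ) = cutPotential α (Real.cos θ) := by
  have hne : θ ≠ α := fun h' => h (by rw [h'])
  rw [logPotential, cutPotential, kernel_cos hα hθ hne, circleMap_zero_mul, circleMap_zero_mul,
    one_mul]
  obtain ⟨hα₀, hα₁⟩ := hα
  obtain ⟨hθ₀, hθ₁⟩ := hθ
  rw [log_one_sub_circleMap (φ := θ + α) (by linarith) (by linarith)]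
  rcases lt_or_gt_of_ne hne with hlt | hlt
  · have h_cos : Real.cos α < Real.cos θ := Real.cos_lt_cos_of_nonneg_of_le_pi hθ₀.le hα₁.le hlt
    have h_sin := Real.sin_pos_of_mem_Ioo (x := (α - θ) / 2) ⟨by linarith, by linarith⟩
    rw [show θ + -α = -(α - θ) by ring,
      log_one_sub_circleMap_neg (φ := α - θ) (by linarith) (by linarith), if_neg h_cos.not_gt,
      ← neg_sub α θ, neg_div, Real.sin_neg, abs_neg, abs_of_pos h_sin]
    push_cast
    ring
  · have h_cos : Real.cos θ < Real.cos α := Real.cos_lt_cos_of_nonneg_of_le_pi hα₀.le hθ₁.le hlt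
    have h_sin := Real.sin_pos_of_mem_Ioo (x := (θ - α) / 2) ⟨by linarith, by linarith⟩
    rw [← sub_eq_add_neg, log_one_sub_circleMap (φ := θ - α) (by linarith) (by linarith),
      if_pos h_cos, abs_of_pos h_sin]
    push_cast
    ring

theorem one_sub_mem_slitPlane {w : ℂ} (hw : ‖w‖ ≤ 1) (h₁ : w ≠ 1) :
    1 - w ∈ Complex.slitPlane := by
  rw [Complex.mem_slitPlane_iff]
  by_contra! h
  simp only [Complex.sub_re, Complex.one_re, Complex.sub_im, Complex.one_im, zero_sub,
    neg_eq_zero] at h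
  have := Complex.re_le_norm w
  exact h₁ (Complex.ext (by rw [Complex.one_re]; linarith [h.1]) (by rw [h.2, Complex.one_im]))

theorem norm_log_le {w : ℂ} {d : ℝ} (hd : 0 < d) (hdw : d / 2 ≤ ‖w‖) (hw : ‖w‖ ≤ 2) :
    ‖Complex.log w‖ ≤ 18 * d ^ (-(1 / 4) : ℝ) := by
  have h_norm := Complex.norm_le_abs_re_add_abs_im (Complex.log w)
  rw [Complex.log_re, Complex.log_im] at h_norm
  have hw₀ : 0 < ‖w‖ := by linarith
  have h_upper := Real.log_le_sub_one_of_pos hw₀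
  have h_lower : -Real.log ‖w‖ ≤ 8 * d ^ (-(1 / 4) : ℝ) := by
    rw [← Real.log_inv]
    refine (Real.log_le_log (inv_pos.mpr hw₀) ?_).trans (log_two_div_le hd)
    exact inv_le_of_inv_le₀ (by positivity) (by rwa [inv_div])
  have h_one : 1 ≤ 2 * d ^ (-(1 / 4) : ℝ) := by
    calc (1 : ℝ) = 2 * 16 ^ (-(1 / 4) : ℝ) := by
          rw [show (16 : ℝ) = 2 ^ (4 : ℝ) by norm_num, ← Real.rpow_mul two_pos.le]
          norm_num
      _ ≤ 2 * d ^ (-(1 / 4) : ℝ) := by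
          gcongr ?_ * ?_
          exact Real.rpow_le_rpow_of_nonpos hd (by linarith) (by norm_num)
  have h_abs : |Real.log ‖w‖| ≤ 1 + 8 * d ^ (-(1 / 4) : ℝ) :=
    abs_le.mpr ⟨by linarith, by linarith⟩
  linarith [Complex.abs_arg_le_pi w, Real.pi_le_four]

theorem one_sub_mul_circleMap_mul (α : ℝ) (ζ : ℂ) :
    (1 - ζ * circleMap 0 1 α) * (1 - ζ * circleMap 0 1 (-α)) =
      1 - 2 * (Real.cos α : ℝ) * ζ + ζ ^ 2 := by
  have h_prod : circleMap 0 1 α * circleMap 0 1 (-α) = 1 := by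
    rw [circleMap_zero_mul, add_neg_cancel]
    simp [circleMap_zero]
  have h_sum : circleMap 0 1 α + circleMap 0 1 (-α) = 2 * (Real.cos α : ℝ) := by
    rw [← conj_circleMap_zero, Complex.add_conj, circleMap_zero_re, one_mul]
    push_cast
    ring
  linear_combination (-ζ) * h_sum + ζ ^ 2 * h_prod

theorem norm_one_sub_mul_circleMap_le {r : ℝ} (hr₀ : 0 ≤ r) (hr₁ : r ≤ 1) (θ α : ℝ) :
    ‖1 - circleMap 0 r θ * circleMap 0 1 α‖ ≤ 2 := by
  refine (norm_sub_le _ _).trans ?_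
  rw [circleMap_zero_mul, mul_one, norm_circleMap_zero_of_nonneg hr₀, norm_one]
  linarith

theorem abs_cos_sub_div_two_le_norm {r : ℝ} (hr : 1 / 2 ≤ r) (hr₁ : r ≤ 1) (θ α : ℝ) :
    |Real.cos θ - Real.cos α| / 2 ≤ ‖1 - circleMap 0 r θ * circleMap 0 1 α‖ := by
  have h := two_mul_abs_cos_sub_le_norm (a := Real.cos α) (r := r) (θ := θ)
    ⟨Real.neg_one_le_cos α, Real.cos_le_one α⟩ (by linarith)
  rw [← one_sub_mul_circleMap_mul, norm_mul] at h
  nlinarith [norm_one_sub_mul_circleMap_le (by linarith) hr₁ θ (-α),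
    norm_nonneg (1 - circleMap 0 r θ * circleMap 0 1 α), abs_nonneg (Real.cos θ - Real.cos α)]

theorem norm_log_one_sub_mul_circleMap_le {r θ α : ℝ} (hr : 1 / 2 ≤ r) (hr₁ : r ≤ 1)
    (h : Real.cos θ ≠ Real.cos α) :
    ‖Complex.log (1 - circleMap 0 r θ * circleMap 0 1 α)‖ ≤
      18 * |Real.cos θ - Real.cos α| ^ (-(1 / 4) : ℝ) :=
  norm_log_le (abs_pos.mpr (sub_ne_zero.mpr h)) (abs_cos_sub_div_two_le_norm hr hr₁ θ α)
    (norm_one_sub_mul_circleMap_le (by linarith) hr₁ θ α)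

theorem one_sub_mul_circleMap_mem_slitPlane {ζ : ℂ} (hζ : ‖ζ‖ < 1) (α : ℝ) :
    1 - ζ * circleMap 0 1 α ∈ Complex.slitPlane := by
  have h : ‖ζ * circleMap 0 1 α‖ < 1 := by
    rwa [norm_mul, norm_circleMap_zero, abs_one, mul_one]
  exact one_sub_mem_slitPlane h.le fun h' => by simp [h'] at h

theorem one_sub_circleMap_mul_mem_slitPlane {θ α : ℝ} (h : Real.cos θ ≠ Real.cos α) :
    1 - circleMap 0 1 θ * circleMap 0 1 α ∈ Complex.slitPlane := by
  refine one_sub_mem_slitPlane (by simp) fun h' => ?_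
  have h_le := abs_cos_sub_div_two_le_norm (by norm_num) le_rfl θ α
  rw [h', sub_self, norm_zero] at h_le
  linarith [abs_pos.mpr (sub_ne_zero.mpr h)]

theorem differentiableAt_log_one_sub_mul {ζ η : ℂ} (h : 1 - ζ * η ∈ Complex.slitPlane) :
    DifferentiableAt ℂ (fun ζ => Complex.log (1 - ζ * η)) ζ :=
  ((differentiableAt_id.mul_const η).const_sub 1).clog h

theorem logPotential_conj (α : ℝ) {ζ : ℂ} (hζ : ‖ζ‖ < 1) :
    logPotential α (conj ζ) = -conj (logPotential α ζ) := by
  have h_arg (β : ℝ) := Complex.slitPlane_arg_ne_pi (one_sub_mul_circleMap_mem_slitPlane hζ β)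
  rw [logPotential, logPotential, map_sub, ← Complex.log_conj _ (h_arg _),
    ← Complex.log_conj _ (h_arg _)]
  simp only [map_sub, map_one, map_mul, conj_circleMap_zero, neg_neg, neg_sub]

theorem measurable_cutPotential (α : ℝ) : Measurable (cutPotential α) := by
  refine (Complex.measurable_ofReal.comp (measurable_kernel_left _)).add
    ((Complex.measurable_ofReal.comp ?_).mul_const _)
  exact Measurable.ite measurableSet_Iio measurable_const measurable_const

theorem hasBoundaryValue_logPotential {α : ℝ} (hα : α ∈ Ioo 0 Real.pi) :
    HasBoundaryValue (logPotential α) (cutPotential α)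
      (fun X => 36 * |X - Real.cos α| ^ (-(1 / 4) : ℝ)) {Real.cos α} where
  differentiableAt ζ hζ _ :=
    (differentiableAt_log_one_sub_mul (one_sub_mul_circleMap_mem_slitPlane hζ α)).sub
      (differentiableAt_log_one_sub_mul (one_sub_mul_circleMap_mem_slitPlane hζ (-α)))
  map_conj ζ hζ := logPotential_conj α hζ
  continuousAt θ _ h := by
    rw [Finset.mem_singleton] at h
    exact (differentiableAt_log_one_sub_mul
      (one_sub_circleMap_mul_mem_slitPlane h)).continuousAt.sub
      (differentiableAt_log_one_sub_mul
        (one_sub_circleMap_mul_mem_slitPlane (by rwa [Real.cos_neg]))).continuousAt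
  circle θ hθ h := logPotential_circle hα hθ (by rwa [Finset.mem_singleton] at h)
  norm_le θ _ h r hr hr₁ := by
    rw [Finset.mem_singleton] at h
    have h_neg := norm_log_one_sub_mul_circleMap_le (θ := θ) (α := -α) hr hr₁.le
      (by rwa [Real.cos_neg])
    rw [Real.cos_neg] at h_neg
    refine (norm_sub_le _ _).trans ?_
    linarith [norm_log_one_sub_mul_circleMap_le hr hr₁.le h]
  measurable := measurable_cutPotential α
  integrableOn S := by
    simp only [mul_assoc]
    exact (integrableOn_abs_sub_rpow_mul_absInvRoot S (Real.cos α) (-1) 1).const_mul 36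

theorem circleMap_pow_sub_circleMap_neg_pow (α : ℝ) (k : ℕ) :
    circleMap 0 1 α ^ k - circleMap 0 1 (-α) ^ k = 2 * Real.sin (k * α) * Complex.I := by
  rw [circleMap_zero_pow, circleMap_zero_pow, one_pow, mul_neg, ← conj_circleMap_zero,
    Complex.sub_conj, circleMap_zero_im, one_mul]
  push_cast
  ring

theorem hasTaylor_logPotential (α : ℝ) (n : ℕ) : HasTaylor (logPotential α) (n + 1)
    (∑ k ∈ Finset.range (n + 1), C (-(2 * Real.sin (k * α) / k : ℝ) * Complex.I) * X ^ k) := by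
  have h := (hasTaylor_log_one_sub_mul (circleMap 0 1 α) n).sub
    (hasTaylor_log_one_sub_mul (circleMap 0 1 (-α)) n)
  refine Eq.subst (motive := fun p => HasTaylor (logPotential α) (n + 1) p) ?_ h
  rw [neg_sub_neg, ← Finset.sum_sub_distrib]
  refine Finset.sum_congr rfl fun k _ => ?_
  rw [← sub_mul, ← C_sub, ← sub_div, ← neg_sub (circleMap 0 1 α ^ k),
    circleMap_pow_sub_circleMap_neg_pow]
  push_cast
  ring_nf

theorem coeff_im_sum_sin_div (α : ℝ) {k n : ℕ} (hk : k < n) :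
    ((∑ k ∈ Finset.range n, C (-(2 * Real.sin (k * α) / k : ℝ) * Complex.I) * X ^ k :
      ℂ[X]).coeff k).im = -(2 * Real.sin (k * α) / k) := by
  simp only [finsetSum_coeff, coeff_C_mul_X_pow]
  rw [Finset.sum_ite_eq, if_pos (Finset.mem_range.mpr hk), ← Complex.ofReal_neg,
    Complex.im_ofReal_mul, Complex.I_im, mul_one]

theorem exists_cutPotential_im_eq {α b c : ℝ} (hα : Real.cos α ∉ Ioo b c) :
    ∃ k, ∀ x ∈ Ioo b c, (cutPotential α x).im = k := by
  by_cases hb : Real.cos α ≤ b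
  · refine ⟨α - Real.pi, fun x hx => ?_⟩
    simp [cutPotential, (hb.trans_lt hx.1).not_gt]
  · have hc : c ≤ Real.cos α := not_lt.mp fun hc => hα ⟨not_le.mp hb, hc⟩
    exact ⟨α, fun x hx => by simp [cutPotential, hx.2.trans_le hc]⟩

namespace BranchPoints

variable {B : BranchPoints}

theorem exists_cos_eq_of_mem_bands {z : ℝ} (hz : z ∈ B.bands) (hz₁ : z ^ 2 ≠ 1) :
    ∃ α ∈ Ioo 0 Real.pi, Real.cos α = z ∧
      (∃ k, ∀ x ∈ Ioo B.a₁ B.a₂, (cutPotential α x).im = k) ∧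
      ∃ k, ∀ x ∈ Ioo B.a₃ B.a₄, (cutPotential α x).im = k := by
  have hz_Icc := B.bands_subset hz
  have hz_Ioo : z ∈ Ioo (-1 : ℝ) 1 :=
    ⟨hz_Icc.1.lt_of_ne fun h => hz₁ (by rw [← h]; norm_num),
      hz_Icc.2.lt_of_ne fun h => hz₁ (by rw [h]; norm_num)⟩
  rw [← image_cos_Ioo] at hz_Ioo
  obtain ⟨α, hα, rfl⟩ := hz_Ioo
  have h_gaps := Set.disjoint_left.mp B.disjoint_bands_gaps hz
  exact ⟨α, hα, rfl, exists_cutPotential_im_eq fun h => h_gaps (Or.inl h),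
    exists_cutPotential_im_eq fun h => h_gaps (Or.inr h)⟩

end BranchPoints

theorem integrableOn_eval_mul_absInvRoot (S : Finset ℝ) (N : ℝ[X]) (b c : ℝ) :
    IntegrableOn (fun x => N.eval x * absInvRoot S x) (Ioo b c) :=
  (((locallyIntegrable_absInvRoot S).integrableOn_isCompact isCompact_Icc).continuousOn_mul
    N.continuous.continuousOn isCompact_Icc).mono_set Ioo_subset_Icc_self

theorem gapIntegral_add (S : Finset ℝ) (M N : ℝ[X]) (b c : ℝ) :
    gapIntegral S (M + N) b c = gapIntegral S M b c + gapIntegral S N b c := by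
  simp only [gapIntegral, eval_add, add_mul]
  exact integral_add (integrableOn_eval_mul_absInvRoot S M b c)
    (integrableOn_eval_mul_absInvRoot S N b c)

theorem gapIntegral_C_mul (S : Finset ℝ) (r : ℝ) (N : ℝ[X]) (b c : ℝ) :
    gapIntegral S (C r * N) b c = r * gapIntegral S N b c := by
  simp only [gapIntegral, eval_mul, eval_C, mul_assoc, integral_const_mul]

theorem absInvRoot_eq_inv_sqrt (S : Finset ℝ) (x : ℝ) :
    absInvRoot S x = (√|(∏ a ∈ S, (X - C a)).eval x|)⁻¹ := by
  rw [absInvRoot, eval_prod, Finset.abs_prod, Real.sqrt_eq_rpow,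
    ← Real.finsetProd_rpow _ _ fun _ _ => abs_nonneg _, ← Finset.prod_inv_distrib]
  refine Finset.prod_congr rfl fun a _ => ?_
  rw [eval_sub, eval_X, eval_C, Real.rpow_neg (abs_nonneg _)]

/-- The integrand is the derivative of `-p √(-P)`, which vanishes at both ends of the gap. -/
theorem gapIntegral_eq_zero_of_exact {S : Finset ℝ} {P : ℝ[X]} (hP : P = ∏ a ∈ S, (X - C a))
    (p : ℝ[X]) {b c : ℝ} (hb : b ∈ S) (hc : c ∈ S) (hbc : b ≤ c)
    (h_neg : ∀ x ∈ Ioo b c, P.eval x < 0) :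
    gapIntegral S (derivative p * P + C (1 / 2) * p * derivative P) b c = 0 := by
  have h_root : ∀ a ∈ S, P.eval a = 0 := fun a ha => by
    rw [hP, eval_prod]
    exact Finset.prod_eq_zero ha (by simp)
  have h_deriv : ∀ x ∈ Ioo b c, HasDerivAt (fun y => -(p.eval y * √(-P.eval y)))
      ((derivative p * P + C (1 / 2) * p * derivative P).eval x * absInvRoot S x) x := by
    intro x hx
    have hPx := neg_pos.mpr (h_neg x hx)
    have h_sqrt : HasDerivAt (fun y => √(-P.eval y))
        (-(derivative P).eval x / (2 * √(-P.eval x))) x := (P.hasDerivAt x).neg.sqrt hPx.ne'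
    refine ((p.hasDerivAt x).mul h_sqrt).neg.congr_deriv ?_
    have h_sq := Real.sq_sqrt hPx.le
    have := Real.sqrt_pos.mpr hPx
    rw [absInvRoot_eq_inv_sqrt, ← hP, abs_of_neg (h_neg x hx)]
    simp only [eval_add, eval_mul, eval_C]
    field_simp
    linear_combination (-2 * (derivative p).eval x) * h_sq
  have h_int := integrableOn_eval_mul_absInvRoot S
    (derivative p * P + C (1 / 2) * p * derivative P) b c
  rw [gapIntegral, ← integral_Ioc_eq_integral_Ioo, ← intervalIntegral.integral_of_le hbc,
    intervalIntegral.integral_eq_sub_of_hasDerivAt_of_le hbc (by fun_prop) h_deriv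
      ((intervalIntegrable_iff_integrableOn_Ioo_of_le hbc).mpr h_int),
    h_root b hb, h_root c hc]
  simp

namespace BranchPoints

variable (B : BranchPoints)

theorem mem_roots {a : ℝ} : a ∈ B.roots ↔ a = B.a₁ ∨ a = B.a₂ ∨ a = B.a₃ ∨ a = B.a₄ := by
  simp only [roots, Finset.mem_insert, Finset.mem_singleton]

theorem quartic_eq_prod : B.quartic = ∏ a ∈ B.roots, (X - C a) := by
  refine funext fun x => ?_
  simp only [prod_roots, quartic, esymm₁, esymm₂, esymm₃, esymm₄, eval_add, eval_sub, eval_mul,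
    eval_pow, eval_X, eval_C]
  ring

theorem eval_quartic (x : ℝ) :
    B.quartic.eval x = (x - B.a₁) * (x - B.a₂) * (x - B.a₃) * (x - B.a₄) := by
  simp only [quartic_eq_prod, prod_roots, eval_mul, eval_sub, eval_X, eval_C]

theorem eval_quartic_neg_of_mem_left_gap {x : ℝ} (hx : x ∈ Ioo B.a₁ B.a₂) :
    B.quartic.eval x < 0 := by
  have h₃ : x < B.a₃ := hx.2.trans B.lt₂₃
  rw [eval_quartic]
  exact mul_neg_of_pos_of_neg (mul_pos_of_neg_of_neg
    (mul_neg_of_pos_of_neg (sub_pos.mpr hx.1) (sub_neg.mpr hx.2)) (sub_neg.mpr h₃))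
    (sub_neg.mpr (h₃.trans B.lt₃₄))

theorem eval_quartic_neg_of_mem_right_gap {x : ℝ} (hx : x ∈ Ioo B.a₃ B.a₄) :
    B.quartic.eval x < 0 := by
  have h₂ : B.a₂ < x := B.lt₂₃.trans hx.1
  rw [eval_quartic]
  exact mul_neg_of_pos_of_neg (mul_pos (mul_pos (sub_pos.mpr (B.lt₁₂.trans h₂)) (sub_pos.mpr h₂))
    (sub_pos.mpr hx.1)) (sub_neg.mpr hx.2)

/-- The differential `N / √P` has vanishing integrals over both gaps. -/
structure HasZeroGaps (N : ℝ[X]) : Prop where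
  left : gapIntegral B.roots N B.a₁ B.a₂ = 0
  right : gapIntegral B.roots N B.a₃ B.a₄ = 0

variable {B} {M N : ℝ[X]}

theorem HasZeroGaps.add (hM : B.HasZeroGaps M) (hN : B.HasZeroGaps N) :
    B.HasZeroGaps (M + N) :=
  ⟨by rw [gapIntegral_add, hM.left, hN.left, add_zero],
    by rw [gapIntegral_add, hM.right, hN.right, add_zero]⟩

theorem HasZeroGaps.const_mul (r : ℝ) (hN : B.HasZeroGaps N) : B.HasZeroGaps (C r * N) :=
  ⟨by rw [gapIntegral_C_mul, hN.left, mul_zero], by rw [gapIntegral_C_mul, hN.right, mul_zero]⟩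

theorem HasZeroGaps.sub (hM : B.HasZeroGaps M) (hN : B.HasZeroGaps N) :
    B.HasZeroGaps (M - N) := by
  have h := hM.add (hN.const_mul (-1))
  rwa [C_neg, C_1, neg_one_mul, ← sub_eq_add_neg] at h

theorem hasZeroGaps_of_exact (p : ℝ[X]) :
    B.HasZeroGaps (derivative p * B.quartic + C (1 / 2) * p * derivative B.quartic) where
  left := gapIntegral_eq_zero_of_exact B.quartic_eq_prod p (by simp [mem_roots])
    (by simp [mem_roots]) B.lt₁₂.le fun _ => B.eval_quartic_neg_of_mem_left_gap
  right := gapIntegral_eq_zero_of_exact B.quartic_eq_prod p (by simp [mem_roots])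
    (by simp [mem_roots]) B.lt₃₄.le fun _ => B.eval_quartic_neg_of_mem_right_gap

theorem HasZeroGaps.num₁ {c : ℝ} (h : B.HasZeroGaps (B.num₀ c)) : B.HasZeroGaps (B.num₁ c) := by
  have h_exact := (hasZeroGaps_of_exact (B := B) 1).const_mul 2
  rw [derivative_one, zero_mul, zero_add, mul_one, ← mul_assoc, ← C_mul] at h_exact
  norm_num at h_exact
  exact (h_exact.add (h.const_mul _)).const_mul _

theorem HasZeroGaps.num₂ {c : ℝ} (h : B.HasZeroGaps (B.num₀ c)) : B.HasZeroGaps (B.num₂ c) := by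
  have h_exact := hasZeroGaps_of_exact (B := B) X
  rw [derivative_X, one_mul] at h_exact
  exact ((h_exact.add (h.num₁.const_mul _)).sub (h.const_mul _)).const_mul _

end BranchPoints

section Elliptic

variable {m : ℝ}

theorem one_sub_mul_sin_sq_pos (hm : m < 1) (y : ℝ) : 0 < 1 - m * Real.sin y ^ 2 := by
  have h_sin := Real.sin_sq_le_one y
  rcases (sq_nonneg (Real.sin y)).eq_or_lt with h | h
  · rw [← h]
    norm_num
  · nlinarith

theorem sqrt_one_sub_mul_sin_sq_pos (hm : m < 1) (y : ℝ) : 0 < √(1 - m * Real.sin y ^ 2) :=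
  Real.sqrt_pos.mpr (one_sub_mul_sin_sq_pos hm y)

theorem continuous_div_sqrt_one_sub (hm : m < 1) {f : ℝ → ℝ} (hf : Continuous f) :
    Continuous fun y => f y / √(1 - m * Real.sin y ^ 2) :=
  hf.div (by fun_prop) fun y => (sqrt_one_sub_mul_sin_sq_pos hm y).ne'

theorem ellipticK_pos (hm : m < 1) : 0 < ellipticK m :=
  intervalIntegral.intervalIntegral_pos_of_pos
    ((continuous_div_sqrt_one_sub hm continuous_const).intervalIntegrable _ _)
    (fun y => one_div_pos.mpr (sqrt_one_sub_mul_sin_sq_pos hm y)) Real.pi_div_two_pos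

theorem ellipticE_lt_ellipticK (h₀ : 0 < m) (hm : m < 1) : ellipticE m < ellipticK m := by
  have hK : Continuous fun y => 1 / √(1 - m * Real.sin y ^ 2) :=
    continuous_div_sqrt_one_sub hm continuous_const
  have hE : Continuous fun y => √(1 - m * Real.sin y ^ 2) := by fun_prop
  rw [← sub_pos, ellipticE, ellipticK, ← intervalIntegral.integral_sub
    (hK.intervalIntegrable _ _) (hE.intervalIntegrable _ _)]
  refine intervalIntegral.intervalIntegral_pos_of_pos_on ((hK.sub hE).intervalIntegrable _ _)
    (fun y hy => ?_) Real.pi_div_two_pos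
  have h_sin : 0 < Real.sin y := Real.sin_pos_of_mem_Ioo ⟨hy.1, by linarith [hy.2, Real.pi_pos]⟩
  have h_lt : 1 - m * Real.sin y ^ 2 < 1 := sub_lt_self _ (by positivity)
  rw [sub_pos, lt_div_iff₀ (sqrt_one_sub_mul_sin_sq_pos hm y),
    Real.mul_self_sqrt (one_sub_mul_sin_sq_pos hm y).le]
  exact h_lt

end Elliptic

namespace BranchPoints

variable (B : BranchPoints)

/-- The elliptic parameter `m` of the curve `w ^ 2 = P(z)`. -/
noncomputable def modulus : ℝ :=
  (B.a₃ - B.a₄) * (B.a₁ - B.a₂) / ((B.a₂ - B.a₄) * (B.a₁ - B.a₃))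

/-- The square of the scale relating `dx / √|P|` to the normalised elliptic differential. -/
def scale : ℝ := (B.a₂ - B.a₄) * (B.a₁ - B.a₃)

/-- The denominator of the substitution `gapParam`. -/
noncomputable def gapDenom (y : ℝ) : ℝ := (B.a₄ - B.a₂) + (B.a₂ - B.a₁) * Real.sin y ^ 2

/-- The Möbius substitution `sin² y = (a₄ - a₂)(x - a₁) / ((a₂ - a₁)(a₄ - x))`, which maps
`(0, π / 2)` onto the left gap. -/
noncomputable def gapParam (y : ℝ) : ℝ :=
  B.a₄ - (B.a₄ - B.a₂) * (B.a₄ - B.a₁) / B.gapDenom y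

theorem scale_pos : 0 < B.scale :=
  mul_pos_of_neg_of_neg (by linarith [B.lt₂₃, B.lt₃₄]) (by linarith [B.lt₁₂, B.lt₂₃])

theorem scale_mul_modulus : B.scale * B.modulus = (B.a₃ - B.a₄) * (B.a₁ - B.a₂) :=
  mul_div_cancel₀ _ B.scale_pos.ne'

theorem modulus_pos : 0 < B.modulus :=
  div_pos (mul_pos_of_neg_of_neg (sub_neg.mpr B.lt₃₄) (sub_neg.mpr B.lt₁₂)) B.scale_pos

theorem modulus_lt_one : B.modulus < 1 := by
  have h : 0 < (B.a₄ - B.a₁) * (B.a₃ - B.a₂) :=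
    mul_pos (by linarith [B.lt₁₂, B.lt₂₃, B.lt₃₄]) (sub_pos.mpr B.lt₂₃)
  refine (div_lt_one B.scale_pos).mpr ?_
  rw [scale]
  linarith

theorem gapDenom_pos (y : ℝ) : 0 < B.gapDenom y :=
  add_pos_of_pos_of_nonneg (sub_pos.mpr (B.lt₂₃.trans B.lt₃₄))
    (mul_nonneg (sub_pos.mpr B.lt₁₂).le (sq_nonneg _))

theorem gapParam_sub_a₁ (y : ℝ) : B.gapParam y - B.a₁ =
    (B.a₂ - B.a₁) * (B.a₄ - B.a₁) * Real.sin y ^ 2 / B.gapDenom y := by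
  have h := (B.gapDenom_pos y).ne'
  rw [gapParam]
  field_simp
  rw [gapDenom]
  ring

theorem gapParam_sub_a₂ (y : ℝ) : B.gapParam y - B.a₂ =
    -((B.a₄ - B.a₂) * (B.a₂ - B.a₁) * Real.cos y ^ 2 / B.gapDenom y) := by
  have h := (B.gapDenom_pos y).ne'
  rw [gapParam, Real.cos_sq']
  field_simp
  rw [gapDenom]
  ring

theorem gapParam_sub_a₃ (y : ℝ) : B.gapParam y - B.a₃ =
    -(B.scale * (1 - B.modulus * Real.sin y ^ 2) / B.gapDenom y) := by
  have h := (B.gapDenom_pos y).ne'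
  rw [mul_sub, ← mul_assoc, scale_mul_modulus, gapParam]
  field_simp
  rw [gapDenom, scale]
  ring

theorem gapParam_sub_a₄ (y : ℝ) : B.gapParam y - B.a₄ =
    -((B.a₄ - B.a₂) * (B.a₄ - B.a₁) / B.gapDenom y) := by
  rw [gapParam]
  ring

theorem hasDerivAt_gapDenom (y : ℝ) :
    HasDerivAt B.gapDenom ((B.a₂ - B.a₁) * (2 * Real.sin y * Real.cos y)) y := by
  refine ((((Real.hasDerivAt_sin y).pow 2).const_mul _).const_add _).congr_deriv ?_
  push_cast
  ring

theorem hasDerivAt_gapParam (y : ℝ) :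
    HasDerivAt B.gapParam (2 * ((B.a₄ - B.a₂) * (B.a₄ - B.a₁) * (B.a₂ - B.a₁) * Real.sin y *
      Real.cos y / B.gapDenom y ^ 2)) y := by
  refine (((hasDerivAt_const y ((B.a₄ - B.a₂) * (B.a₄ - B.a₁))).div (B.hasDerivAt_gapDenom y)
    (B.gapDenom_pos y).ne').const_sub B.a₄).congr_deriv ?_
  ring

theorem continuous_gapParam : Continuous B.gapParam :=
  continuous_iff_continuousAt.mpr fun y => (B.hasDerivAt_gapParam y).continuousAt

theorem gapParam_mem_left_gap {y : ℝ} (hy : y ∈ Ioo 0 (Real.pi / 2)) :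
    B.gapParam y ∈ Ioo B.a₁ B.a₂ := by
  have h_denom := B.gapDenom_pos y
  have h_sin : 0 < Real.sin y := Real.sin_pos_of_mem_Ioo ⟨hy.1, by linarith [hy.1, hy.2]⟩
  have h_cos : 0 < Real.cos y := Real.cos_pos_of_mem_Ioo ⟨by linarith [hy.1, hy.2], hy.2⟩
  have h₂₁ := sub_pos.mpr B.lt₁₂
  have h₄₂ := sub_pos.mpr (B.lt₂₃.trans B.lt₃₄)
  have h₄₁ := sub_pos.mpr (B.lt₁₂.trans (B.lt₂₃.trans B.lt₃₄))
  constructor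
  · rw [← sub_pos, gapParam_sub_a₁]
    positivity
  · rw [← sub_neg, gapParam_sub_a₂, neg_lt_zero]
    positivity

theorem exists_gapParam_eq {x : ℝ} (hx : x ∈ Ioo B.a₁ B.a₂) :
    ∃ y ∈ Ioo 0 (Real.pi / 2), B.gapParam y = x := by
  have h₂₁ := sub_pos.mpr B.lt₁₂
  have h₄₂ := sub_pos.mpr (B.lt₂₃.trans B.lt₃₄)
  have h₄₁ := sub_pos.mpr (B.lt₁₂.trans (B.lt₂₃.trans B.lt₃₄))
  have h₁ := sub_pos.mpr hx.1
  have h₂ := sub_pos.mpr hx.2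
  have h₄ : 0 < B.a₄ - x := by linarith
  obtain ⟨t, ht⟩ : ∃ t, t = (B.a₄ - B.a₂) * (x - B.a₁) / ((B.a₂ - B.a₁) * (B.a₄ - x)) := ⟨_, rfl⟩
  have ht₀ : 0 < t := ht ▸ by positivity
  have ht₁ : t < 1 := by
    rw [ht, div_lt_one (by positivity)]
    nlinarith [mul_pos h₂ h₄₁]
  have h_sqrt : √t < 1 := by
    rw [Real.sqrt_lt' one_pos]
    simpa using ht₁
  refine ⟨Real.arcsin √t, ⟨Real.arcsin_pos.mpr (Real.sqrt_pos.mpr ht₀),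
    Real.arcsin_lt_pi_div_two.mpr h_sqrt⟩, ?_⟩
  have h_denom : (B.a₄ - B.a₂) + (B.a₂ - B.a₁) * t =
      (B.a₄ - B.a₂) * (B.a₄ - B.a₁) / (B.a₄ - x) := by
    rw [ht]
    field_simp
    ring
  rw [gapParam, gapDenom, Real.sin_arcsin (by linarith [Real.sqrt_nonneg t]) h_sqrt.le,
    Real.sq_sqrt ht₀.le, h_denom]
  field_simp
  ring

theorem image_gapParam : B.gapParam '' Ioo 0 (Real.pi / 2) = Ioo B.a₁ B.a₂ :=
  Subset.antisymm (image_subset_iff.mpr fun _ => B.gapParam_mem_left_gap)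
    fun _ => B.exists_gapParam_eq

theorem injOn_gapParam : InjOn B.gapParam (Ioo 0 (Real.pi / 2)) := by
  intro y hy z hz h
  have h_num : (B.a₄ - B.a₂) * (B.a₄ - B.a₁) ≠ 0 :=
    (mul_pos (sub_pos.mpr (B.lt₂₃.trans B.lt₃₄))
      (sub_pos.mpr (B.lt₁₂.trans (B.lt₂₃.trans B.lt₃₄)))).ne'
  have h_denom : B.gapDenom z = B.gapDenom y := by
    rw [gapParam, gapParam, sub_right_inj,
      div_eq_div_iff (B.gapDenom_pos y).ne' (B.gapDenom_pos z).ne'] at h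
    exact mul_left_cancel₀ h_num h
  have h_sq : Real.sin y ^ 2 = Real.sin z ^ 2 :=
    (mul_left_cancel₀ (sub_pos.mpr B.lt₁₂).ne' (add_left_cancel h_denom)).symm
  have h_sin_nonneg : ∀ x ∈ Ioo 0 (Real.pi / 2), 0 ≤ Real.sin x := fun x hx =>
    Real.sin_nonneg_of_mem_Icc ⟨hx.1.le, by linarith [hx.1, hx.2]⟩
  have h_mem : ∀ x ∈ Ioo 0 (Real.pi / 2), x ∈ Icc (-(Real.pi / 2)) (Real.pi / 2) := fun x hx =>
    ⟨by linarith [hx.1, hx.2], hx.2.le⟩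
  exact Real.injOn_sin (h_mem y hy) (h_mem z hz)
    ((pow_left_inj₀ (h_sin_nonneg y hy) (h_sin_nonneg z hz) two_ne_zero).mp h_sq)

theorem absInvRoot_gapParam {y : ℝ} (hy : y ∈ Ioo 0 (Real.pi / 2)) :
    absInvRoot B.roots (B.gapParam y) =
      ((B.a₄ - B.a₂) * (B.a₄ - B.a₁) * (B.a₂ - B.a₁) * Real.sin y * Real.cos y /
        B.gapDenom y ^ 2 * (√B.scale * √(1 - B.modulus * Real.sin y ^ 2)))⁻¹ := by
  have h_scale := B.scale_pos
  have h_root := one_sub_mul_sin_sq_pos B.modulus_lt_one y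
  have h_sin : 0 < Real.sin y := Real.sin_pos_of_mem_Ioo ⟨hy.1, by linarith [hy.1, hy.2]⟩
  have h_cos : 0 < Real.cos y := Real.cos_pos_of_mem_Ioo ⟨by linarith [hy.1, hy.2], hy.2⟩
  have h₂₁ := sub_pos.mpr B.lt₁₂
  have h₄₂ := sub_pos.mpr (B.lt₂₃.trans B.lt₃₄)
  have h₄₁ := sub_pos.mpr (B.lt₁₂.trans (B.lt₂₃.trans B.lt₃₄))
  have h_denom := B.gapDenom_pos y
  have h_eval : B.quartic.eval (B.gapParam y) =
      -(((B.a₄ - B.a₂) * (B.a₄ - B.a₁) * (B.a₂ - B.a₁) * Real.sin y * Real.cos y /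
        B.gapDenom y ^ 2) ^ 2 * (B.scale * (1 - B.modulus * Real.sin y ^ 2))) := by
    rw [eval_quartic, gapParam_sub_a₁, gapParam_sub_a₂, gapParam_sub_a₃, gapParam_sub_a₄]
    field_simp
  rw [absInvRoot_eq_inv_sqrt, ← quartic_eq_prod, h_eval, abs_neg, abs_of_nonneg (by positivity),
    Real.sqrt_mul (by positivity), Real.sqrt_sq (by positivity), Real.sqrt_mul (by positivity)]

theorem gapIntegral_eq_integral_gapParam (N : ℝ[X]) :
    gapIntegral B.roots N B.a₁ B.a₂ = 2 / √B.scale *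
      ∫ y in (0 : ℝ)..(Real.pi / 2),
        N.eval (B.gapParam y) / √(1 - B.modulus * Real.sin y ^ 2) := by
  have h_scale := Real.sqrt_pos.mpr B.scale_pos
  rw [gapIntegral, ← B.image_gapParam, integral_image_eq_integral_abs_deriv_smul measurableSet_Ioo
    (fun y _ => (B.hasDerivAt_gapParam y).hasDerivWithinAt) B.injOn_gapParam,
    intervalIntegral.integral_of_le Real.pi_div_two_pos.le, integral_Ioc_eq_integral_Ioo,
    ← integral_const_mul]
  refine setIntegral_congr_fun measurableSet_Ioo fun y hy => ?_
  have h_sin : 0 < Real.sin y := Real.sin_pos_of_mem_Ioo ⟨hy.1, by linarith [hy.1, hy.2]⟩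
  have h_cos : 0 < Real.cos y := Real.cos_pos_of_mem_Ioo ⟨by linarith [hy.1, hy.2], hy.2⟩
  have h₂₁ := sub_pos.mpr B.lt₁₂
  have h₄₂ := sub_pos.mpr (B.lt₂₃.trans B.lt₃₄)
  have h₄₁ := sub_pos.mpr (B.lt₁₂.trans (B.lt₂₃.trans B.lt₃₄))
  have h_denom := B.gapDenom_pos y
  have := sqrt_one_sub_mul_sin_sq_pos B.modulus_lt_one y
  rw [B.absInvRoot_gapParam hy, smul_eq_mul, abs_of_nonneg (by positivity)]
  field_simp

/-- With `Δ = √(1 - m sin² y)`, the derivative of a multiple of `sin y cos y Δ / gapDenom y` is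
the pullback of `num₀ / √P` up to a combination of `Δ` and `1 / Δ`. -/
theorem hasDerivAt_gapPrimitive (c y : ℝ) :
    HasDerivAt (fun y => (B.a₃ - B.a₁) * (B.a₂ - B.a₁) * (B.a₄ - B.a₂) / 2 *
        (Real.sin y * Real.cos y * √(1 - B.modulus * Real.sin y ^ 2) / B.gapDenom y))
      ((B.num₀ c).eval (B.gapParam y) / √(1 - B.modulus * Real.sin y ^ 2) -
        (B.scale / 2 * √(1 - B.modulus * Real.sin y ^ 2) +
          (c - (B.a₁ * B.a₂ + B.a₃ * B.a₄) / 2) * (1 / √(1 - B.modulus * Real.sin y ^ 2)))) y := by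
  have h_pos := one_sub_mul_sin_sq_pos B.modulus_lt_one y
  have h_denom := (B.gapDenom_pos y).ne'
  have h_sqrt : HasDerivAt (fun y => √(1 - B.modulus * Real.sin y ^ 2))
      (-(B.modulus * (2 * Real.sin y * Real.cos y)) / (2 * √(1 - B.modulus * Real.sin y ^ 2))) y :=
    ((((Real.hasDerivAt_sin y).pow 2).const_mul _).const_sub 1 |>.sqrt h_pos.ne').congr_deriv
      (by simp only [Pi.pow_apply]; push_cast; ring)
  refine (((((Real.hasDerivAt_sin y).mul (Real.hasDerivAt_cos y)).mul h_sqrt).div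
    (B.hasDerivAt_gapDenom y) h_denom).const_mul _).congr_deriv ?_
  have h_sq : √(1 - B.modulus * Real.sin y ^ 2) ^ 2 = 1 - B.modulus * Real.sin y ^ 2 :=
    Real.sq_sqrt h_pos.le
  have h_root := (sqrt_one_sub_mul_sin_sq_pos B.modulus_lt_one y).ne'
  have h_cos := Real.cos_sq' y
  have h_modulus := B.scale_mul_modulus
  simp only [num₀, eval_add, eval_sub, eval_mul, eval_pow, eval_X, eval_C, gapParam,
    Pi.mul_apply]
  generalize √(1 - B.modulus * Real.sin y ^ 2) = r at *
  have h_num : B.gapDenom y = (B.a₄ - B.a₂) + (B.a₂ - B.a₁) * Real.sin y ^ 2 := rfl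
  rw [scale] at h_modulus ⊢
  generalize B.gapDenom y = d at *
  generalize B.modulus = m at *
  generalize Real.sin y = s at *
  generalize Real.cos y = k at *
  rw [esymm₁]
  field_simp
  rw [h_sq, h_cos, h_num]
  linear_combination ((B.a₂ - B.a₁) * (-(s ^ 2 * (1 - 2 * s ^ 2) + s ^ 2 * (1 - s ^ 2)) *
    (B.a₄ - B.a₂ + (B.a₂ - B.a₁) * s ^ 2) + 2 * (B.a₂ - B.a₁) * s ^ 4 * (1 - s ^ 2)) -
    s ^ 2 * (B.a₄ - B.a₂ + (B.a₂ - B.a₁) * s ^ 2) ^ 2) * h_modulus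

theorem gapIntegral_num₀_eq_elliptic (c : ℝ) :
    gapIntegral B.roots (B.num₀ c) B.a₁ B.a₂ = 2 / √B.scale *
      (B.scale / 2 * ellipticE B.modulus +
        (c - (B.a₁ * B.a₂ + B.a₃ * B.a₄) / 2) * ellipticK B.modulus) := by
  have h_num : Continuous fun y =>
      (B.num₀ c).eval (B.gapParam y) / √(1 - B.modulus * Real.sin y ^ 2) :=
    continuous_div_sqrt_one_sub B.modulus_lt_one ((B.num₀ c).continuous.comp B.continuous_gapParam)
  have hE : Continuous fun y => B.scale / 2 * √(1 - B.modulus * Real.sin y ^ 2) := by fun_prop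
  have hK : Continuous fun y => (c - (B.a₁ * B.a₂ + B.a₃ * B.a₄) / 2) *
      (1 / √(1 - B.modulus * Real.sin y ^ 2)) :=
    continuous_const.mul (continuous_div_sqrt_one_sub B.modulus_lt_one continuous_const)
  have hEK := intervalIntegral.integral_add (hE.intervalIntegrable 0 (Real.pi / 2))
    (hK.intervalIntegrable 0 (Real.pi / 2)) (μ := volume)
  have h_exact := intervalIntegral.integral_eq_sub_of_hasDerivAt (a := 0) (b := Real.pi / 2)
    (fun y _ => B.hasDerivAt_gapPrimitive c y)
    ((h_num.sub (hE.add hK)).intervalIntegrable _ _)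
  rw [intervalIntegral.integral_sub (h_num.intervalIntegrable _ _)
    (by exact (hE.add hK).intervalIntegrable _ _), hEK, intervalIntegral.integral_const_mul,
    intervalIntegral.integral_const_mul, ← ellipticE, ← ellipticK] at h_exact
  simp only [Real.cos_pi_div_two, Real.sin_zero, zero_mul, mul_zero, zero_div, sub_zero]
    at h_exact
  rw [gapIntegral_eq_integral_gapParam, sub_eq_zero.mp h_exact]

/-- The ratio `E / K` of the complete elliptic integrals at the parameter `modulus`. -/
noncomputable def ellipticRatio : ℝ := ellipticE B.modulus / ellipticK B.modulus

theorem ellipticRatio_lt_one : B.ellipticRatio < 1 :=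
  (div_lt_one (ellipticK_pos B.modulus_lt_one)).mpr
    (ellipticE_lt_ellipticK B.modulus_pos B.modulus_lt_one)

/-- The constant term of the numerator of the quasimomentum differential: the value of `c` for
which the integrals of `num₀ c / √P` over the gaps vanish. -/
noncomputable def normConst : ℝ :=
  (B.a₁ * B.a₂ + B.a₃ * B.a₄ - B.scale * B.ellipticRatio) / 2

theorem hasZeroGaps_num₀ : B.HasZeroGaps (B.num₀ B.normConst) := by
  have h_left : gapIntegral B.roots (B.num₀ B.normConst) B.a₁ B.a₂ = 0 := by
    rw [gapIntegral_num₀_eq_elliptic, normConst, ellipticRatio]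
    field_simp [(ellipticK_pos B.modulus_lt_one).ne']
    ring
  exact ⟨h_left, gapIntegral_num₀_eq B.normConst ▸ h_left⟩

variable {B} {c : ℝ} {N : ℝ[X]}

theorem setIntegral_kernel_mul_density_of_cos {f : ℝ → ℝ} (hf : ∀ z, absR₀ z = 0 → f z = 0)
    (h : ∀ α ∈ Ioo 0 Real.pi, (∃ k, ∀ x ∈ Ioo B.a₁ B.a₂, (cutPotential α x).im = k) →
      (∃ k, ∀ x ∈ Ioo B.a₃ B.a₄, (cutPotential α x).im = k) →
      ∫ x in B.bands, (cutPotential α x).re * density B.roots N x = f (Real.cos α))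
    {z : ℝ} (hz : z ∈ B.bands) : ∫ x in B.bands, kernel z x * density B.roots N x = f z := by
  by_cases hz₁ : z ^ 2 = 1
  · simp only [kernel_eq_zero_of_sq_eq_one hz₁, zero_mul, integral_zero]
    rw [hf z (by rw [absR₀, hz₁, sub_self, Real.sqrt_zero])]
  · obtain ⟨α, hα, rfl, h_left, h_right⟩ := exists_cos_eq_of_mem_bands hz hz₁
    rw [← h α hα h_left h_right]
    simp [cutPotential]

theorem setIntegral_kernel_mul_density_num₀ (h : B.HasZeroGaps (B.num₀ c)) {z : ℝ}
    (hz : z ∈ B.bands) :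
    ∫ x in B.bands, kernel z x * density B.roots (B.num₀ c) x = absR₀ z := by
  refine setIntegral_kernel_mul_density_of_cos (fun _ => id) ?_ hz
  rintro α hα ⟨k₁, hk₁⟩ ⟨k₂, hk₂⟩
  have h_res := setIntegral_num₀_add_gapIntegrals c (hasBoundaryValue_logPotential hα)
    (hasTaylor_logPotential α 1) hk₁ hk₂
  rw [h.left, h.right, mul_zero, mul_zero, sub_zero, add_zero,
    coeff_im_sum_sin_div α (by norm_num)] at h_res
  rw [mul_left_cancel₀ Real.pi_ne_zero h_res, absR₀_cos hα]
  norm_num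

theorem setIntegral_kernel_mul_density_num₁ (h : B.HasZeroGaps (B.num₀ c)) {z : ℝ}
    (hz : z ∈ B.bands) :
    ∫ x in B.bands, kernel z x * density B.roots (B.num₁ c) x = z * absR₀ z / 2 := by
  refine setIntegral_kernel_mul_density_of_cos (f := fun z => z * absR₀ z / 2)
    (fun z hz => by rw [hz, mul_zero, zero_div]) ?_ hz
  rintro α hα ⟨k₁, hk₁⟩ ⟨k₂, hk₂⟩
  have h_res := setIntegral_num₁_add_gapIntegrals c (hasBoundaryValue_logPotential hα)
    (hasTaylor_logPotential α 2) hk₁ hk₂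
  rw [h.num₁.left, h.num₁.right, mul_zero, mul_zero, sub_zero, add_zero,
    coeff_im_sum_sin_div α (by norm_num)] at h_res
  rw [mul_left_cancel₀ Real.pi_ne_zero h_res, absR₀_cos hα, Nat.cast_ofNat, Real.sin_two_mul]
  ring

theorem setIntegral_kernel_mul_density_num₂ (h : B.HasZeroGaps (B.num₀ c)) {z : ℝ}
    (hz : z ∈ B.bands) :
    ∫ x in B.bands, kernel z x * density B.roots (B.num₂ c) x =
      (1 / 6 + z ^ 2 / 3) * absR₀ z := by
  refine setIntegral_kernel_mul_density_of_cos (f := fun z => (1 / 6 + z ^ 2 / 3) * absR₀ z)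
    (fun z hz => by rw [hz, mul_zero]) ?_ hz
  rintro α hα ⟨k₁, hk₁⟩ ⟨k₂, hk₂⟩
  have h_res := setIntegral_num₂_add_gapIntegrals c (hasBoundaryValue_logPotential hα)
    (hasTaylor_logPotential α 3) hk₁ hk₂
  rw [h.num₂.left, h.num₂.right, mul_zero, mul_zero, sub_zero, add_zero,
    coeff_im_sum_sin_div α (by norm_num), coeff_im_sum_sin_div α (by norm_num)] at h_res
  rw [mul_left_cancel₀ Real.pi_ne_zero h_res, absR₀_cos hα, Nat.cast_one, one_mul,
    Nat.cast_ofNat, Real.sin_three_mul]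
  linear_combination -(1 / 3) * Real.sin α * Real.sin_sq_add_cos_sq α

end BranchPoints

section Duality

variable {Γ : Set ℝ} {u w : ℝ → ℝ} {S : Finset ℝ} {M : ℝ}

theorem abs_kernel_mul_le {z x : ℝ} (hz : z ∈ Icc (-1 : ℝ) 1) (hx : x ∈ Icc (-1 : ℝ) 1)
    (hw : |w x| ≤ M * absInvRoot S x) :
    |kernel z x * w x| ≤ 8 * M * (|x - z| ^ (-(1 / 4) : ℝ) * absInvRoot S x) := by
  rw [abs_mul]
  calc |kernel z x| * |w x| ≤ 8 * |x - z| ^ (-(1 / 4) : ℝ) * (M * absInvRoot S x) :=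
        mul_le_mul (abs_kernel_le hz hx) hw (abs_nonneg _) (by positivity)
    _ = _ := by ring

theorem integrableOn_kernel_mul (hΓ : Γ ⊆ Icc (-1) 1) (h_meas : MeasurableSet Γ)
    (hw_meas : Measurable w) (hw : ∀ x ∈ Γ, |w x| ≤ M * absInvRoot S x) {z : ℝ}
    (hz : z ∈ Icc (-1 : ℝ) 1) : IntegrableOn (fun x => kernel z x * w x) Γ := by
  refine Integrable.mono' (((integrableOn_abs_sub_rpow_mul_absInvRoot S z (-1) 1).mono_set
    hΓ).const_mul (8 * M)) ((measurable_kernel_left z).mul hw_meas).aestronglyMeasurable ?_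
  filter_upwards [ae_restrict_mem h_meas] with x hx
  exact abs_kernel_mul_le hz (hΓ hx) (hw x hx)

theorem exists_setIntegral_abs_kernel_mul_le (hΓ : Γ ⊆ Icc (-1) 1) (h_meas : MeasurableSet Γ)
    (hw_meas : Measurable w) (hM : 0 ≤ M) (hw : ∀ x ∈ Γ, |w x| ≤ M * absInvRoot S x) :
    ∃ K, ∀ z ∈ Icc (-1 : ℝ) 1, ∫ x in Γ, |kernel z x * w x| ≤ K := by
  obtain ⟨K, hK⟩ := exists_setIntegral_abs_sub_rpow_mul_absInvRoot_le S
  refine ⟨8 * M * K, fun z hz => ?_⟩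
  have h_int := integrableOn_abs_sub_rpow_mul_absInvRoot S z (-1) 1
  calc ∫ x in Γ, |kernel z x * w x|
      ≤ ∫ x in Γ, 8 * M * (|x - z| ^ (-(1 / 4) : ℝ) * absInvRoot S x) :=
        setIntegral_mono_on (integrableOn_kernel_mul hΓ h_meas hw_meas hw hz).abs
          ((h_int.mono_set hΓ).const_mul _) h_meas
          fun x hx => abs_kernel_mul_le hz (hΓ hx) (hw x hx)
    _ = 8 * M * ∫ x in Γ, |x - z| ^ (-(1 / 4) : ℝ) * absInvRoot S x := integral_const_mul _ _
    _ ≤ 8 * M * ∫ x in Icc (-1) 1, |x - z| ^ (-(1 / 4) : ℝ) * absInvRoot S x := by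
        refine mul_le_mul_of_nonneg_left (setIntegral_mono_set h_int (ae_of_all _ fun x => ?_)
          (ae_of_all _ hΓ)) (by positivity)
        exact mul_nonneg (Real.rpow_nonneg (abs_nonneg _) _) (absInvRoot_nonneg S x)
    _ ≤ 8 * M * K := mul_le_mul_of_nonneg_left (hK z hz) (by positivity)

theorem integrable_mul_kernel_mul (hΓ : Γ ⊆ Icc (-1) 1) (h_meas : MeasurableSet Γ)
    (hu : IntegrableOn u Γ) (hw_meas : Measurable w) (hM : 0 ≤ M)
    (hw : ∀ x ∈ Γ, |w x| ≤ M * absInvRoot S x) :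
    Integrable (Function.uncurry fun z x => u z * (kernel z x * w x))
      ((volume.restrict Γ).prod (volume.restrict Γ)) := by
  obtain ⟨K, hK⟩ := exists_setIntegral_abs_kernel_mul_le hΓ h_meas hw_meas hM hw
  have h_aesm : AEStronglyMeasurable (Function.uncurry fun z x => u z * (kernel z x * w x))
      ((volume.restrict Γ).prod (volume.restrict Γ)) :=
    hu.aestronglyMeasurable.comp_fst.mul
      (measurable_kernel.mul (hw_meas.comp measurable_snd)).aestronglyMeasurable
  rw [integrable_prod_iff h_aesm]
  constructor
  · filter_upwards [ae_restrict_mem h_meas] with z hz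
    exact (integrableOn_kernel_mul hΓ h_meas hw_meas hw (hΓ hz)).const_mul (u z)
  · refine (hu.norm.mul_const K).mono' h_aesm.norm.integral_prod_right' ?_
    filter_upwards [ae_restrict_mem h_meas] with z hz
    simp only [Function.uncurry_apply_pair, norm_mul (u z), integral_const_mul]
    rw [norm_mul, norm_norm, Real.norm_of_nonneg (integral_nonneg fun x => norm_nonneg _)]
    exact mul_le_mul_of_nonneg_left (hK z (hΓ hz)) (norm_nonneg _)

theorem setIntegral_kernel_swap (hΓ : Γ ⊆ Icc (-1) 1) (h_meas : MeasurableSet Γ)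
    (hu : IntegrableOn u Γ) (hw_meas : Measurable w) (hM : 0 ≤ M)
    (hw : ∀ x ∈ Γ, |w x| ≤ M * absInvRoot S x) :
    ∫ z in Γ, u z * ∫ x in Γ, kernel z x * w x =
      ∫ x in Γ, w x * ∫ z in Γ, kernel x z * u z := by
  have h_swap :=
    integral_integral_swap (integrable_mul_kernel_mul hΓ h_meas hu hw_meas hM hw)
  simp only [← integral_const_mul]
  rw [h_swap]
  refine integral_congr_ae (ae_of_all _ fun x => integral_congr_ae (ae_of_all _ fun z => ?_))
  simp only [kernel_comm x z]
  ring

theorem measurable_density (S : Finset ℝ) (N : ℝ[X]) : Measurable (density S N) :=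
  (N.continuous.measurable.mul
    (Complex.measurable_re.comp (measurable_cutInvRoot S))).const_mul _

theorem exists_abs_density_le (S : Finset ℝ) (N : ℝ[X]) :
    ∃ M, 0 ≤ M ∧ ∀ x ∈ Icc (-1 : ℝ) 1, |density S N x| ≤ M * absInvRoot S x := by
  obtain ⟨C, hC⟩ := (isCompact_Icc (a := (-1 : ℝ)) (b := 1)).exists_bound_of_continuousOn
    N.continuous.continuousOn
  have hC₀ : 0 ≤ C := (norm_nonneg _).trans (hC 0 (by norm_num))
  have h_pi : 0 ≤ Real.pi⁻¹ := inv_nonneg.mpr Real.pi_nonneg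
  refine ⟨Real.pi⁻¹ * C, mul_nonneg h_pi hC₀, fun x hx => ?_⟩
  have h_re := Complex.abs_re_le_norm (cutInvRoot S x)
  rw [norm_cutInvRoot] at h_re
  rw [density, abs_mul, abs_mul, abs_of_nonneg h_pi, mul_assoc]
  exact mul_le_mul_of_nonneg_left (mul_le_mul (hC x hx) h_re (abs_nonneg _) hC₀) h_pi

theorem integrableOn_density (S : Finset ℝ) (N : ℝ[X]) :
    IntegrableOn (density S N) (Icc (-1) 1) := by
  obtain ⟨M, -, hM⟩ := exists_abs_density_le S N
  refine Integrable.mono' (((locallyIntegrable_absInvRoot S).integrableOn_isCompact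
    isCompact_Icc).const_mul M) (measurable_density S N).aestronglyMeasurable ?_
  filter_upwards [ae_restrict_mem measurableSet_Icc] with x hx
  exact hM x hx

theorem SolvesNDR.setIntegral_mul_eq {f g : ℝ → ℝ} {N : ℝ[X]} (hΓ : Γ ⊆ Icc (-1) 1)
    (h_meas : MeasurableSet Γ) (hu : SolvesNDR Γ (fun _ => 0) f u)
    (hg : ∀ z ∈ Γ, ∫ x in Γ, kernel z x * density S N x = g z) :
    ∫ z in Γ, u z * g z = ∫ x in Γ, f x * density S N x := by
  obtain ⟨M, hM, h_le⟩ := exists_abs_density_le S N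
  have h_eq : ∀ x ∈ Γ, ∫ z in Γ, kernel x z * u z = f x := fun x hx => by
    simpa only [zero_mul, add_zero] using hu.equation x hx
  calc ∫ z in Γ, u z * g z = ∫ z in Γ, u z * ∫ x in Γ, kernel z x * density S N x :=
        setIntegral_congr_fun h_meas fun z hz => by simp only [hg z hz]
    _ = ∫ x in Γ, density S N x * ∫ z in Γ, kernel x z * u z :=
        setIntegral_kernel_swap hΓ h_meas hu.integrableOn (measurable_density S N) hM
          fun x hx => h_le x (hΓ hx)
    _ = ∫ x in Γ, f x * density S N x :=
        setIntegral_congr_fun h_meas fun x hx => by simp only [h_eq x hx, mul_comm (f x)]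

theorem solvesNDR_density {f : ℝ → ℝ} {N : ℝ[X]} (hΓ : Γ ⊆ Icc (-1) 1) (h_meas : MeasurableSet Γ)
    (hf : ∀ z ∈ Γ, ∫ x in Γ, kernel z x * density S N x = f z) :
    SolvesNDR Γ (fun _ => 0) f (density S N) where
  integrableOn := (integrableOn_density S N).mono_set hΓ
  kernel_integrableOn z hz := by
    obtain ⟨M, -, h_le⟩ := exists_abs_density_le S N
    exact integrableOn_kernel_mul hΓ h_meas (measurable_density S N)
      (fun x hx => h_le x (hΓ hx)) (hΓ hz)
  equation z hz := by rw [hf z hz, zero_mul, add_zero]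

end Duality

namespace BranchPoints

variable {B : BranchPoints} {c : ℝ} {u v : ℝ → ℝ}

theorem density_C_mul (S : Finset ℝ) (r : ℝ) (N : ℝ[X]) (x : ℝ) :
    density S (C r * N) x = r * density S N x := by
  rw [density, density, eval_mul, eval_C]
  ring

theorem isCondensate_density (h : B.HasZeroGaps (B.num₀ c)) :
    IsCondensate B.bands (density B.roots (B.num₀ c)) (density B.roots (C 4 * B.num₁ c)) where
  dos := solvesNDR_density B.bands_subset B.measurableSet_bands
    fun _ => setIntegral_kernel_mul_density_num₀ h
  dof := solvesNDR_density B.bands_subset B.measurableSet_bands fun z hz => by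
    simp only [density_C_mul, mul_left_comm _ (4 : ℝ)]
    rw [integral_const_mul, setIntegral_kernel_mul_density_num₁ h hz]
    ring

end BranchPoints

section CauchyIntegral

variable {Γ : Set ℝ} {φ : ℝ → ℂ}

theorem norm_ofReal_le_one {x : ℝ} (hx : x ∈ Icc (-1 : ℝ) 1) : ‖(x : ℂ)‖ ≤ 1 := by
  rw [Complex.norm_real]
  exact abs_le.mpr hx

theorem differentiableAt_integral_div_sub (hΓ : Γ ⊆ Icc (-1) 1) (h_meas : MeasurableSet Γ)
    (hφ : IntegrableOn φ Γ) {z : ℂ} (hz : 1 < ‖z‖) :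
    DifferentiableAt ℂ (fun z => ∫ x in Γ, φ x / (x - z)) z := by
  obtain ⟨δ, hδ, hδz⟩ : ∃ δ, 0 < δ ∧ 1 + 2 * δ = ‖z‖ := ⟨(‖z‖ - 1) / 2, by linarith, by ring⟩
  have h_far : ∀ x ∈ Γ, ∀ y ∈ Metric.ball z δ, δ ≤ ‖(x : ℂ) - y‖ := fun x hx y hy => by
    have h_yz := norm_sub_norm_le z y
    have h_xy := norm_sub_norm_le y x
    rw [Metric.mem_ball, dist_comm, dist_eq_norm] at hy
    rw [norm_sub_rev] at h_xy
    linarith [norm_ofReal_le_one (hΓ hx)]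
  have h_div_meas (y : ℂ) (n : ℕ) :
      AEStronglyMeasurable (fun x : ℝ => φ x / (x - y) ^ n) (volume.restrict Γ) :=
    hφ.aestronglyMeasurable.div₀ (by fun_prop)
  have h_le : ∀ x ∈ Γ, ∀ y ∈ Metric.ball z δ, ∀ n, ‖φ x / (x - y) ^ n‖ ≤ ‖φ x‖ / δ ^ n :=
    fun x hx y hy n => by
      rw [norm_div, norm_pow]
      exact div_le_div_of_nonneg_left (norm_nonneg _) (pow_pos hδ n)
        (pow_le_pow_left₀ hδ.le (h_far x hx y hy) n)
  have hz_ball := Metric.mem_ball_self (x := z) hδ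
  refine (hasDerivAt_integral_of_dominated_loc_of_deriv_le (μ := volume.restrict Γ)
    (F := fun z x => φ x / (x - z)) (F' := fun z x => φ x / (x - z) ^ 2)
    (bound := fun x => ‖φ x‖ / δ ^ 2) (Metric.ball_mem_nhds z hδ)
    (.of_forall fun y => by simpa using h_div_meas y 1) ?_ (h_div_meas z 2) ?_
    (hφ.norm.div_const _) ?_).2.differentiableAt
  · refine (hφ.norm.div_const δ).mono' (by simpa using h_div_meas z 1) ?_
    filter_upwards [ae_restrict_mem h_meas] with x hx
    simpa using h_le x hx z hz_ball 1
  · filter_upwards [ae_restrict_mem h_meas] with x hx y hy using h_le x hx y hy 2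
  · filter_upwards [ae_restrict_mem h_meas] with x hx y hy
    have h_ne : (x : ℂ) - y ≠ 0 := norm_pos_iff.mp (hδ.trans_le (h_far x hx y hy))
    refine ((((hasDerivAt_id y).const_sub (x : ℂ)).inv h_ne).const_mul (φ x)).congr_deriv ?_
    rw [neg_neg, one_div, div_eq_mul_inv, id]

theorem one_div_one_sub_sub_geom_sum {x : ℂ} (hx : x ≠ 1) (n : ℕ) :
    1 / (1 - x) - ∑ k ∈ Finset.range n, x ^ k = x ^ n / (1 - x) := by
  have h_ne : 1 - x ≠ 0 := sub_ne_zero.mpr hx.symm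
  rw [sub_eq_iff_eq_add, div_add' _ _ _ h_ne, mul_comm, mul_neg_geom_sum, add_sub_cancel]

theorem half_le_norm_one_sub_mul {x : ℝ} (hx : x ∈ Icc (-1 : ℝ) 1) {w : ℂ} (hw : ‖w‖ ≤ 1 / 2) :
    1 / 2 ≤ ‖1 - x * w‖ := by
  have h_sub := norm_sub_norm_le (1 : ℂ) (x * w)
  have h_mul := mul_le_of_le_one_left (norm_nonneg w) (norm_ofReal_le_one hx)
  rw [norm_one, norm_mul] at h_sub
  linarith

theorem hasTaylor_integral_div_one_sub_mul (hΓ : Γ ⊆ Icc (-1) 1) (h_meas : MeasurableSet Γ)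
    (hφ : IntegrableOn φ Γ) (n : ℕ) :
    HasTaylor (fun w => ∫ x in Γ, φ x / (1 - x * w)) n
      (∑ k ∈ Finset.range n, C (∫ x in Γ, φ x * x ^ k) * X ^ k) := by
  have h_moment : ∀ k : ℕ, IntegrableOn (fun x => φ x * (x : ℂ) ^ k) Γ := fun k => by
    refine hφ.norm.mono' (hφ.aestronglyMeasurable.mul (by fun_prop)) ?_
    filter_upwards [ae_restrict_mem h_meas] with x hx
    rw [norm_mul, norm_pow]
    exact mul_le_of_le_one_right (norm_nonneg _)
      (pow_le_one₀ (norm_nonneg _) (norm_ofReal_le_one (hΓ hx)))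
  refine IsBigO.of_bound (2 * ∫ x in Γ, ‖φ x‖) ?_
  filter_upwards [nhdsWithin_le_nhds (Metric.closedBall_mem_nhds (0 : ℂ) one_half_pos)] with w hw
  rw [mem_closedBall_zero_iff] at hw
  have h_inv : ∀ x ∈ Γ, ‖(1 - x * w : ℂ)‖⁻¹ ≤ 2 := fun x hx => by
    simpa using inv_anti₀ one_half_pos (half_le_norm_one_sub_mul (hΓ hx) hw)
  have h_div : IntegrableOn (fun x => φ x / (1 - x * w)) Γ := by
    refine (hφ.norm.mul_const 2).mono' (hφ.aestronglyMeasurable.div₀ (by fun_prop)) ?_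
    filter_upwards [ae_restrict_mem h_meas] with x hx
    rw [norm_div, div_eq_mul_inv]
    exact mul_le_mul_of_nonneg_left (h_inv x hx) (norm_nonneg _)
  simp only [eval_finsetSum, eval_C_mul, eval_pow, eval_X, ← integral_mul_const]
  rw [← integral_finsetSum _ fun k _ => (h_moment k).mul_const _,
    ← integral_sub h_div (integrable_finsetSum _ fun k _ => (h_moment k).mul_const _),
    mul_assoc, ← integral_mul_const, ← integral_const_mul]
  refine norm_integral_le_of_norm_le ((hφ.norm.mul_const _).const_mul 2) ?_
  filter_upwards [ae_restrict_mem h_meas] with x hx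
  have h_ne : (x * w : ℂ) ≠ 1 := fun h => by
    have := half_le_norm_one_sub_mul (hΓ hx) hw
    rw [h, sub_self, norm_zero] at this
    linarith
  have h_rem : φ x / (1 - x * w) - ∑ k ∈ Finset.range n, φ x * x ^ k * w ^ k =
      φ x * w ^ n * (x ^ n * (1 - x * w : ℂ)⁻¹) := by
    simp only [mul_assoc, ← mul_pow, ← Finset.mul_sum]
    rw [← mul_one_div, ← mul_sub, one_div_one_sub_sub_geom_sum h_ne]
    ring
  rw [h_rem, norm_mul, norm_mul, norm_mul, norm_pow (x : ℂ), norm_inv, mul_comm (2 : ℝ)]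
  refine mul_le_mul_of_nonneg_left ?_ (by positivity)
  exact (mul_le_of_le_one_left (by positivity)
    (pow_le_one₀ (norm_nonneg _) (norm_ofReal_le_one (hΓ hx)))).trans (h_inv x hx)

end CauchyIntegral

section R₀

theorem R₀_eq (z : ℂ) : R₀ z = z * diskSqrt 0 (Complex.I * z⁻¹) := by
  rw [R₀, diskSqrt, mul_pow, Complex.I_sq, Complex.ofReal_zero]
  ring_nf

theorem norm_I_mul_inv_lt_one {z : ℂ} (hz : 1 < ‖z‖) : ‖Complex.I * z⁻¹‖ < 1 := by
  rw [norm_mul, Complex.norm_I, one_mul, norm_inv]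
  exact inv_lt_one_of_one_lt₀ hz

theorem R₀_ne_zero {z : ℂ} (hz : 1 < ‖z‖) : R₀ z ≠ 0 := by
  rw [R₀_eq]
  exact mul_ne_zero (norm_pos_iff.mp (one_pos.trans hz))
    (diskSqrt_ne_zero (quadratic_mem_slitPlane (by norm_num) (norm_I_mul_inv_lt_one hz)))

theorem differentiableAt_R₀ {z : ℂ} (hz : 1 < ‖z‖) : DifferentiableAt ℂ R₀ z := by
  have h_inv : DifferentiableAt ℂ (fun z : ℂ => Complex.I * z⁻¹) z :=
    (differentiableAt_inv (norm_pos_iff.mp (one_pos.trans hz))).const_mul _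
  rw [funext R₀_eq]
  have h_sqrt : DifferentiableAt ℂ (fun z => diskSqrt 0 (Complex.I * z⁻¹)) z :=
    (differentiableAt_diskSqrt
      (quadratic_mem_slitPlane (by norm_num) (norm_I_mul_inv_lt_one hz))).fun_comp' z h_inv
  exact differentiableAt_id.mul h_sqrt

theorem tendsto_diskSqrt_I_mul :
    Tendsto (fun w => diskSqrt 0 (Complex.I * w)) (𝓝[≠] 0) (𝓝 1) := by
  have h_cont : ContinuousAt (fun w => diskSqrt 0 (Complex.I * w)) 0 :=
    (differentiableAt_diskSqrt (by simp)).continuousAt.comp (by fun_prop)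
  simpa [diskSqrt_zero] using h_cont.tendsto.mono_left nhdsWithin_le_nhds

theorem hasTaylor_diskSqrt_I_mul : HasTaylor (fun w => diskSqrt 0 (Complex.I * w)) 5
    (1 - C (1 / 2) * X ^ 2 - C (1 / 8) * X ^ 4) := by
  refine .of_sq (.of_eq_add (r := fun w => -(w / 8 + w ^ 3 / 64)) (by fun_prop) fun w _ => ?_)
    (by simp) (by simpa using tendsto_diskSqrt_I_mul)
  rw [diskSqrt_sq, mul_pow, Complex.I_sq]
  simp only [eval_pow, eval_sub, eval_mul, eval_one, eval_C, eval_X, Complex.ofReal_zero]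
  ring

theorem hasTaylor_one_div_diskSqrt_I_mul :
    HasTaylor (fun w => 1 / diskSqrt 0 (Complex.I * w)) 5
      (1 + C (1 / 2) * X ^ 2 + C (3 / 8) * X ^ 4) := by
  refine .div (.of_eq_add (r := fun w => w / 4 + 3 * w ^ 3 / 64) (by fun_prop) fun w _ => ?_)
    hasTaylor_diskSqrt_I_mul one_ne_zero tendsto_diskSqrt_I_mul
  simp only [eval_mul, eval_add, eval_sub, eval_pow, eval_one, eval_C, eval_X]
  ring

end R₀

section Moments

variable {Γ : Set ℝ} {u v : ℝ → ℝ}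

/-- The `k`-th moment of the density `u |R₀|` on `Γ`. -/
noncomputable def moment (Γ : Set ℝ) (u : ℝ → ℝ) (k : ℕ) : ℝ := ∫ x in Γ, u x * (x ^ k * absR₀ x)

theorem abs_absR₀_le_one (x : ℝ) : |absR₀ x| ≤ 1 := by
  rw [absR₀, abs_of_nonneg (Real.sqrt_nonneg _), Real.sqrt_le_one]
  linarith [sq_nonneg x]

theorem integrableOn_mul_pow_mul_absR₀ (hΓ : Γ ⊆ Icc (-1) 1) (h_meas : MeasurableSet Γ)
    (hu : IntegrableOn u Γ) (k : ℕ) : IntegrableOn (fun x => u x * (x ^ k * absR₀ x)) Γ := by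
  have h_cont : Continuous fun x : ℝ => x ^ k * absR₀ x := by
    unfold absR₀
    fun_prop
  refine hu.mul_bdd (c := 1) h_cont.aestronglyMeasurable ?_
  filter_upwards [ae_restrict_mem h_meas] with x hx
  rw [Real.norm_eq_abs, abs_mul, abs_pow]
  exact mul_le_one₀ (pow_le_one₀ (abs_nonneg x) (abs_le.mpr (hΓ hx))) (abs_nonneg _)
    (abs_absR₀_le_one x)

theorem integrableOn_ofReal_mul_absR₀ (hΓ : Γ ⊆ Icc (-1) 1) (h_meas : MeasurableSet Γ)
    (hu : IntegrableOn u Γ) : IntegrableOn (fun x => ((u x * absR₀ x : ℝ) : ℂ)) Γ := by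
  simpa [IntegrableOn] using (integrableOn_mul_pow_mul_absR₀ hΓ h_meas hu 0).ofReal (𝕜 := ℂ)

theorem integral_ofReal_mul_pow (u : ℝ → ℝ) (k : ℕ) :
    ∫ x in Γ, ((u x * absR₀ x : ℝ) : ℂ) * (x : ℂ) ^ k = moment Γ u k := by
  rw [moment, ← integral_complex_ofReal]
  congr 1 with x
  push_cast
  ring

theorem I_mul_integral_R₀cut (u : ℝ → ℝ) (z : ℂ) :
    Complex.I * ∫ ζ in Γ, (u ζ : ℂ) * R₀cut ζ / ((ζ : ℂ) - z) =
      -∫ ζ in Γ, ((u ζ * absR₀ ζ : ℝ) : ℂ) / ((ζ : ℂ) - z) := by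
  rw [← integral_const_mul, ← integral_neg]
  congr 1 with ζ
  rw [R₀cut]
  push_cast
  linear_combination (u ζ * absR₀ ζ / (ζ - z) : ℂ) * Complex.I_sq

theorem integral_div_sub_inv (φ : ℝ → ℂ) {w : ℂ} (hw : w ≠ 0) :
    ∫ x in Γ, φ x / ((x : ℂ) - w⁻¹) = -(w * ∫ x in Γ, φ x / (1 - x * w)) := by
  rw [← integral_const_mul, ← integral_neg]
  congr 1 with x
  rw [show (x : ℂ) - w⁻¹ = -(1 - x * w) * w⁻¹ by field_simp; ring, ← div_div, div_inv_eq_mul,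
    div_neg]
  ring

theorem dpdz_eq (u : ℝ → ℝ) (z : ℂ) :
    dpdz Γ u z = (z + ∫ ζ in Γ, ((u ζ * absR₀ ζ : ℝ) : ℂ) / ((ζ : ℂ) - z)) / R₀ z := by
  rw [dpdz, div_mul_eq_mul_div, I_mul_integral_R₀cut]
  ring

theorem dqdz_eq (v : ℝ → ℝ) (z : ℂ) :
    dqdz Γ v z =
      2 * R₀ z + (2 * z ^ 2 + ∫ ζ in Γ, ((v ζ * absR₀ ζ : ℝ) : ℂ) / ((ζ : ℂ) - z)) / R₀ z := by
  rw [dqdz, div_mul_eq_mul_div, I_mul_integral_R₀cut]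
  ring

theorem differentiableAt_dpdz (hΓ : Γ ⊆ Icc (-1) 1) (h_meas : MeasurableSet Γ)
    (hu : IntegrableOn u Γ) {z : ℂ} (hz : 1 < ‖z‖) : DifferentiableAt ℂ (dpdz Γ u) z := by
  rw [funext (dpdz_eq u)]
  exact (differentiableAt_id.add (differentiableAt_integral_div_sub hΓ h_meas
    (integrableOn_ofReal_mul_absR₀ hΓ h_meas hu) hz)).div (differentiableAt_R₀ hz) (R₀_ne_zero hz)

theorem differentiableAt_dqdz (hΓ : Γ ⊆ Icc (-1) 1) (h_meas : MeasurableSet Γ)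
    (hv : IntegrableOn v Γ) {z : ℂ} (hz : 1 < ‖z‖) : DifferentiableAt ℂ (dqdz Γ v) z := by
  rw [funext (dqdz_eq v)]
  have h_sq : DifferentiableAt ℂ (fun z : ℂ => 2 * z ^ 2) z := by fun_prop
  exact ((differentiableAt_R₀ hz).const_mul 2).add ((h_sq.add
    (differentiableAt_integral_div_sub hΓ h_meas (integrableOn_ofReal_mul_absR₀ hΓ h_meas hv)
      hz)).div (differentiableAt_R₀ hz) (R₀_ne_zero hz))

theorem hasTaylor_cauchyTransform (hΓ : Γ ⊆ Icc (-1) 1) (h_meas : MeasurableSet Γ)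
    (hu : IntegrableOn u Γ) :
    HasTaylor (fun w => ∫ x in Γ, ((u x * absR₀ x : ℝ) : ℂ) / (1 - x * w)) 5
      (∑ k ∈ Finset.range 5, C (moment Γ u k : ℂ) * X ^ k) := by
  simpa only [integral_ofReal_mul_pow] using hasTaylor_integral_div_one_sub_mul hΓ h_meas
    (integrableOn_ofReal_mul_absR₀ hΓ h_meas hu) 5

theorem R₀_inv (w : ℂ) : R₀ w⁻¹ = diskSqrt 0 (Complex.I * w) / w := by
  rw [R₀_eq, inv_inv, inv_mul_eq_div]

theorem hasTaylor_dpdz (hΓ : Γ ⊆ Icc (-1) 1) (h_meas : MeasurableSet Γ) (hu : IntegrableOn u Γ) :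
    HasTaylor (fun w => dpdz Γ u w⁻¹) 5
      ((1 + C (1 / 2) * X ^ 2 + C (3 / 8) * X ^ 4) *
        (1 - X ^ 2 * ∑ k ∈ Finset.range 5, C (moment Γ u k : ℂ) * X ^ k)) := by
  have h_num := (hasTaylor_eval 5 1).sub
    ((hasTaylor_eval 5 (X ^ 2)).mul (hasTaylor_cauchyTransform hΓ h_meas hu))
  refine (hasTaylor_one_div_diskSqrt_I_mul.mul h_num).congr_fun ?_
  filter_upwards [self_mem_nhdsWithin] with w hw
  rw [dpdz_eq, R₀_inv, integral_div_sub_inv _ hw]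
  have hw : w ≠ 0 := hw
  simp only [eval_one, eval_pow, eval_X]
  rw [div_div_eq_mul_div, one_div_mul_eq_div]
  congr 1
  field_simp
  ring

theorem hasTaylor_dqdz (hΓ : Γ ⊆ Icc (-1) 1) (h_meas : MeasurableSet Γ) (hv : IntegrableOn v Γ) :
    HasTaylor (fun w => w ^ 1 * dqdz Γ v w⁻¹) 5
      ((1 + C (1 / 2) * X ^ 2 + C (3 / 8) * X ^ 4) *
        (C 4 - C 2 * X ^ 2 - X ^ 3 * ∑ k ∈ Finset.range 5, C (moment Γ v k : ℂ) * X ^ k)) := by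
  have h_num := (hasTaylor_eval 5 (C 4 - C 2 * X ^ 2)).sub
    ((hasTaylor_eval 5 (X ^ 3)).mul (hasTaylor_cauchyTransform hΓ h_meas hv))
  refine (hasTaylor_one_div_diskSqrt_I_mul.mul h_num).congr_fun ?_
  filter_upwards [self_mem_nhdsWithin, tendsto_diskSqrt_I_mul.eventually_ne one_ne_zero]
    with w hw h_ne
  have hw : w ≠ 0 := hw
  have h_sq : diskSqrt 0 (Complex.I * w) ^ 2 = 1 - w ^ 2 := by
    rw [diskSqrt_sq, mul_pow, Complex.I_sq, Complex.ofReal_zero]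
    ring
  rw [dqdz_eq, R₀_inv, integral_div_sub_inv _ hw]
  simp only [eval_sub, eval_mul, eval_C, eval_pow, eval_X]
  field_simp
  rw [h_sq]
  ring

theorem coeffI_one (hΓ : Γ ⊆ Icc (-1) 1) (h_meas : MeasurableSet Γ) (hu : IntegrableOn u Γ) :
    coeffI Γ u 1 = moment Γ u 0 - 1 / 2 := by
  have h := laurentCoeff_eq_coeff (m := 1) (j := 0) (fun z => differentiableAt_dpdz hΓ h_meas hu)
    (((hasTaylor_dpdz hΓ h_meas hu).mono (by norm_num)).congr_fun (by simp))
  rw [coeffI, h]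
  simp [coeff_mul, Finset.Nat.antidiagonal_succ, Finset.sum_range_succ, coeff_X_pow, coeff_X,
    coeff_one, coeff_C]
  ring

theorem coeffI_three (hΓ : Γ ⊆ Icc (-1) 1) (h_meas : MeasurableSet Γ) (hu : IntegrableOn u Γ) :
    coeffI Γ u 3 = moment Γ u 2 + moment Γ u 0 / 2 - 3 / 8 := by
  have h := laurentCoeff_eq_coeff (m := 3) (j := 0) (fun z => differentiableAt_dpdz hΓ h_meas hu)
    ((hasTaylor_dpdz hΓ h_meas hu).congr_fun (by simp))
  rw [coeffI, h]
  simp [coeff_mul, Finset.Nat.antidiagonal_succ, Finset.sum_range_succ, coeff_X_pow, coeff_X,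
    coeff_one, coeff_C]
  ring

theorem coeffJ_two (hΓ : Γ ⊆ Icc (-1) 1) (h_meas : MeasurableSet Γ) (hv : IntegrableOn v Γ) :
    coeffJ Γ v 2 = moment Γ v 1 - 1 / 2 := by
  have h := laurentCoeff_eq_coeff (m := 2) (j := 1) (fun z => differentiableAt_dqdz hΓ h_meas hv)
    (hasTaylor_dqdz hΓ h_meas hv)
  rw [coeffJ, h]
  simp [coeff_mul, Finset.Nat.antidiagonal_succ, Finset.sum_range_succ, coeff_X_pow, coeff_X,
    coeff_one, coeff_C]
  ring

end Moments

namespace BranchPoints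

variable (B : BranchPoints)

theorem four_mul_scale_mul_ellipticRatio_lt :
    4 * ((B.a₂ - B.a₄) * (B.a₁ - B.a₃)) * B.ellipticRatio < (B.a₁ + B.a₂ - B.a₃ - B.a₄) ^ 2 := by
  calc 4 * ((B.a₂ - B.a₄) * (B.a₁ - B.a₃)) * B.ellipticRatio
      < 4 * ((B.a₂ - B.a₄) * (B.a₁ - B.a₃)) :=
        mul_lt_of_lt_one_right (mul_pos four_pos B.scale_pos) B.ellipticRatio_lt_one
    _ ≤ (B.a₁ + B.a₂ - B.a₃ - B.a₄) ^ 2 := by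
        linarith [sq_nonneg ((B.a₄ - B.a₂) - (B.a₃ - B.a₁))]

variable {B} {c : ℝ} {u v : ℝ → ℝ}

theorem moment_zero_dos (h : B.HasZeroGaps (B.num₀ c)) (hu : IsDOS B.bands (fun _ => 0) u) :
    moment B.bands u 0 = 1 / 2 - (c - B.sqrtCoeff₀) := by
  simp only [moment, pow_zero, one_mul]
  rw [SolvesNDR.setIntegral_mul_eq B.bands_subset B.measurableSet_bands hu
    fun _ => setIntegral_kernel_mul_density_num₀ h, setIntegral_absR₀_mul_density_num₀]

theorem moment_two_dos (h : B.HasZeroGaps (B.num₀ c)) (hu : IsDOS B.bands (fun _ => 0) u) :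
    moment B.bands u 2 = 3 / 8 - moment B.bands u 0 / 2 - 3 * (B.numCoeff₂ c - B.sqrtCoeff₂) := by
  have h_int := integrableOn_mul_pow_mul_absR₀ B.bands_subset B.measurableSet_bands hu.integrableOn
  have h_split : ∫ x in B.bands, u x * ((1 / 6 + x ^ 2 / 3) * absR₀ x) =
      1 / 6 * moment B.bands u 0 + 1 / 3 * moment B.bands u 2 := by
    rw [moment, moment, ← integral_const_mul, ← integral_const_mul,
      ← integral_add ((h_int 0).const_mul _) ((h_int 2).const_mul _)]
    congr 1 with x
    ring
  rw [SolvesNDR.setIntegral_mul_eq B.bands_subset B.measurableSet_bands hu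
    fun _ => setIntegral_kernel_mul_density_num₂ h, setIntegral_absR₀_mul_density_num₂] at h_split
  linarith

theorem moment_one_dof (h : B.HasZeroGaps (B.num₀ c)) (hv : IsDOF B.bands (fun _ => 0) v) :
    moment B.bands v 1 =
      1 / 2 - (2 * B.esymm₁ * (B.numCoeff₁ c - B.sqrtCoeff₁) - 4 * B.sqrtCoeff₂) := by
  have h_dual := SolvesNDR.setIntegral_mul_eq B.bands_subset B.measurableSet_bands hv
    fun _ => setIntegral_kernel_mul_density_num₁ h
  have h_density : ∀ x, 2 * x * absR₀ x * density B.roots (B.num₁ c) x =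
      2 * (absR₀ x * density B.roots (X * B.num₁ c) x) := fun x => by
    simp only [density, eval_mul, eval_X]
    ring
  simp only [h_density, integral_const_mul, mul_div_assoc', integral_div,
    setIntegral_absR₀_mul_density_X_mul_num₁] at h_dual
  simp only [moment, pow_one]
  linarith

theorem meanF₁_eq (h : B.HasZeroGaps (B.num₀ c)) (hu : IsDOS B.bands (fun _ => 0) u) :
    meanF₁ B.bands u = 2 * (c - B.sqrtCoeff₀) := by
  rw [meanF₁, coeffI_one B.bands_subset B.measurableSet_bands hu.integrableOn,
    moment_zero_dos h hu]
  ring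

theorem meanF₃_eq (h : B.HasZeroGaps (B.num₀ c)) (hu : IsDOS B.bands (fun _ => 0) u) :
    meanF₃ B.bands u = 8 * (B.numCoeff₂ c - B.sqrtCoeff₂) := by
  rw [meanF₃, coeffI_three B.bands_subset B.measurableSet_bands hu.integrableOn,
    moment_two_dos h hu]
  ring

theorem meanG₂_eq (h : B.HasZeroGaps (B.num₀ c)) (hv : IsDOF B.bands (fun _ => 0) v) :
    meanG₂ B.bands v = 4 * B.esymm₁ * (B.numCoeff₁ c - B.sqrtCoeff₁) - 8 * B.sqrtCoeff₂ := by
  rw [meanG₂, coeffJ_two B.bands_subset B.measurableSet_bands hv.integrableOn,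
    moment_one_dof h hv]
  ring

theorem meanSq_eq (h : B.HasZeroGaps (B.num₀ c)) (hu : IsDOS B.bands (fun _ => 0) u) :
    meanSq B.bands u = 2 * c + (B.esymm₁ ^ 2 / 4 - B.esymm₂) := by
  rw [meanSq, meanF₁_eq h hu, sqrtCoeff₀]
  ring

theorem meanFourth_eq (h : B.HasZeroGaps (B.num₀ c)) (huv : IsCondensate B.bands u v) :
    meanFourth B.bands u v = (B.esymm₁ ^ 2 - 8 / 3 * B.esymm₂) * c +
      (B.esymm₁ ^ 2 / 4 - B.esymm₂) ^ 2 + (4 * B.esymm₄ - B.esymm₁ * B.esymm₃) / 3 := by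
  rw [meanFourth, meanF₃_eq h huv.dos, meanG₂_eq h huv.dof, numCoeff₂, numCoeff₁, sqrtCoeff₂,
    sqrtCoeff₁, sqrtCoeff₀]
  ring

end BranchPoints

end DefNLS

theorem mainTheorem9 (a₁ a₂ a₃ a₄ : ℝ) (h₀₁ : -1 ≤ a₁) (h₁₂ : a₁ < a₂) (h₂₃ : a₂ < a₃)
    (h₃₄ : a₃ < a₄) (h₄₅ : a₄ ≤ 1)
    (Γ : Set ℝ) (hΓ : Γ = DefNLS.genusOneSupport a₁ a₂ a₃ a₄)
    (m μ A B C D : ℝ)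
    (hm : m = ((a₃ - a₄) * (-a₂ + a₁)) / ((a₂ - a₄) * (-a₃ + a₁)))
    (hμ : μ = DefNLS.ellipticE m / DefNLS.ellipticK m)
    (hA : A = -8 * (-a₄ + a₂) * (-a₃ + a₁)
      * (4 * (a₁ ^ 2 + a₂ ^ 2 + a₃ ^ 2 + a₄ ^ 2) - (a₁ + a₂ + a₃ + a₄) ^ 2))
    (hB : B = 3 * a₁ ^ 4 + (12 * a₂ - 12 * a₃ - 12 * a₄) * a₁ ^ 3
      + (2 * a₂ ^ 2 + (-20 * a₃ - 20 * a₄) * a₂ + 18 * a₃ ^ 2 + 20 * a₄ * a₃ + 18 * a₄ ^ 2) * a₁ ^ 2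
      + (12 * a₂ ^ 3 - 4 * (a₃ + a₄) * (5 * a₂ ^ 2 - 5 * a₃ * a₂ - 5 * a₄ * a₂
          + 3 * a₃ ^ 2 + 2 * a₄ * a₃ + 3 * a₄ ^ 2)) * a₁
      + 3 * a₂ ^ 4 + (-12 * a₃ - 12 * a₄) * a₂ ^ 3
      + (18 * a₃ ^ 2 + 20 * a₄ * a₃ + 18 * a₄ ^ 2) * a₂ ^ 2
      + (-12 * a₃ ^ 3 - 20 * a₃ ^ 2 * a₄ - 20 * a₃ * a₄ ^ 2 - 12 * a₄ ^ 3) * a₂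
      + 3 * a₃ ^ 4 + 12 * a₃ ^ 3 * a₄ + 2 * a₃ ^ 2 * a₄ ^ 2 + 12 * a₃ * a₄ ^ 3 + 3 * a₄ ^ 4)
    (hC : C = 4 * (-a₄ + a₂) * (-a₃ + a₁))
    (hD : D = -(a₁ + a₂ - a₃ - a₄) ^ 2) :
    (∃ u v : ℝ → ℝ, DefNLS.IsCondensate Γ u v) ∧
    ∀ u v : ℝ → ℝ, DefNLS.IsCondensate Γ u v →
      0 < DefNLS.meanSq Γ u ∧ C * μ + D ≠ 0 ∧
      DefNLS.kurtosis Γ u v = (A * μ + B) / (3 * (C * μ + D) ^ 2) := by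
  obtain ⟨b, rfl, rfl, rfl, rfl⟩ : ∃ b : DefNLS.BranchPoints,
      b.a₁ = a₁ ∧ b.a₂ = a₂ ∧ b.a₃ = a₃ ∧ b.a₄ = a₄ :=
    ⟨⟨a₁, a₂, a₃, a₄, h₀₁, h₁₂, h₂₃, h₃₄, h₄₅⟩, rfl, rfl, rfl, rfl⟩
  obtain rfl : Γ = b.bands := hΓ
  have h_ratio : μ = b.ellipticRatio := by
    rw [hμ, hm, neg_add_eq_sub, neg_add_eq_sub, ← DefNLS.BranchPoints.modulus,
      ← DefNLS.BranchPoints.ellipticRatio]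
  have h_neg : C * μ + D < 0 := by
    rw [hC, hD, h_ratio]
    linarith [b.four_mul_scale_mul_ellipticRatio_lt]
  refine ⟨⟨_, _, DefNLS.BranchPoints.isCondensate_density b.hasZeroGaps_num₀⟩, fun u v huv => ?_⟩
  have h_sq : DefNLS.meanSq b.bands u = -(C * μ + D) / 4 := by
    rw [DefNLS.BranchPoints.meanSq_eq b.hasZeroGaps_num₀ huv.dos, hC, hD, h_ratio,
      DefNLS.BranchPoints.normConst, DefNLS.BranchPoints.scale, DefNLS.BranchPoints.esymm₁,
      DefNLS.BranchPoints.esymm₂]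
    ring
  have h_fourth : DefNLS.meanFourth b.bands u v = (A * μ + B) / 48 := by
    rw [DefNLS.BranchPoints.meanFourth_eq b.hasZeroGaps_num₀ huv, hA, hB, h_ratio]
    simp only [DefNLS.BranchPoints.normConst, DefNLS.BranchPoints.scale,
      DefNLS.BranchPoints.esymm₁, DefNLS.BranchPoints.esymm₂, DefNLS.BranchPoints.esymm₃,
      DefNLS.BranchPoints.esymm₄]
    ring
  refine ⟨by linarith, h_neg.ne, ?_⟩
  rw [DefNLS.kurtosis, h_sq, h_fourth]
  field_simp [h_neg.ne]
  ring
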